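/- Let $\mathcal H\subset\mathbb R^2$ be a finite set of mutually non-parallel (non-zero) vectors, let $C_\alpha$ ($\alpha\in\mathcal H$) be non-zero complex constants, and let $$L=-\Big(\frac{\partial^2}{\partial x_1^2}+\frac{\partial^2}{\partial x_2^2}\Big)+\sum_{\alpha\in\mathcal H}\frac{C_\alpha}{\langle\alpha,x\rangle^2}.$$ Assume that $L$ commutes with a differential operator $P=\sum_p a_p(x)\,\partial_x^p$ with rational coefficients $a_p\in\mathbb C(x_1,x_2)$, whose principal symbol $\widetilde P_0(\xi)=\sum_{|p|=\operatorname{ord}P}a_p\,\xi^p$ does not depend on $x$ and is not a polynomial in $\xi_1^2+\xi_2^2$. Call $(\mathcal H,C)$ and $(\mathcal H',C')$ equivalent if there are $g\in O(2)$ and non-zero real numbers $k_\alpha$ ($\alpha\in\mathcal H$) with $\mathcal H'=\{k_\alpha\, g\alpha:\alpha\in\mathcal H\}$ and $C'_{k_\alpha g\alpha}=k_\alpha^2C_\alpha$; two sets $\mathcal H$, $\mathcal H'$ are equivalent if the first of these conditions holds. Say that $\mathcal H$ is of type $A_1\times A_1$ (respectively $A_2$) if it is equivalent to a positive system of a root system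 of that type. Let $e_1,e_2$ be the standard basis of $\mathbb R^2$. 1. If $\#\mathcal H=2$, then the two vectors of $\mathcal H$ are orthogonal; hence $\mathcal H$ is of type $A_1\times A_1$. 2. If $\#\mathcal H=3$, then $\mathcal H$ is equivalent to $\{e_1,\ a e_1+e_2,\ -a e_1+e_2\}$ for some real $a\neq0$. Moreover, if $\mathcal H$ is not of type $A_2$, then whenever $(\mathcal H,C)$ is equivalent to $(\mathcal H',C')$ with $\mathcal H'=\{e_1,\ a e_1+e_2,\ -a e_1+e_2\}$, $a\neq0$, the coupling constants of $\pm a e_1+e_2$ are one, that is $C'_{\pm a e_1+e_2}=2(a^2+1)$, and $L$ is the deformed $A_2$ operator of Chalykh, Feigin and Veselov, that is also $C'_{e_1}=\dfrac{1-a^4}{4a^4}$. 3. If $\#\mathcal H=4$, then $\mathcal H$ is equivalent to $\{e_1,\ e_2,\ a e_1+e_2,\ -a e_1+e_2\}$ for some real $a\neq0$. -/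

import Mathlib

open MvPolynomial

noncomputable section

namespace RankTwo

/-- The Euclidean plane `ℝ²`, containing the singular locus. -/
abbrev Plane : Type := EuclideanSpace ℝ (Fin 2)

/-- The field `ℂ(x₁, x₂)` of rational functions in the two coordinates. -/
abbrev RatFun : Type := FractionRing (MvPolynomial (Fin 2) ℂ)

/-- The coordinate function `xᵢ` as a rational function. -/
def coord (i : Fin 2) : RatFun := algebraMap (MvPolynomial (Fin 2) ℂ) RatFun (X i)

/-! ### Partial derivatives of rational functions

The partial derivative in the direction `i` is the unique `ℂ`-linear derivation of
`ℂ(x₁, x₂)` that extends the partial derivative of polynomials. It is obtained as the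
`ε`-part of the ring homomorphism `f(x) ↦ f(x + ε eᵢ)` into the dual numbers. -/

/-- `f(x) ↦ f(x + ε eᵢ)` on polynomials. -/
def shiftPoly (i : Fin 2) : MvPolynomial (Fin 2) ℂ →ₐ[ℂ] TrivSqZeroExt RatFun RatFun :=
  aeval fun j => TrivSqZeroExt.inl (coord j) + TrivSqZeroExt.inr (if j = i then 1 else 0)

theorem fst_shiftPoly (i : Fin 2) (p : MvPolynomial (Fin 2) ℂ) :
    (shiftPoly i p).fst = algebraMap (MvPolynomial (Fin 2) ℂ) RatFun p := by
  have h : (TrivSqZeroExt.fstHom ℂ RatFun RatFun).comp (shiftPoly i) =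
      IsScalarTower.toAlgHom ℂ (MvPolynomial (Fin 2) ℂ) RatFun := by
    apply MvPolynomial.algHom_ext
    intro j
    simp only [AlgHom.comp_apply, shiftPoly, aeval_X, TrivSqZeroExt.fstHom_apply,
      TrivSqZeroExt.fst_add, TrivSqZeroExt.fst_inl, TrivSqZeroExt.fst_inr, add_zero]
    rfl
  exact DFunLike.congr_fun h p

theorem snd_shiftPoly (i : Fin 2) (p : MvPolynomial (Fin 2) ℂ) :
    (shiftPoly i p).snd = algebraMap (MvPolynomial (Fin 2) ℂ) RatFun (pderiv i p) := by
  induction p using MvPolynomial.induction_on with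
  | C a =>
    have : shiftPoly i (C a) = algebraMap ℂ _ a := by simp [shiftPoly]
    rw [this, pderiv_C, map_zero]
    rfl
  | add p q hp hq => simp [hp, hq]
  | mul_X p j hp =>
    rw [map_mul, TrivSqZeroExt.snd_mul, hp, fst_shiftPoly, pderiv_mul, pderiv_X]
    by_cases h : j = i
    · subst h
      simp [shiftPoly, coord, add_comm]
    · simp [shiftPoly, coord, h]

/-- `f(x) ↦ f(x + ε eᵢ)` on rational functions. -/
def shift (i : Fin 2) : RatFun →ₐ[ℂ] TrivSqZeroExt RatFun RatFun :=
  IsLocalization.liftAlgHom (M := nonZeroDivisors (MvPolynomial (Fin 2) ℂ)) (f := shiftPoly i)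
    (by
      intro y
      rw [TrivSqZeroExt.isUnit_iff_isUnit_fst, fst_shiftPoly]
      exact IsLocalization.map_units RatFun y)

theorem shift_algebraMap (i : Fin 2) (p : MvPolynomial (Fin 2) ℂ) :
    shift i (algebraMap (MvPolynomial (Fin 2) ℂ) RatFun p) = shiftPoly i p := by
  simp [shift]

theorem fst_shift (i : Fin 2) (f : RatFun) : (shift i f).fst = f := by
  have h : (TrivSqZeroExt.fstHom ℂ RatFun RatFun).comp (shift i) = AlgHom.id ℂ RatFun := by
    apply IsLocalization.algHom_ext (nonZeroDivisors (MvPolynomial (Fin 2) ℂ))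
    apply AlgHom.ext
    intro p
    exact (congrArg TrivSqZeroExt.fst (shift_algebraMap i p)).trans (fst_shiftPoly i p)
  exact DFunLike.congr_fun h f

/-- The partial derivative `∂/∂xᵢ` of rational functions. -/
def pd (i : Fin 2) : Derivation ℂ RatFun RatFun :=
  Derivation.mk' ((TrivSqZeroExt.sndHom RatFun RatFun).restrictScalars ℂ ∘ₗ (shift i).toLinearMap)
    (by
      intro a b
      simp [fst_shift, mul_comm])

/-- On polynomials, `pd i` is the usual partial derivative. -/
theorem pd_algebraMap (i : Fin 2) (p : MvPolynomial (Fin 2) ℂ) :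
    pd i (algebraMap (MvPolynomial (Fin 2) ℂ) RatFun p) =
      algebraMap (MvPolynomial (Fin 2) ℂ) RatFun (pderiv i p) := by
  simp [pd, shift_algebraMap, snd_shiftPoly]

/-! ### Differential operators with rational coefficients -/

/-- The operator `∂/∂xᵢ` on `ℂ(x₁, x₂)`. -/
def partialOp (i : Fin 2) : Module.End ℂ RatFun := (pd i : RatFun →ₗ[ℂ] RatFun)

/-- The operator of multiplication by the rational function `f`. -/
def mulOp (f : RatFun) : Module.End ℂ RatFun := LinearMap.mulLeft ℂ f

/-- The differential operator `∑ₚ aₚ(x) ∂ₓᵖ` whose full symbol is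
`σ = ∑ₚ aₚ(x) ξᵖ ∈ ℂ(x₁, x₂)[ξ₁, ξ₂]`. -/
def diffOp (σ : MvPolynomial (Fin 2) RatFun) : Module.End ℂ RatFun :=
  ∑ p ∈ σ.support, mulOp (σ.coeff p) * (partialOp 0 ^ p 0 * partialOp 1 ^ p 1)

/-- The principal symbol: the part of the full symbol of top degree in `ξ`
(the order of the operator is `σ.totalDegree`). -/
def principalSymbol (σ : MvPolynomial (Fin 2) RatFun) : MvPolynomial (Fin 2) RatFun :=
  homogeneousComponent σ.totalDegree σ

/-- The linear function `x_α = ⟨α, x⟩`. -/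
def linForm (α : Plane) : RatFun := ∑ i, algebraMap ℂ RatFun (α i : ℂ) * coord i

/-- The potential `R(x) = ∑_{α ∈ H} C_α / ⟨α, x⟩²`. -/
def potential (H : Finset Plane) (C : Plane → ℂ) : RatFun :=
  ∑ α ∈ H, algebraMap ℂ RatFun (C α) / linForm α ^ 2

/-- The Schrödinger operator `L = -(∂₁² + ∂₂²) + R(x)`. -/
def schrodinger (H : Finset Plane) (C : Plane → ℂ) : Module.End ℂ RatFun :=
  -(partialOp 0 ^ 2 + partialOp 1 ^ 2) + mulOp (potential H C)

/-- `L` commutes with a differential operator `P` whose principal symbol is constant with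
respect to `x`, and is not a polynomial in `ξ₁² + ξ₂²`. -/
def HasNontrivialCommutant (H : Finset Plane) (C : Plane → ℂ) : Prop :=
  ∃ (σ : MvPolynomial (Fin 2) RatFun) (p₀ : MvPolynomial (Fin 2) ℂ),
    Commute (schrodinger H C) (diffOp σ) ∧
    principalSymbol σ = map (algebraMap ℂ RatFun) p₀ ∧
    ∀ q : Polynomial ℂ, p₀ ≠ Polynomial.aeval (X 0 ^ 2 + X 1 ^ 2) q

/-! ### Singular loci -/

/-- The vectors of `H` are mutually non-parallel. -/
def MutuallyNonParallel (H : Finset Plane) : Prop :=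
  ∀ α ∈ H, ∀ β ∈ H, α ≠ β → LinearIndependent ℝ ![α, β]

/-- Two singular loci are equivalent if one is obtained from the other by an element of `O(2)`
followed by multiplication of each vector by a non-zero scalar. -/
def LocusEquiv (S S' : Set Plane) : Prop :=
  ∃ (g : Plane ≃ₗᵢ[ℝ] Plane) (k : Plane → ℝ),
    (∀ α ∈ S, k α ≠ 0) ∧ S' = (fun α => k α • g α) '' S

/-- Equivalence of singular loci with constants: besides `α ↦ k α • g α`, the constant `C_α` is
multiplied by `k_α²`, so that `C_α / ⟨α, x⟩²` is unchanged up to the rotation `g`. -/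
def LocusEquivWith (S : Set Plane) (C : Plane → ℂ) (S' : Set Plane) (C' : Plane → ℂ) : Prop :=
  ∃ (g : Plane ≃ₗᵢ[ℝ] Plane) (k : Plane → ℝ),
    (∀ α ∈ S, k α ≠ 0) ∧ S' = (fun α => k α • g α) '' S ∧
    ∀ α ∈ S, C' (k α • g α) = (k α : ℂ) ^ 2 * C α

/-- The coupling constant of `α` is one: `C_α = 1 · 2 |α|²`. -/
def CouplingOne (C : Plane → ℂ) (α : Plane) : Prop := C α = 2 * (‖α‖ : ℂ) ^ 2

/-- A root system of type `A₁ × A₁` in the plane. -/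
def IsA1A1RootSystem (Φ : Set Plane) : Prop :=
  ∃ α β : Plane, α ≠ 0 ∧ β ≠ 0 ∧ inner ℝ α β = 0 ∧ Φ = {α, -α, β, -β}

/-- A root system of type `A₂` in the plane: simple roots of equal length at an angle of `120°`. -/
def IsA2RootSystem (Φ : Set Plane) : Prop :=
  ∃ α β : Plane, α ≠ 0 ∧ ‖α‖ = ‖β‖ ∧ 2 * inner ℝ α β = -‖α‖ ^ 2 ∧
    Φ = {α, -α, β, -β, α + β, -(α + β)}

/-- `S` is a positive system of `Φ`: the roots on one side of a line through the origin that
contains no root. -/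
def IsPositiveSystem (Φ S : Set Plane) : Prop :=
  ∃ v : Plane, (∀ γ ∈ Φ, inner ℝ v γ ≠ 0) ∧ S = {γ ∈ Φ | 0 < inner ℝ v γ}

/-- `S` is, up to equivalence, a positive system of a root system of type `A₁ × A₁`. -/
def IsOfTypeA1A1 (S : Set Plane) : Prop :=
  ∃ S' Φ : Set Plane, LocusEquiv S S' ∧ IsA1A1RootSystem Φ ∧ IsPositiveSystem Φ S'

/-- `S` is, up to equivalence, a positive system of a root system of type `A₂`. -/
def IsOfTypeA2 (S : Set Plane) : Prop :=
  ∃ S' Φ : Set Plane, LocusEquiv S S' ∧ IsA2RootSystem Φ ∧ IsPositiveSystem Φ S'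

/-- The vector `s e₁ + t e₂`. -/
def vec (s t : ℝ) : Plane := !₂[s, t]

end RankTwo

end

open MvPolynomial

noncomputable section

namespace RankTwo

/-! ### Derivations on Laurent series -/

section Derivations

variable {A : Type*} [CommRing A]

/-! In polar coordinates `L = r⁻² (V(θ) - (r ∂_r)² - ∂_θ²)`. Let `ψ` be the formal solution of `ψ''
= (V + κ²) ψ` with logarithmic derivative `κ + χ(κ)`, `χ = ∑ χₙ κ⁻ⁿ`; by the Riccati equation the
`χₙ` are differential polynomials in `V`. With `ν = -iκ`, `L` kills `r^ν ψ`. The operators are made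
to act on products `v · r^ν ψ`, where `v` is a Laurent series in `r` whose coefficients are Laurent
series in `κ⁻¹` over Laurent series in the angle near a line `⟨β, x⟩ = 0`. If `r^k u` is a nonzero
component of an element of the kernel of `L`, then `u'/u = ik + χ(κ + ik) - χ(κ)`. As `κ d/dκ`
commutes with `d/dθ`, the coefficients of `u'/u` at nonzero powers of `κ` have no residue in `θ`;
for `k ≠ 0` this forces `res χₙ = 0` for all `n` (`residue_chi_eq_zero`).

Suppose some `res χₙ ≠ 0`. Then the kernel of `L` consists of the terms `r⁰ u` with `u' = 0`, while
`L` maps the even polynomials in `r` with such coefficients onto themselves. Hence `P` preserves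
these polynomials (`map_mem_evenRadial`), and so does its `m`-th iterated commutator with `r²`, `m =
ord P`, which is multiplication by `2^m m! P̃₀(x)` (`adSq_iterate`). Applied to `1`, this shows that
`P̃₀` is constant on the unit circle, and zero if `m` is odd; so `P̃₀` is a polynomial in `ξ₁² +
ξ₂²`, which is excluded. Thus all residues vanish (`exists_aeval_of_commute`). Commutation is given
only on rational functions, but there an operator determines its symbol, so the identity holds in
every `Realization` (`schr_dop_comm`).

At a double pole with coefficient `c = C_β / |β|²`, the residues of `χ₃`, `χ₅`, `χ₇` make the
Laurent coefficients of `V` at `θ`, at `θ³` (unless `c = 2`) and at `θ⁵` (unless `c` is `2` or `6`)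
vanish (`coeff_of_residues`). With `y` the cotangent of the angle from `β` to `γ`, `w = C_γ / |γ|²`
and `G(y) = y (1 + y²)`, these conditions say `∑ w G(y) y^j = 0` for `j = 0, 2, 4`
(`momentCondition_of_commutant`).

The rest is real algebra. Two vectors: `G(y) = 0` means orthogonality. Three: some vector sees the
other two under opposite cotangents, and the moments at the other vectors determine the constants.
Four: some vector sees the others under `0, p, -p` (`exists_isBalanced`). This is elimination if its
weight is neither `2` nor `6`; if all weights are `2` or `6`, positivity and the monotonicity of `G`
replace the missing equations. -/

/-- The Leibniz rule for an additive endomorphism. -/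
def Leibniz (d : A →+ A) : Prop := ∀ a b, d (a * b) = d a * b + a * d b

theorem Leibniz.map_one {d : A →+ A} (hd : Leibniz d) : d 1 = 0 := by
  have := hd 1 1
  simpa using this

theorem Leibniz.map_sq {d : A →+ A} (hd : Leibniz d) (a : A) : d (a ^ 2) = 2 * a * d a := by
  rw [pow_two, hd]; ring

theorem Leibniz.mul_eq_zero {d : A →+ A} (hd : Leibniz d) {a b : A} (ha : d a = 0) (hb : d b = 0) :
    d (a * b) = 0 := by
  rw [hd, ha, hb]; simp

theorem Leibniz.inv_eq_zero {K : Type*} [Field K] {d : K →+ K} (hd : Leibniz d) {a : K}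
    (ha : d a = 0) : d a⁻¹ = 0 := by
  by_cases h : a = 0
  · simp [h]
  · have := hd a a⁻¹
    rw [mul_inv_cancel₀ h, hd.map_one, ha, zero_mul, zero_add] at this
    exact (_root_.mul_eq_zero.1 this.symm).resolve_left h

/-- The Euler derivation `X d/dX` of Laurent series. -/
def euler (A : Type*) [CommRing A] : LaurentSeries A →+ LaurentSeries A where
  toFun x :=
    { coeff := fun n => n • x.coeff n
      isPWO_support' := x.isPWO_support.mono (by
        intro n hn hx
        exact hn (by simp [hx])) }
  map_zero' := by ext; simp
  map_add' x y := by ext; simp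

/-- The coefficientwise extension of an additive endomorphism to Laurent series. -/
def mapD (d : A →+ A) : LaurentSeries A →+ LaurentSeries A where
  toFun x := x.map d
  map_zero' := by ext; simp
  map_add' x y := by ext; simp

@[simp]
theorem coeff_euler (x : LaurentSeries A) (n : ℤ) : (euler A x).coeff n = n • x.coeff n := rfl

@[simp]
theorem coeff_mapD (d : A →+ A) (x : LaurentSeries A) (n : ℤ) :
    (mapD d x).coeff n = d (x.coeff n) := rfl

theorem leibniz_euler : Leibniz (euler A) := by
  intro x y
  ext n
  have hx : (euler A x).support ⊆ x.support := by
    intro n hn hx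
    exact hn (by simp [hx])
  have hy : (euler A y).support ⊆ y.support := by
    intro n hn hy
    exact hn (by simp [hy])
  -- Enlarging the supports of the derivatives to those of `x` and `y` puts all three products over
  -- one antidiagonal.
  rw [coeff_euler, HahnSeries.coeff_add, HahnSeries.coeff_mul_left' x.isPWO_support hx,
    HahnSeries.coeff_mul_right' y.isPWO_support hy, HahnSeries.coeff_mul, Finset.smul_sum,
    ← Finset.sum_add_distrib]
  refine Finset.sum_congr rfl fun ij h => ?_
  rw [Finset.mem_antidiagonal] at h
  rw [← h.2.2, coeff_euler, coeff_euler, add_smul, smul_mul_assoc, mul_smul_comm]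

theorem leibniz_mapD {d : A →+ A} (hd : Leibniz d) : Leibniz (mapD d) := by
  intro x y
  ext n
  have hx : (mapD d x).support ⊆ x.support := by
    intro n hn hx
    exact hn (by simp [hx])
  have hy : (mapD d y).support ⊆ y.support := by
    intro n hn hy
    exact hn (by simp [hy])
  rw [coeff_mapD, HahnSeries.coeff_add, HahnSeries.coeff_mul_left' x.isPWO_support hx,
    HahnSeries.coeff_mul_right' y.isPWO_support hy, HahnSeries.coeff_mul, map_sum,
    ← Finset.sum_add_distrib]
  refine Finset.sum_congr rfl fun ij h => ?_
  rw [hd, coeff_mapD, coeff_mapD]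

theorem euler_mapD (d : A →+ A) (x : LaurentSeries A) :
    euler A (mapD d x) = mapD d (euler A x) := by
  ext n; simp only [coeff_euler, coeff_mapD, map_zsmul]

@[simp]
theorem euler_single (n : ℤ) (a : A) :
    euler A (HahnSeries.single n a) = HahnSeries.single n (n • a) := by
  ext m
  by_cases h : m = n
  · subst h; simp
  · simp [h]

@[simp]
theorem euler_C (a : A) : euler A (HahnSeries.C a) = 0 := by
  simp [HahnSeries.C_apply]

@[simp]
theorem mapD_single (d : A →+ A) (n : ℤ) (a : A) :
    mapD d (HahnSeries.single n a) = HahnSeries.single n (d a) := by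
  ext m
  by_cases h : m = n
  · subst h; simp
  · simp [h]

@[simp]
theorem mapD_C (d : A →+ A) (a : A) : mapD d (HahnSeries.C a) = HahnSeries.C (d a) := by
  simp [HahnSeries.C_apply]

/-- The logarithmic derivative of a Laurent series has no residue in positive and negative
degrees, for any functional that kills derivatives. -/
theorem residue_logDeriv {A B : Type*} [Field A] [AddCommGroup B] [IsAddTorsionFree B]
    {d : A →+ A} (hd : Leibniz d) {ρ : A →+ B} (hρ : ∀ a, ρ (d a) = 0)
    {u q : LaurentSeries A} (hu : u ≠ 0) (h : mapD d u = q * u) {n : ℤ} (hn : n ≠ 0) :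
    ρ (q.coeff n) = 0 := by
  have hL := leibniz_mapD hd
  set w := euler A u * u⁻¹ with hw
  have hwu : euler A u = w * u := by rw [hw, mul_assoc, inv_mul_cancel₀ hu, mul_one]
  -- The two derivations commute, so the Euler derivative of `q = u'/u` is the `d`-derivative of
  -- `w`; in degree `n` this reads `n qₙ = d wₙ`.
  have h1 : euler A q = mapD d w := by
    have e1 : euler A (mapD d u) = mapD d (euler A u) := euler_mapD d u
    rw [h, hwu, leibniz_euler, hL, h, hwu] at e1
    have : euler A q * u = mapD d w * u := by linear_combination e1
    exact mul_right_cancel₀ hu this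
  have h2 := congrArg (fun x => ρ (HahnSeries.coeff x n)) h1
  simp only [coeff_euler, coeff_mapD, hρ, map_zsmul] at h2
  exact (smul_eq_zero.1 h2).resolve_left hn

/-- A homogeneous linear equation `w' + G w = 0` with coefficient `G` of order `-1` has
no nonzero solution. -/
theorem eq_zero_of_mapD_add_mul {A : Type*} [Field A] (d : A →+ A) {G w : LaurentSeries A}
    (hG : G.order = -1) (hG0 : G ≠ 0) (h : mapD d w + G * w = 0) : w = 0 := by
  by_contra hw
  -- In degree `ord w - 1` the term `mapD d w` is absent, since `mapD` does not lower the order;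
  -- only the product of the leading coefficients remains.
  have h1 := congrArg (fun x => HahnSeries.coeff x (G.order + w.order)) h
  simp only [HahnSeries.coeff_add, coeff_mapD, HahnSeries.coeff_mul_order_add_order,
    HahnSeries.coeff_zero] at h1
  rw [HahnSeries.coeff_eq_zero_of_lt_order (by rw [hG]; omega), map_zero, zero_add] at h1
  rcases mul_eq_zero.1 h1 with h1 | h1
  · exact hG0 (HahnSeries.leadingCoeff_eq_zero.1 h1)
  · exact hw (HahnSeries.leadingCoeff_eq_zero.1 h1)

end Derivations

/-! ### Realizations of differential operators with rational coefficients -/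

/-- A commutative ring `F` containing the rational functions, with two commuting operators that
satisfy the Leibniz rule of `∂/∂x₁`, `∂/∂x₂` against rational functions. -/
structure Realization where
  /-- The carrier of the realization. -/
  F : Type
  [ring : CommRing F]
  /-- The inclusion of rational functions. -/
  φ : RatFun →+* F
  /-- The operators that represent the partial derivatives. -/
  D : Fin 2 → F →+ F
  comm : ∀ v, D 0 (D 1 v) = D 1 (D 0 v)
  leibniz : ∀ i a v, D i (φ a * v) = φ (pd i a) * v + φ a * D i v

attribute [instance] Realization.ring

namespace Realization

/-- The action of `∂₁^{p₁} ∂₂^{p₂}`. -/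
def mono (R : Realization) (p : Fin 2 →₀ ℕ) (v : R.F) : R.F := (R.D 0)^[p 0] ((R.D 1)^[p 1] v)

theorem iterate_add (R : Realization) (i : Fin 2) (n : ℕ) (v w : R.F) :
    (R.D i)^[n] (v + w) = (R.D i)^[n] v + (R.D i)^[n] w := by
  induction n generalizing v w with
  | zero => rfl
  | succ n ih => rw [Function.iterate_succ_apply, map_add, ih]; rfl

theorem mono_add (R : Realization) (p : Fin 2 →₀ ℕ) (v w : R.F) :
    R.mono p (v + w) = R.mono p v + R.mono p w := by
  simp only [mono, iterate_add]

/-- The operator with full symbol `σ`. -/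
def dop (R : Realization) (σ : MvPolynomial (Fin 2) RatFun) (v : R.F) : R.F :=
  ∑ p ∈ σ.support, R.φ (σ.coeff p) * R.mono p v

theorem dop_eq_sum_of_subset (R : Realization) {σ : MvPolynomial (Fin 2) RatFun}
    {s : Finset (Fin 2 →₀ ℕ)} (hs : σ.support ⊆ s) (v : R.F) :
    R.dop σ v = ∑ p ∈ s, R.φ (σ.coeff p) * R.mono p v := by
  refine Finset.sum_subset hs fun p _ hp => ?_
  rw [MvPolynomial.notMem_support_iff.1 hp, map_zero, zero_mul]

theorem dop_add (R : Realization) (σ τ : MvPolynomial (Fin 2) RatFun) (v : R.F) :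
    R.dop (σ + τ) v = R.dop σ v + R.dop τ v := by
  classical
  rw [R.dop_eq_sum_of_subset (MvPolynomial.support_add (p := σ) (q := τ)),
    R.dop_eq_sum_of_subset (Finset.subset_union_left : σ.support ⊆ σ.support ∪ τ.support),
    R.dop_eq_sum_of_subset (Finset.subset_union_right : τ.support ⊆ σ.support ∪ τ.support),
    ← Finset.sum_add_distrib]
  refine Finset.sum_congr rfl fun p _ => ?_
  rw [coeff_add, map_add, add_mul]

@[simp]
theorem dop_zero (R : Realization) (v : R.F) : R.dop 0 v = 0 := by
  simp [dop]

theorem dop_monomial (R : Realization) (p : Fin 2 →₀ ℕ) (a : RatFun) (v : R.F) :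
    R.dop (monomial p a) v = R.φ a * R.mono p v := by
  rw [R.dop_eq_sum_of_subset support_monomial_subset, Finset.sum_singleton, coeff_monomial,
    if_pos rfl]

theorem dop_C_mul (R : Realization) (a : RatFun) (σ : MvPolynomial (Fin 2) RatFun) (v : R.F) :
    R.dop (C a * σ) v = R.φ a * R.dop σ v := by
  induction σ using MvPolynomial.induction_on' with
  | monomial p b => rw [C_mul_monomial, dop_monomial, dop_monomial, map_mul, mul_assoc]
  | add p q hp hq => rw [mul_add, dop_add, dop_add, hp, hq, mul_add]

@[simp]
theorem dop_C (R : Realization) (a : RatFun) (v : R.F) : R.dop (C a) v = R.φ a * v := by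
  rw [← monomial_zero', dop_monomial]; rfl

theorem dop_add_apply (R : Realization) (σ : MvPolynomial (Fin 2) RatFun) (v w : R.F) :
    R.dop σ (v + w) = R.dop σ v + R.dop σ w := by
  simp only [dop, mono_add, mul_add, Finset.sum_add_distrib]

/-- The operator with full symbol `σ` as an additive map. -/
def dopHom (R : Realization) (σ : MvPolynomial (Fin 2) RatFun) : R.F →+ R.F :=
  AddMonoidHom.mk' (R.dop σ) (R.dop_add_apply σ)

theorem D_mono (R : Realization) (i : Fin 2) (p : Fin 2 →₀ ℕ) (v : R.F) :
    R.D i (R.mono p v) = R.mono (p + Finsupp.single i 1) v := by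
  fin_cases i
  · simp [mono, Function.iterate_succ_apply']
  -- `mono` applies `D 0` last, so a new `D 1` has to pass the iterates of `D 0`.
  · have h : ∀ (n : ℕ) (w : R.F), R.D 1 ((R.D 0)^[n] w) = (R.D 0)^[n] (R.D 1 w) := by
      intro n
      induction n with
      | zero => intro w; rfl
      | succ n ih =>
        intro w
        rw [Function.iterate_succ_apply', ← R.comm, ih, Function.iterate_succ_apply']
    simp [mono, Function.iterate_succ_apply', h]

/-- The Schrödinger operator with potential `V` in a realization. -/
def schr (R : Realization) (V : RatFun) (v : R.F) : R.F :=
  -(R.D 0 (R.D 0 v) + R.D 1 (R.D 1 v)) + R.φ V * v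

end Realization

/-- An operator defined in all realizations is a differential operator if it is given in all
of them by one symbol. -/
def IsDiffOp (O : ∀ R : Realization, R.F → R.F) : Prop :=
  ∃ τ : MvPolynomial (Fin 2) RatFun, ∀ (R : Realization) (v : R.F), O R v = R.dop τ v

namespace IsDiffOp

theorem ident : IsDiffOp fun _ v => v := ⟨1, fun R v => by
  rw [← C_1, R.dop_C, map_one, one_mul]⟩

theorem zero : IsDiffOp fun _ _ => 0 := ⟨0, fun R v => by simp⟩

theorem add {O O' : ∀ R : Realization, R.F → R.F} (h : IsDiffOp O) (h' : IsDiffOp O') :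
    IsDiffOp fun R v => O R v + O' R v := by
  obtain ⟨τ, hτ⟩ := h
  obtain ⟨τ', hτ'⟩ := h'
  exact ⟨τ + τ', fun R v => by simp only [R.dop_add, hτ, hτ']⟩

theorem mul {O : ∀ R : Realization, R.F → R.F} (h : IsDiffOp O) (a : RatFun) :
    IsDiffOp fun R v => R.φ a * O R v := by
  obtain ⟨τ, hτ⟩ := h
  exact ⟨C a * τ, fun R v => by simp only [R.dop_C_mul, hτ]⟩

theorem neg {O : ∀ R : Realization, R.F → R.F} (h : IsDiffOp O) :
    IsDiffOp fun R v => -O R v := by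
  obtain ⟨τ, hτ⟩ := h.mul (-1)
  exact ⟨τ, fun R v => by rw [← hτ]; simp⟩

theorem sum {ι : Type*} (s : Finset ι) (O : ι → ∀ R : Realization, R.F → R.F)
    (h : ∀ i, IsDiffOp (O i)) : IsDiffOp fun R v => ∑ i ∈ s, O i R v := by
  classical
  induction s using Finset.induction_on with
  | empty => simpa using zero
  | insert i s hi ih => simpa [Finset.sum_insert hi] using (h i).add ih

/-- By the Leibniz rule `∂ᵢ ∘ a ∂ᵖ = (∂ᵢ a) ∂ᵖ + a ∂ᵖ⁺ᵉⁱ`, with the same two monomials in every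
realization. -/
theorem deriv {O : ∀ R : Realization, R.F → R.F} (h : IsDiffOp O) (i : Fin 2) :
    IsDiffOp fun R v => R.D i (O R v) := by
  obtain ⟨τ, hτ⟩ := h
  simp only [hτ, Realization.dop, map_sum, Realization.leibniz, Realization.D_mono]
  refine sum _ _ fun p => add ?_ ?_
  · exact ⟨monomial p _, fun R v => (R.dop_monomial _ _ _).symm⟩
  · exact ⟨monomial _ _, fun R v => (R.dop_monomial _ _ _).symm⟩

theorem iterate {O : ∀ R : Realization, R.F → R.F} (h : IsDiffOp O) (i : Fin 2) (n : ℕ) :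
    IsDiffOp fun R v => (R.D i)^[n] (O R v) := by
  induction n with
  | zero => exact h
  | succ n ih => simpa only [Function.iterate_succ_apply'] using ih.deriv i

theorem dop {O : ∀ R : Realization, R.F → R.F} (h : IsDiffOp O)
    (σ : MvPolynomial (Fin 2) RatFun) : IsDiffOp fun R v => R.dop σ (O R v) := by
  simp only [Realization.dop, Realization.mono]
  exact sum _ _ fun p => ((h.iterate 1 _).iterate 0 _).mul _

theorem schr {O : ∀ R : Realization, R.F → R.F} (h : IsDiffOp O) (V : RatFun) :
    IsDiffOp fun R v => R.schr V (O R v) :=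
  (((h.deriv 0).deriv 0).add ((h.deriv 1).deriv 1)).neg.add (h.mul V)

end IsDiffOp

/-! ### Commutators with coordinates -/

theorem pd_coord (i j : Fin 2) : pd i (coord j) = if j = i then 1 else 0 := by
  classical
  rw [coord, pd_algebraMap, pderiv_X]
  by_cases h : j = i
  · subst h; simp
  · simp [h]

namespace Realization

theorem D_coord (R : Realization) (i j : Fin 2) (v : R.F) :
    R.D i (R.φ (coord j) * v) = R.φ (coord j) * R.D i v + if j = i then v else 0 := by
  rw [R.leibniz, pd_coord]
  split_ifs <;> simp [add_comm]

theorem iterate_coord_self (R : Realization) (i : Fin 2) (n : ℕ) (v : R.F) :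
    (R.D i)^[n] (R.φ (coord i) * v) =
      R.φ (coord i) * (R.D i)^[n] v + n * (R.D i)^[n - 1] v := by
  induction n with
  | zero => simp
  | succ n ih =>
    rw [Function.iterate_succ_apply', ih, map_add, D_coord, if_pos rfl]
    have h : R.D i ((n : R.F) * (R.D i)^[n - 1] v) = n * (R.D i)^[n] v := by
      rw [← nsmul_eq_mul, map_nsmul, nsmul_eq_mul]
      -- The truncated exponent `n - 1` is wrong only for `n = 0`, where the factor `n` kills the
      -- term.
      cases n with
      | zero => simp
      | succ n => rw [Function.iterate_succ_apply']; rfl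
    rw [h, Function.iterate_succ_apply']
    rw [Nat.add_sub_cancel]
    push_cast
    ring

theorem iterate_coord_of_ne (R : Realization) {i j : Fin 2} (hij : j ≠ i) (n : ℕ) (v : R.F) :
    (R.D i)^[n] (R.φ (coord j) * v) = R.φ (coord j) * (R.D i)^[n] v := by
  induction n with
  | zero => simp
  | succ n ih =>
    rw [Function.iterate_succ_apply', ih, D_coord, if_neg hij, Function.iterate_succ_apply',
      add_zero]

theorem iterate_natCast_mul (R : Realization) (i : Fin 2) (n m : ℕ) (v : R.F) :
    (R.D i)^[n] ((m : R.F) * v) = m * (R.D i)^[n] v := by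
  induction n with
  | zero => rfl
  | succ n ih =>
    rw [Function.iterate_succ_apply', ih, Function.iterate_succ_apply', ← nsmul_eq_mul, map_nsmul,
      nsmul_eq_mul]

theorem mono_coord (R : Realization) (i : Fin 2) (p : Fin 2 →₀ ℕ) (v : R.F) :
    R.mono p (R.φ (coord i) * v) =
      R.φ (coord i) * R.mono p v + p i * R.mono (p - Finsupp.single i 1) v := by
  fin_cases i
  · simp [mono, R.iterate_coord_of_ne (show (0 : Fin 2) ≠ 1 by decide), iterate_coord_self]
  · simp [mono, R.iterate_coord_of_ne (show (1 : Fin 2) ≠ 0 by decide), iterate_coord_self,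
      iterate_natCast_mul]

/-- The commutator with a coordinate differentiates the symbol. -/
theorem dop_coord (R : Realization) (i : Fin 2) (σ : MvPolynomial (Fin 2) RatFun) (v : R.F) :
    R.dop σ (R.φ (coord i) * v) = R.φ (coord i) * R.dop σ v + R.dop (pderiv i σ) v := by
  induction σ using MvPolynomial.induction_on' with
  | monomial p a =>
    rw [dop_monomial, dop_monomial, pderiv_monomial, dop_monomial, mono_coord, map_mul, map_natCast]
    ring
  | add p q hp hq => rw [dop_add, dop_add, map_add, dop_add, hp, hq]; ring

end Realization

/-- A set of polynomials in characteristic zero that is stable under partial derivatives and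
contains no nonzero constant is trivial. -/
theorem eq_zero_of_pderiv_stable {k : Type*} [Field k] [CharZero k]
    {I : MvPolynomial (Fin 2) k → Prop} (hI : ∀ i p, I p → I (pderiv i p))
    (hC : ∀ a, I (C a) → a = 0) {p : MvPolynomial (Fin 2) k} (hp : I p) : p = 0 := by
  induction h : p.totalDegree using Nat.strong_induction_on generalizing p with
  | _ n ih =>
    -- Derivatives have smaller degree and stay in the set, so they vanish by induction; in
    -- characteristic zero `p` is then constant.
    have key : ∀ i, pderiv i p = 0 := by
      intro i
      by_contra hne
      have hlt : (pderiv i p).totalDegree < n := by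
        rw [totalDegree, Finset.sup_lt_iff]
        · intro m hm
          rw [mem_support_iff, coeff_pderiv] at hm
          have h2 : coeff (m + Finsupp.single i 1) p ≠ 0 := left_ne_zero_of_mul hm
          have := le_totalDegree (mem_support_iff.2 h2)
          rw [Finsupp.sum_add_index' (by simp) (by simp), Finsupp.sum_single_index rfl, h] at this
          exact this
        · rw [← h, bot_eq_zero', pos_iff_ne_zero]
          intro h0
          rw [totalDegree_eq_zero_iff_eq_C] at h0
          rw [h0, pderiv_C] at hne
          exact hne rfl
      exact hne (ih _ hlt (hI i p hp) rfl)
    have hpC : p = C (coeff 0 p) := by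
      ext m
      rw [coeff_C]
      split_ifs with hm
      · rw [hm]
      · obtain ⟨i, hi⟩ : ∃ i, m i ≠ 0 := by
          by_contra! hall
          exact hm (by ext i; simp [hall i])
        have h2 := congrArg (coeff (m - Finsupp.single i 1)) (key i)
        rw [coeff_pderiv, coeff_zero] at h2
        have h3 : m - Finsupp.single i 1 + Finsupp.single i 1 = m :=
          tsub_add_cancel_of_le (by simpa using Nat.one_le_iff_ne_zero.2 hi)
        rw [h3] at h2
        refine (mul_eq_zero.1 h2).resolve_right ?_
        exact Nat.cast_add_one_ne_zero _
    rw [hpC] at hp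
    rw [hpC, hC _ hp, C_0]

/-! ### The tautological realization and transfer of commutation -/

/-- A commutator of derivations is a derivation, and this one vanishes on the variables. -/
theorem pderiv_comm_poly {k : Type*} [CommRing k] (p : MvPolynomial (Fin 2) k) (i j : Fin 2) :
    pderiv i (pderiv j p) = pderiv j (pderiv i p) := by
  have : ⁅(pderiv i : Derivation k _ _), pderiv j⁆ =
      (0 : Derivation k (MvPolynomial (Fin 2) k) _) := by
    apply MvPolynomial.derivation_ext
    intro l
    classical
    rw [Derivation.commutator_apply, pderiv_X, pderiv_X]
    simp only [Pi.single_apply]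
    split_ifs <;> simp
  have h := DFunLike.congr_fun this p
  rw [Derivation.commutator_apply] at h
  exact sub_eq_zero.1 h

/-- Differentiating `a = b f` twice in both orders, with `a` and `b` polynomials, leaves `b` times
the commutator on `f`. -/
theorem pd_comm (f : RatFun) : pd 0 (pd 1 f) = pd 1 (pd 0 f) := by
  obtain ⟨p, q, hq, rfl⟩ := IsFractionRing.div_surjective (A := MvPolynomial (Fin 2) ℂ) f
  set a := algebraMap (MvPolynomial (Fin 2) ℂ) RatFun p
  set b := algebraMap (MvPolynomial (Fin 2) ℂ) RatFun q with hb
  have hb0 : b ≠ 0 := by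
    rw [hb, Ne, FaithfulSMul.algebraMap_eq_zero_iff]
    exact nonZeroDivisors.ne_zero hq
  have hcomm : ∀ p : MvPolynomial (Fin 2) ℂ, pd 0 (pd 1 (algebraMap _ RatFun p)) =
      pd 1 (pd 0 (algebraMap _ RatFun p)) := by
    intro p
    simp only [pd_algebraMap, pderiv_comm_poly p 0 1]
  have ha := hcomm p
  have hbb := hcomm q
  obtain ⟨f, hf⟩ : ∃ f, f = a / b := ⟨_, rfl⟩
  have hab : a = b * f := by rw [hf]; field_simp
  rw [← hf]
  change pd 0 (pd 1 a) = pd 1 (pd 0 a) at ha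
  change pd 0 (pd 1 b) = pd 1 (pd 0 b) at hbb
  rw [hab] at ha
  simp only [Derivation.leibniz, map_add, smul_eq_mul, hbb] at ha
  have : b * (pd 0 (pd 1 f) - pd 1 (pd 0 f)) = 0 := by linear_combination ha
  exact sub_eq_zero.1 ((mul_eq_zero.1 this).resolve_left hb0)

/-- Rational functions with their partial derivatives. -/
def tautological : Realization where
  F := RatFun
  φ := RingHom.id _
  D i := (pd i : RatFun →ₗ[ℂ] RatFun).toAddMonoidHom
  comm := pd_comm
  leibniz i a v := by
    have := (pd i).leibniz a v
    simp only [smul_eq_mul] at this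
    change pd i (a * v) = pd i a * v + a * pd i v
    rw [this]; ring

theorem tautological_dop (σ : MvPolynomial (Fin 2) RatFun) (v : RatFun) :
    tautological.dop σ v = diffOp σ v := by
  rw [diffOp, LinearMap.sum_apply]
  refine Finset.sum_congr rfl fun p _ => ?_
  simp only [Module.End.mul_apply, mulOp, LinearMap.mulLeft_apply, Module.End.pow_apply]
  rfl

theorem tautological_schr (H : Finset Plane) (C : Plane → ℂ) (v : RatFun) :
    tautological.schr (potential H C) v = schrodinger H C v := by
  simp only [schrodinger, LinearMap.add_apply, LinearMap.neg_apply, pow_two, Module.End.mul_apply,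
    mulOp, LinearMap.mulLeft_apply]
  rfl

/-- The symbol of a differential operator on rational functions is unique. -/
theorem eq_zero_of_tautological_dop {τ : MvPolynomial (Fin 2) RatFun}
    (h : ∀ v, tautological.dop τ v = 0) : τ = 0 := by
  refine eq_zero_of_pderiv_stable
    (I := fun τ => ∀ v, tautological.dop τ v = 0) ?_ ?_ h
  -- The commutator with `xᵢ` is again zero and has symbol `pderiv i p`; for a constant symbol,
  -- applying the operator to `1` suffices.
  · intro i p hp v
    have := tautological.dop_coord i p v
    rw [hp, hp] at this
    simpa using this.symm
  · intro a ha
    have := (tautological.dop_C a (1 : RatFun)).symm.trans (ha (1 : RatFun))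
    exact (mul_one a).symm.trans this

/-- Commutation on rational functions implies commutation in every realization. -/
theorem schr_dop_comm {H : Finset Plane} {C : Plane → ℂ} {σ : MvPolynomial (Fin 2) RatFun}
    (h : Commute (schrodinger H C) (diffOp σ)) (R : Realization) (v : R.F) :
    R.schr (potential H C) (R.dop σ v) = R.dop σ (R.schr (potential H C) v) := by
  -- The commutator has a single symbol `τ`, valid in all realizations, so it may be tested on
  -- rational functions alone.
  obtain ⟨τ, hτ⟩ : IsDiffOp fun R v =>
      R.schr (potential H C) (R.dop σ v) + -R.dop σ (R.schr (potential H C) v) :=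
    ((IsDiffOp.ident.dop σ).schr _).add ((IsDiffOp.ident.schr _).dop σ).neg
  have h0 : τ = 0 := by
    apply eq_zero_of_tautological_dop
    intro v
    rw [← hτ]
    change tautological.schr (potential H C) (tautological.dop σ v) +
      -tautological.dop σ (tautological.schr (potential H C) v) = 0
    have := LinearMap.congr_fun h.eq v
    change schrodinger H C (diffOp σ v) = diffOp σ (schrodinger H C v) at this
    have e : tautological.schr (potential H C) (tautological.dop σ v) =
        tautological.dop σ (tautological.schr (potential H C) v) := by
      refine (tautological_schr H C _).trans (Eq.trans ?_ (tautological_dop σ _).symm)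
      exact (congrArg (schrodinger H C) (tautological_dop σ v)).trans
        (this.trans (congrArg (diffOp σ) (tautological_schr H C v).symm))
    rw [e]
    exact add_neg_cancel _
  have := hτ R v
  rw [h0, R.dop_zero] at this
  exact add_neg_eq_zero.1 this

/-! ### The formal solution of the Riccati equation and its shifts -/

section Riccati

set_option linter.unusedSectionVars false

variable {A : Type*} [Field A] [Algebra ℂ A]

/-- The coefficients of the formal solution `χ = ∑ χₙ κ⁻ⁿ` of `2 κ χ + χ' + χ² = V`. -/
def chi (d : A →+ A) (V : A) : ℕ → A
  | 0 => 0
  | n + 1 => (1 / 2) * ((if n = 0 then V else 0) - d (chi d V n) -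
      ∑ i : Fin (n + 1), chi d V i * chi d V (n - i))
termination_by n => n
decreasing_by all_goals omega

theorem chi_zero (d : A →+ A) (V : A) : chi d V 0 = 0 := by
  rw [chi]

theorem two_mul_chi_succ (d : A →+ A) (V : A) (n : ℕ) :
    2 * chi d V (n + 1) = (if n = 0 then V else 0) - d (chi d V n) -
      ∑ ij ∈ Finset.HasAntidiagonal.antidiagonal n, chi d V ij.1 * chi d V ij.2 := by
  have : CharZero A := charZero_of_injective_algebraMap (algebraMap ℂ A).injective
  rw [chi, Finset.Nat.sum_antidiagonal_eq_sum_range_succ (fun i j => chi d V i * chi d V j),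
    Finset.sum_range]
  ring

/-- The power series `∑ χₙ Xⁿ`. -/
def chiSeries (d : A →+ A) (V : A) : PowerSeries A := PowerSeries.mk (chi d V)

/-- Coefficientwise action on power series. -/
def psD (d : A →+ A) (f : PowerSeries A) : PowerSeries A :=
  PowerSeries.mk fun n => d (PowerSeries.coeff n f)

/-- The Riccati equation multiplied by `X = 1/κ`, which makes it an identity of power series. -/
theorem chiSeries_riccati (d : A →+ A) (V : A) :
    2 * chiSeries d V =
      PowerSeries.X * (PowerSeries.C V - psD d (chiSeries d V) - chiSeries d V ^ 2) := by
  ext n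
  have h2 : PowerSeries.coeff n (2 * chiSeries d V) = 2 * chi d V n := by
    rw [two_mul, map_add, chiSeries, PowerSeries.coeff_mk, two_mul]
  rw [h2]
  cases n with
  | zero => simp [chi_zero]
  | succ n =>
    rw [two_mul_chi_succ, PowerSeries.coeff_succ_X_mul, map_sub, map_sub, PowerSeries.coeff_C,
      pow_two, PowerSeries.coeff_mul]
    simp [psD, chiSeries]

/-! ### Shifting the spectral parameter -/

/-- The series of `1 / (κ + h)` in powers of `X = 1 / κ`. -/
def shiftVar (k : Type*) [CommRing k] (h : k) : PowerSeries k :=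
  PowerSeries.X * PowerSeries.mk fun n => (-h) ^ n

theorem one_add_mul_shiftVar {k : Type*} [CommRing k] (h : k) :
    (1 + PowerSeries.C h * PowerSeries.X) * shiftVar k h = PowerSeries.X := by
  have : (1 + PowerSeries.C h * PowerSeries.X) * PowerSeries.mk (fun n => (-h) ^ n) =
      (1 : PowerSeries k) := by
    ext n
    rw [add_mul, one_mul, map_add, mul_assoc, PowerSeries.coeff_C_mul]
    cases n with
    | zero => simp
    | succ n =>
      rw [PowerSeries.coeff_succ_X_mul, PowerSeries.coeff_mk, PowerSeries.coeff_mk,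
        PowerSeries.coeff_one, if_neg (Nat.succ_ne_zero n)]
      ring
  rw [shiftVar, mul_left_comm, this, mul_one]

theorem map_shiftVar (h : ℂ) :
    (shiftVar ℂ h).map (algebraMap ℂ A) = shiftVar A (algebraMap ℂ A h) := by
  rw [shiftVar, shiftVar, map_mul, PowerSeries.map_X]
  congr 1
  ext n
  simp

theorem hasSubst_shiftVar (h : A) : PowerSeries.HasSubst (shiftVar A h) :=
  PowerSeries.HasSubst.of_constantCoeff_zero' (by simp [shiftVar])

theorem coeff_shiftVar_pow_of_lt {k : Type*} [CommRing k] (h : k) {n m : ℕ} (hnm : n < m) :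
    PowerSeries.coeff n (shiftVar k h ^ m) = 0 := by
  rw [shiftVar, mul_pow, PowerSeries.coeff_X_pow_mul', if_neg (by omega)]

theorem coeff_shiftVar_pow_self {k : Type*} [CommRing k] (h : k) (n : ℕ) :
    PowerSeries.coeff n (shiftVar k h ^ n) = 1 := by
  rw [shiftVar, mul_pow, PowerSeries.coeff_X_pow_mul', if_pos le_rfl, Nat.sub_self,
    PowerSeries.coeff_zero_eq_constantCoeff_apply, map_pow]
  simp [← PowerSeries.coeff_zero_eq_constantCoeff_apply]

/-- The second term of `(κ + h)⁻ⁿ = κ⁻ⁿ - n h κ⁻ⁿ⁻¹ + ⋯`. That it is nonzero for `n, h ≠ 0` is what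
makes `residue_chi_eq_zero` work. -/
theorem coeff_shiftVar_pow_succ {k : Type*} [CommRing k] (h : k) (n : ℕ) :
    PowerSeries.coeff (n + 1) (shiftVar k h ^ n) = -(n * h) := by
  rw [shiftVar, mul_pow, PowerSeries.coeff_X_pow_mul', if_pos (Nat.le_succ n),
    Nat.add_sub_cancel_left, PowerSeries.coeff_one_pow]
  simp [← PowerSeries.coeff_zero_eq_constantCoeff_apply]

/-- The `m`-th power of the substituted series starts in degree `m`, so the sum is finite. Its
coefficients are complex numbers; written as scalars they pass through `d` and through linear
functionals. -/
theorem coeff_subst_shiftVar (h : ℂ) (f : PowerSeries A) (n : ℕ) :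
    PowerSeries.coeff n (f.subst (shiftVar A (algebraMap ℂ A h))) =
      ∑ m ∈ Finset.range (n + 1),
        PowerSeries.coeff n (shiftVar ℂ h ^ m) • PowerSeries.coeff m f := by
  rw [PowerSeries.coeff_subst' (hasSubst_shiftVar _),
    finsum_eq_sum_of_support_subset (s := Finset.range (n + 1))]
  · refine Finset.sum_congr rfl fun m _ => ?_
    rw [← map_shiftVar, ← map_pow, PowerSeries.coeff_map, smul_eq_mul, Algebra.smul_def, mul_comm]
  · intro m hm
    rw [Finset.coe_range, Set.mem_Iio]
    by_contra hlt
    exact hm (by simp only [coeff_shiftVar_pow_of_lt _ (show n < m by omega), smul_zero])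

variable {d : A →+ A}

theorem map_smul_of_const (hd : Leibniz d) (hdc : ∀ c : ℂ, d (algebraMap ℂ A c) = 0) (c : ℂ)
    (a : A) : d (c • a) = c • d a := by
  rw [Algebra.smul_def, hd, hdc, zero_mul, zero_add, Algebra.smul_def]

theorem psD_subst (hd : Leibniz d) (hdc : ∀ c : ℂ, d (algebraMap ℂ A c) = 0) (h : ℂ)
    (f : PowerSeries A) :
    psD d (f.subst (shiftVar A (algebraMap ℂ A h))) =
      (psD d f).subst (shiftVar A (algebraMap ℂ A h)) := by
  ext n
  rw [psD, PowerSeries.coeff_mk, coeff_subst_shiftVar, coeff_subst_shiftVar, map_sum]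
  refine Finset.sum_congr rfl fun m _ => ?_
  rw [map_smul_of_const hd hdc, psD, PowerSeries.coeff_mk]

/-- The formal solution `χ(κ + h)`. -/
def chiShift (d : A →+ A) (V : A) (h : ℂ) : PowerSeries A :=
  (chiSeries d V).subst (shiftVar A (algebraMap ℂ A h))

theorem chiShift_zero (V : A) : chiShift d V 0 = chiSeries d V := by
  have : shiftVar A (algebraMap ℂ A 0) = PowerSeries.X := by
    have := one_add_mul_shiftVar (algebraMap ℂ A 0)
    simpa using this
  rw [chiShift, this, PowerSeries.X_subst]

/-- Substitution of `1/(κ + h)` for `X` commutes with `d`, as its coefficients are constants; the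
factor `1 + hX` clears the denominator. -/
theorem chiShift_riccati (hd : Leibniz d) (hdc : ∀ c : ℂ, d (algebraMap ℂ A c) = 0) (V : A)
    (h : ℂ) :
    2 * (1 + PowerSeries.C (algebraMap ℂ A h) * PowerSeries.X) * chiShift d V h =
      PowerSeries.X * (PowerSeries.C V - psD d (chiShift d V h) - chiShift d V h ^ 2) := by
  have hs := hasSubst_shiftVar (algebraMap ℂ A h)
  have h1 := congrArg (PowerSeries.subst (shiftVar A (algebraMap ℂ A h))) (chiSeries_riccati d V)
  have hC : PowerSeries.subst (shiftVar A (algebraMap ℂ A h)) (PowerSeries.C V) =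
      PowerSeries.C V := PowerSeries.subst_C _
  rw [two_mul, PowerSeries.subst_add hs, PowerSeries.subst_mul hs, PowerSeries.subst_X hs,
    PowerSeries.subst_sub hs, PowerSeries.subst_sub hs, PowerSeries.subst_pow hs,
    ← psD_subst hd hdc, hC] at h1
  rw [← chiShift] at h1
  have h2 := one_add_mul_shiftVar (algebraMap ℂ A h)
  linear_combination (1 + PowerSeries.C (algebraMap ℂ A h) * PowerSeries.X) * h1 +
    (PowerSeries.C V - psD d (chiShift d V h) - chiShift d V h ^ 2) * h2

/-- The large parameter `κ`. -/
def kappa (A : Type*) [Field A] : LaurentSeries A := HahnSeries.single (-1) 1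

/-- The logarithmic derivative `κ + h + χ(κ + h)` of a formal eigenfunction. -/
def logDer (d : A →+ A) (V : A) (h : ℂ) : LaurentSeries A :=
  kappa A + HahnSeries.C (algebraMap ℂ A h) + HahnSeries.ofPowerSeries ℤ A (chiShift d V h)

theorem mapD_ofPowerSeries (d : A →+ A) (f : PowerSeries A) :
    mapD d (HahnSeries.ofPowerSeries ℤ A f) = HahnSeries.ofPowerSeries ℤ A (psD d f) := by
  ext n
  rw [coeff_mapD, PowerSeries.coeff_coe, PowerSeries.coeff_coe]
  split_ifs
  · exact map_zero d
  · rw [psD, PowerSeries.coeff_mk]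

theorem mapD_kappa (hd : Leibniz d) : mapD d (kappa A) = 0 := by
  rw [kappa, mapD_single, hd.map_one, map_zero]

theorem kappa_mul_X : kappa A * HahnSeries.ofPowerSeries ℤ A PowerSeries.X = 1 := by
  rw [kappa, PowerSeries.coe_X, HahnSeries.single_mul_single]
  simp

/-- This expresses `ψ'' = (V + (κ + h)²) ψ` through the logarithmic derivative of `ψ`. -/
theorem logDer_riccati (hd : Leibniz d) (hdc : ∀ c : ℂ, d (algebraMap ℂ A c) = 0) (V : A)
    (h : ℂ) :
    mapD d (logDer d V h) + logDer d V h ^ 2 =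
      HahnSeries.C V + (kappa A + HahnSeries.C (algebraMap ℂ A h)) ^ 2 := by
  have h1 := congrArg (HahnSeries.ofPowerSeries ℤ A) (chiShift_riccati hd hdc V h)
  simp only [map_mul, map_add, map_sub, map_one, map_pow, HahnSeries.ofPowerSeries_C, map_ofNat]
    at h1
  have h2 := kappa_mul_X (A := A)
  rw [logDer, map_add, map_add, mapD_kappa hd, mapD_C, hdc, map_zero, mapD_ofPowerSeries]
  linear_combination kappa A * h1 + (HahnSeries.C V -
    HahnSeries.ofPowerSeries ℤ A (psD d (chiShift d V h)) -
    HahnSeries.ofPowerSeries ℤ A (chiShift d V h) ^ 2 -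
    2 * HahnSeries.C (algebraMap ℂ A h) * HahnSeries.ofPowerSeries ℤ A (chiShift d V h)) * h2

theorem coeff_logDer_add (V : A) (h h' : ℂ) :
    (logDer d V h + logDer d V h').coeff (-1) = 2 := by
  simp [logDer, kappa, PowerSeries.coeff_coe, HahnSeries.C_apply]
  norm_num

theorem logDer_add_ne_zero (V : A) (h h' : ℂ) : logDer d V h + logDer d V h' ≠ 0 := by
  have : CharZero A := charZero_of_injective_algebraMap (algebraMap ℂ A).injective
  intro h0
  have := coeff_logDer_add (d := d) V h h'
  rw [h0] at this
  exact two_ne_zero this.symm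

theorem order_logDer_add (V : A) (h h' : ℂ) : (logDer d V h + logDer d V h').order = -1 := by
  have : CharZero A := charZero_of_injective_algebraMap (algebraMap ℂ A).injective
  apply le_antisymm
  · apply HahnSeries.order_le_of_coeff_ne_zero
    rw [coeff_logDer_add]
    exact two_ne_zero
  · rw [HahnSeries.le_order_iff_forall (logDer_add_ne_zero V h h')]
    intro j hj
    have h1 : j ≠ 0 := by omega
    have h2 : j ≠ -1 := by omega
    have h3 : j < 0 := by omega
    simp [logDer, kappa, PowerSeries.coeff_coe, HahnSeries.C_apply, h1, h2, h3]

/-- An eigenfunction `u · ψ` of level `h`, with `ψ` the formal eigenfunction of level `0`, is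
proportional to the formal eigenfunction of level `h`. -/
theorem mapD_eq_of_eigen (hd : Leibniz d) (hdc : ∀ c : ℂ, d (algebraMap ℂ A c) = 0) {V : A}
    {h : ℂ} {u : LaurentSeries A}
    (hu : mapD d (mapD d u + logDer d V 0 * u) + logDer d V 0 * (mapD d u + logDer d V 0 * u) =
      (HahnSeries.C V + (kappa A + HahnSeries.C (algebraMap ℂ A h)) ^ 2) * u) :
    mapD d u = (logDer d V h - logDer d V 0) * u := by
  have hL := leibniz_mapD hd
  -- With `b = logDer d V h` the equation for `f = uψ` factors as `(∂ + b)(∂ - b) f = 0`. After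
  -- division by `ψ` the left side here, `w`, satisfies `w' + (logDer d V 0 + b) w = 0`, whose
  -- coefficient starts with `2κ`; so `w = 0`.
  have key : mapD d u - (logDer d V h - logDer d V 0) * u = 0 := by
    refine eq_zero_of_mapD_add_mul d (order_logDer_add (d := d) V 0 h) (logDer_add_ne_zero V 0 h) ?_
    have h1 := logDer_riccati hd hdc V h
    rw [← h1] at hu
    rw [map_add, hL] at hu
    rw [map_sub, hL, map_sub]
    linear_combination hu
  exact sub_eq_zero.1 key

/-- A nonzero eigenfunction of level `h ≠ 0` obtained from level `0` forces all residues of the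
Riccati solution to vanish. -/
theorem residue_chi_eq_zero (hd : Leibniz d) {ρ : A →ₗ[ℂ] ℂ} (hρ : ∀ a, ρ (d a) = 0) {V : A}
    {h : ℂ} (hh : h ≠ 0) {u : LaurentSeries A} (hu : u ≠ 0)
    (hu' : mapD d u = (logDer d V h - logDer d V 0) * u) (n : ℕ) : ρ (chi d V n) = 0 := by
  have h1 : ∀ n : ℕ, n ≠ 0 → ρ (PowerSeries.coeff n (chiShift d V h)) = ρ (chi d V n) := by
    intro n hn
    have := residue_logDeriv hd (ρ := ρ.toAddMonoidHom) hρ hu hu' (n := n) (by exact_mod_cast hn)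
    have h2 : (logDer d V h - logDer d V 0).coeff (n : ℤ) =
        PowerSeries.coeff n (chiShift d V h) - chi d V n := by
      have hn0 : (n : ℤ) ≠ 0 := by exact_mod_cast hn
      have hn1 : (n : ℤ) ≠ -1 := by omega
      rw [logDer, logDer, chiShift_zero]
      simp [kappa, HahnSeries.C_apply, HahnSeries.coeff_single_of_ne hn0, hn1, chiSeries,
        PowerSeries.coeff_mk]
    rw [h2, map_sub] at this
    exact sub_eq_zero.1 this
  induction n using Nat.strong_induction_on with
  | _ n ih =>
    rcases Nat.eq_zero_or_pos n with rfl | hn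
    · rw [chi_zero, map_zero]
    -- Residues are compared one degree higher: `χₙ₊₁` cancels, the terms below `n` vanish by
    -- induction, and `-n h ρ(χₙ) = 0` remains.
    · have h2 := h1 (n + 1) (Nat.succ_ne_zero n)
      rw [chiShift, coeff_subst_shiftVar, map_sum, Finset.sum_range_succ, Finset.sum_range_succ,
        Finset.sum_eq_zero, zero_add, coeff_shiftVar_pow_self, coeff_shiftVar_pow_succ] at h2
      · simp only [map_smul, chiSeries, PowerSeries.coeff_mk, smul_eq_mul, one_mul,
          add_eq_right, mul_eq_zero, neg_eq_zero, Nat.cast_eq_zero] at h2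
        rcases h2 with (h2 | h2) | h2
        · omega
        · exact absurd h2 hh
        · exact h2
      · intro m hm
        rw [map_smul, chiSeries, PowerSeries.coeff_mk, ih m (Finset.mem_range.1 hm), smul_zero]

end Riccati

/-! ### Polar coordinates -/

/-- Data for polar coordinates in a commutative ring: the derivations `r ∂/∂r` and `∂/∂θ`, the
inverse radius, the direction `(p₀, p₁) = (cos, sin)` and the logarithmic derivatives `ν`, `S` of a
twisting factor. -/
structure PolarFrame (F : Type*) [CommRing F] where
  /-- The derivation `r ∂/∂r`. -/
  E : F →+ F
  /-- The derivation `∂/∂θ`. -/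
  T : F →+ F
  /-- The inverse radius. -/
  ri : F
  /-- The cosine. -/
  p₀ : F
  /-- The sine. -/
  p₁ : F
  /-- The radial logarithmic derivative of the twist. -/
  ν : F
  /-- The angular logarithmic derivative of the twist. -/
  S : F
  leibniz_E : Leibniz E
  leibniz_T : Leibniz T
  comm : ∀ v, E (T v) = T (E v)
  E_ri : E ri = -ri
  T_ri : T ri = 0
  E_p₀ : E p₀ = 0
  E_p₁ : E p₁ = 0
  T_p₀ : T p₀ = -p₁
  T_p₁ : T p₁ = p₀
  norm_sq : p₀ ^ 2 + p₁ ^ 2 = 1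
  T_ν : T ν = 0
  E_S : E S = 0

namespace PolarFrame

variable {F : Type*} [CommRing F] (P : PolarFrame F)

/-- The twisted radial operator. -/
def tE (v : F) : F := P.E v + P.ν * v

/-- The twisted angular operator. -/
def tT (v : F) : F := P.T v + P.S * v

/-- The Cartesian partial derivatives. -/
def δ : Fin 2 → F →+ F :=
  ![AddMonoidHom.mk' (fun v => P.ri * (P.p₀ * P.E v - P.p₁ * P.T v))
      (fun v w => by simp only [map_add]; ring),
    AddMonoidHom.mk' (fun v => P.ri * (P.p₁ * P.E v + P.p₀ * P.T v))
      (fun v w => by simp only [map_add]; ring)]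

/-- The twisted Cartesian partial derivatives. -/
def D : Fin 2 → F →+ F :=
  ![AddMonoidHom.mk' (fun v => P.ri * (P.p₀ * P.tE v - P.p₁ * P.tT v))
      (fun v w => by simp only [tE, tT, map_add]; ring),
    AddMonoidHom.mk' (fun v => P.ri * (P.p₁ * P.tE v + P.p₀ * P.tT v))
      (fun v w => by simp only [tE, tT, map_add]; ring)]

theorem δ_zero (v : F) : P.δ 0 v = P.ri * (P.p₀ * P.E v - P.p₁ * P.T v) := rfl

theorem δ_one (v : F) : P.δ 1 v = P.ri * (P.p₁ * P.E v + P.p₀ * P.T v) := rfl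

theorem D_zero (v : F) : P.D 0 v = P.ri * (P.p₀ * P.tE v - P.p₁ * P.tT v) := rfl

theorem D_one (v : F) : P.D 1 v = P.ri * (P.p₁ * P.tE v + P.p₀ * P.tT v) := rfl

theorem leibniz_δ (i : Fin 2) : Leibniz (P.δ i) := by
  intro a b
  fin_cases i
  · simp only [Fin.zero_eta, δ_zero, P.leibniz_E a b, P.leibniz_T a b]; ring
  · simp only [Fin.mk_one, δ_one, P.leibniz_E a b, P.leibniz_T a b]; ring

theorem D_mul (i : Fin 2) (a v : F) : P.D i (a * v) = P.δ i a * v + a * P.D i v := by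
  fin_cases i
  · simp only [Fin.zero_eta, δ_zero, D_zero, tE, tT, P.leibniz_E a v, P.leibniz_T a v]; ring
  · simp only [Fin.mk_one, δ_one, D_one, tE, tT, P.leibniz_E a v, P.leibniz_T a v]; ring

theorem tE_tT (v : F) : P.tE (P.tT v) = P.tT (P.tE v) := by
  simp only [tE, tT, map_add, P.leibniz_E P.S v, P.leibniz_T P.ν v, P.comm, P.E_S, P.T_ν]
  ring

theorem tE_mul (a v : F) : P.tE (a * v) = P.E a * v + a * P.tE v := by
  simp only [tE, P.leibniz_E a v]; ring

theorem tT_mul (a v : F) : P.tT (a * v) = P.T a * v + a * P.tT v := by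
  simp only [tT, P.leibniz_T a v]; ring

theorem tE_add (v w : F) : P.tE (v + w) = P.tE v + P.tE w := by
  simp only [tE, map_add]; ring

theorem tT_add (v w : F) : P.tT (v + w) = P.tT v + P.tT w := by
  simp only [tT, map_add]; ring

theorem tE_sub (v w : F) : P.tE (v - w) = P.tE v - P.tE w := by
  simp only [tE, map_sub]; ring

theorem tT_sub (v w : F) : P.tT (v - w) = P.tT v - P.tT w := by
  simp only [tT, map_sub]; ring

theorem D_comm (v : F) : P.D 0 (P.D 1 v) = P.D 1 (P.D 0 v) := by
  simp only [D_zero, D_one, tE_mul, tT_mul, tE_add, tT_add, tE_sub, tT_sub, tE_tT, P.E_ri, P.T_ri,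
    P.E_p₀, P.E_p₁, P.T_p₀, P.T_p₁]
  ring

/-- The first-order terms from differentiating the inverse radius cancel those from the turning
direction, as for the usual Laplacian. -/
theorem laplace (v : F) :
    P.D 0 (P.D 0 v) + P.D 1 (P.D 1 v) = P.ri ^ 2 * (P.tE (P.tE v) + P.tT (P.tT v)) := by
  simp only [D_zero, D_one, tE_mul, tT_mul, tE_add, tT_add, tE_sub, tT_sub, tE_tT, P.E_ri, P.T_ri,
    P.E_p₀, P.E_p₁, P.T_p₀, P.T_p₁]
  linear_combination P.ri ^ 2 * (P.tE (P.tE v) + P.tT (P.tT v)) * P.norm_sq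

/-- The realization of differential operators defined by a polar frame. -/
def toRealization {F : Type} [CommRing F] (P : PolarFrame F) (φ : RatFun →+* F)
    (h : ∀ i f, P.δ i (φ f) = φ (pd i f)) : Realization where
  F := F
  φ := φ
  D := P.D
  comm := P.D_comm
  leibniz i a v := by rw [PolarFrame.D_mul, h]

theorem toRealization_schr {F : Type} [CommRing F] (P : PolarFrame F) (φ : RatFun →+* F)
    (h : ∀ i f, P.δ i (φ f) = φ (pd i f)) {U : RatFun} {w : F} (hU : φ U = P.ri ^ 2 * w) (v : F) :
    (P.toRealization φ h).schr U v = P.ri ^ 2 * (w * v - P.tE (P.tE v) - P.tT (P.tT v)) := by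
  have e : -(P.D 0 (P.D 0 v) + P.D 1 (P.D 1 v)) + φ U * v =
      P.ri ^ 2 * (w * v - P.tE (P.tE v) - P.tT (P.tT v)) := by
    rw [P.laplace, hU]
    ring
  exact e

end PolarFrame

/-! ### The realization on formal series in the radius -/

section Concrete

set_option linter.unusedSectionVars false

variable {A : Type} [Field A] [Algebra ℂ A]

/-- A differential field over `ℂ` with a direction `(p₀, p₁)` moving on the unit circle. -/
structure CircleField (A : Type) [Field A] [Algebra ℂ A] where
  /-- The derivation `d/dθ`. -/
  d : A →+ A
  /-- The moving point of the unit circle. -/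
  p : Fin 2 → A
  leibniz : Leibniz d
  d_const : ∀ c : ℂ, d (algebraMap ℂ A c) = 0
  d_zero : d (p 0) = -p 1
  d_one : d (p 1) = p 0
  norm_sq : p 0 ^ 2 + p 1 ^ 2 = 1

/-- Formal Laurent series in the radius, with coefficients formal Laurent series in `κ⁻¹`. -/
abbrev Polar (A : Type) [Field A] : Type := LaurentSeries (LaurentSeries A)

/-- The inclusion of functions of the angle. -/
def incl (A : Type) [Field A] : A →+* Polar A :=
  (HahnSeries.C : LaurentSeries A →+* Polar A).comp HahnSeries.C

/-- The radius. -/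
def radius (A : Type) [Field A] : Polar A := HahnSeries.single 1 1

/-- The inverse radius. -/
def radiusInv (A : Type) [Field A] : Polar A := HahnSeries.single (-1) 1

theorem radiusInv_mul_radius : radiusInv A * radius A = 1 := by
  rw [radius, radiusInv, HahnSeries.single_mul_single]
  simp

/-- The radial exponent `ν = -i κ`. -/
def nu (A : Type) [Field A] [Algebra ℂ A] : LaurentSeries A :=
  HahnSeries.C (algebraMap ℂ A (-Complex.I)) * kappa A

/-- The radial and the angular spectral parameters cancel, so the twist `r^ν ψ` lies in the kernel
of the Schrödinger operator. -/
theorem nu_sq : nu A ^ 2 = -kappa A ^ 2 := by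
  rw [nu, mul_pow, ← map_pow, ← map_pow, neg_sq, Complex.I_sq, map_neg, map_neg, map_one, map_one]
  ring

namespace CircleField

variable (c : CircleField A)

theorem mapD_nu : mapD c.d (nu A) = 0 := by
  rw [nu]
  refine (leibniz_mapD c.leibniz).mul_eq_zero ?_ (mapD_kappa c.leibniz)
  rw [mapD_C, c.d_const, map_zero]

/-- The polar frame twisted by the formal eigenfunction with potential `V`. -/
def frame (V : A) : PolarFrame (Polar A) where
  E := euler _
  T := mapD (mapD c.d)
  ri := radiusInv A
  p₀ := incl A (c.p 0)
  p₁ := incl A (c.p 1)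
  ν := HahnSeries.C (nu A)
  S := HahnSeries.C (logDer c.d V 0)
  leibniz_E := leibniz_euler
  leibniz_T := leibniz_mapD (leibniz_mapD c.leibniz)
  comm := euler_mapD _
  E_ri := by rw [radiusInv, euler_single, ← HahnSeries.single_neg]; simp
  T_ri := by rw [radiusInv, mapD_single, (leibniz_mapD c.leibniz).map_one, map_zero]
  E_p₀ := by simp [incl]
  E_p₁ := by simp [incl]
  T_p₀ := by simp [incl, c.d_zero]
  T_p₁ := by simp [incl, c.d_one]
  norm_sq := by rw [← map_pow, ← map_pow, ← map_add, c.norm_sq, map_one]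
  T_ν := by rw [mapD_C, c.mapD_nu, map_zero]
  E_S := by simp

/-- The substitution of polar coordinates in polynomials. -/
def polarPoly : MvPolynomial (Fin 2) ℂ →+* Polar A :=
  eval₂Hom ((incl A).comp (algebraMap ℂ A)) fun i => radius A * incl A (c.p i)

theorem polarPoly_X (i : Fin 2) : c.polarPoly (X i) = radius A * incl A (c.p i) := by
  simp [polarPoly]

theorem polarPoly_C (a : ℂ) : c.polarPoly (C a) = incl A (algebraMap ℂ A a) := by
  simp [polarPoly]

theorem euler_radius : euler _ (radius A) = radius A := by
  rw [radius, euler_single, one_smul]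

theorem mapD_radius : mapD (mapD c.d) (radius A) = 0 := by
  rw [radius, mapD_single, (leibniz_mapD c.leibniz).map_one, map_zero]

theorem δ_polarPoly_X (V : A) (i j : Fin 2) :
    (c.frame V).δ i (c.polarPoly (X j)) = if j = i then 1 else 0 := by
  have hE : (c.frame V).E (radius A) = radius A := euler_radius
  have hT : (c.frame V).T (radius A) = 0 := c.mapD_radius
  have h0 : incl A (c.p 0) = (c.frame V).p₀ := rfl
  have h1 : incl A (c.p 1) = (c.frame V).p₁ := rfl
  have hr : (c.frame V).ri * radius A = 1 := radiusInv_mul_radius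
  have hn := (c.frame V).norm_sq
  rw [polarPoly_X]
  fin_cases i <;> fin_cases j <;>
  simp only [Fin.zero_eta, Fin.mk_one, PolarFrame.δ_zero, PolarFrame.δ_one,
    (c.frame V).leibniz_T (radius A), (c.frame V).leibniz_E (radius A), h0, h1, hE, hT,
    (c.frame V).E_p₀, (c.frame V).E_p₁, (c.frame V).T_p₀, (c.frame V).T_p₁, if_pos,
    zero_ne_one, one_ne_zero, if_false]
  · linear_combination (c.frame V).ri * radius A * hn + hr
  · ring
  · ring
  · linear_combination (c.frame V).ri * radius A * hn + hr

theorem δ_polarPoly (V : A) (i : Fin 2) (q : MvPolynomial (Fin 2) ℂ) :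
    (c.frame V).δ i (c.polarPoly q) = c.polarPoly (pderiv i q) := by
  classical
  induction q using MvPolynomial.induction_on with
  | C a =>
    rw [pderiv_C, map_zero, polarPoly_C]
    have hE : (c.frame V).E (incl A (algebraMap ℂ A a)) = 0 := by
      change euler _ _ = 0
      simp [incl]
    have hT : (c.frame V).T (incl A (algebraMap ℂ A a)) = 0 := by
      change mapD (mapD c.d) _ = 0
      simp [incl, c.d_const]
    fin_cases i
    · simp [PolarFrame.δ_zero, hE, hT]
    · simp [PolarFrame.δ_one, hE, hT]
  | add p q hp hq => rw [map_add, map_add, hp, hq, map_add, map_add]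
  | mul_X p j hp =>
    rw [map_mul, (c.frame V).leibniz_δ i, hp, δ_polarPoly_X, pderiv_mul, pderiv_X, map_add, map_mul,
      map_mul]
    by_cases h : j = i
    · subst h; simp
    · simp [h]

/-- The kernel is stable under partial derivatives and contains no nonzero constant. Injectivity is
what lets the substitution extend to fractions. -/
theorem polarPoly_eq_zero {q : MvPolynomial (Fin 2) ℂ} (h : c.polarPoly q = 0) : q = 0 := by
  refine eq_zero_of_pderiv_stable (I := fun q => c.polarPoly q = 0) ?_ ?_ h
  · intro i p hp
    -- The potential `0` is an arbitrary choice: `δ` does not involve the twist.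
    rw [← c.δ_polarPoly 0, hp, map_zero]
  · intro a ha
    rw [polarPoly_C] at ha
    exact (map_eq_zero _).1 ((map_eq_zero _).1 ha)

/-- The substitution of polar coordinates in rational functions. -/
def polar : RatFun →+* Polar A :=
  IsFractionRing.lift (g := c.polarPoly)
    ((injective_iff_map_eq_zero _).2 fun _ h => c.polarPoly_eq_zero h)

theorem polar_algebraMap (q : MvPolynomial (Fin 2) ℂ) :
    c.polar (algebraMap _ RatFun q) = c.polarPoly q :=
  IsFractionRing.lift_algebraMap _ q

theorem polar_coord (i : Fin 2) : c.polar (coord i) = radius A * incl A (c.p i) := by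
  rw [coord, polar_algebraMap, polarPoly_X]

theorem polar_const (a : ℂ) : c.polar (algebraMap ℂ RatFun a) = incl A (algebraMap ℂ A a) := by
  rw [IsScalarTower.algebraMap_apply ℂ (MvPolynomial (Fin 2) ℂ) RatFun, polar_algebraMap,
    algebraMap_eq, polarPoly_C]

theorem δ_polar (V : A) (i : Fin 2) (f : RatFun) :
    (c.frame V).δ i (c.polar f) = c.polar (pd i f) := by
  obtain ⟨p, q, hq, rfl⟩ := IsFractionRing.div_surjective (A := MvPolynomial (Fin 2) ℂ) f
  have hcomm : ∀ p : MvPolynomial (Fin 2) ℂ, (c.frame V).δ i (c.polar (algebraMap _ RatFun p)) =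
      c.polar (pd i (algebraMap _ RatFun p)) := by
    intro p
    rw [pd_algebraMap, polar_algebraMap, polar_algebraMap, δ_polarPoly]
  have hb0 : algebraMap (MvPolynomial (Fin 2) ℂ) RatFun q ≠ 0 := by
    rw [Ne, FaithfulSMul.algebraMap_eq_zero_iff]
    exact nonZeroDivisors.ne_zero hq
  have ha := hcomm p
  have hb := hcomm q
  set a := algebraMap (MvPolynomial (Fin 2) ℂ) RatFun p
  set b := algebraMap (MvPolynomial (Fin 2) ℂ) RatFun q
  obtain ⟨f, hf⟩ : ∃ f, f = a / b := ⟨_, rfl⟩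
  have hab : a = b * f := by rw [hf]; field_simp
  rw [← hf]
  rw [hab, map_mul, (c.frame V).leibniz_δ i, hb, (pd i).leibniz, map_add, smul_eq_mul, smul_eq_mul,
    map_mul, map_mul] at ha
  have h0 : c.polar b * ((c.frame V).δ i (c.polar f) - c.polar (pd i f)) = 0 := by
    linear_combination ha
  exact sub_eq_zero.1 ((mul_eq_zero.1 h0).resolve_left ((map_ne_zero _).2 hb0))

/-- Differential operators with rational coefficients act on formal series in the radius. -/
def realization (V : A) : Realization :=
  (c.frame V).toRealization c.polar (c.δ_polar V)

end CircleField

end Concrete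

/-! ### Iterated commutators with the squared radius -/

theorem homogeneousComponent_pderiv {k : Type*} [CommRing k] (i : Fin 2) (m : ℕ)
    (τ : MvPolynomial (Fin 2) k) :
    homogeneousComponent m (pderiv i τ) = pderiv i (homogeneousComponent (m + 1) τ) := by
  ext e
  rw [coeff_homogeneousComponent, coeff_pderiv, coeff_pderiv, coeff_homogeneousComponent,
    map_add Finsupp.degree, Finsupp.degree_single]
  simp only [add_left_inj]
  split_ifs <;> simp

/-- The symbol of the commutator with `x₁² + x₂²`. -/
def adSq (τ : MvPolynomial (Fin 2) RatFun) : MvPolynomial (Fin 2) RatFun :=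
  ∑ i, (C (2 * coord i) * pderiv i τ + pderiv i (pderiv i τ))

theorem homogeneousComponent_adSq {m : ℕ} {τ : MvPolynomial (Fin 2) RatFun}
    (h : ∀ k, m + 1 < k → homogeneousComponent k τ = 0) {k : ℕ} (hk : m ≤ k) :
    homogeneousComponent k (adSq τ) =
      ∑ i, C (2 * coord i) * pderiv i (homogeneousComponent (k + 1) τ) := by
  rw [adSq, map_sum]
  refine Finset.sum_congr rfl fun i _ => ?_
  rw [map_add, homogeneousComponent_C_mul, homogeneousComponent_pderiv,
    homogeneousComponent_pderiv, homogeneousComponent_pderiv, h (k + 1 + 1) (by omega), map_zero,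
    map_zero, add_zero]

/-- Each commutator with `x₁² + x₂²` lowers the order by one and acts on the top symbol by `2 ∑ xᵢ
∂/∂ξᵢ`. After `m` of them an operator of order at most `m` has become a multiplication, namely by
the value of its degree-`m` symbol at `ξ = x`, up to the factor. -/
theorem adSq_iterate {m : ℕ} {τ : MvPolynomial (Fin 2) RatFun}
    (h : ∀ k, m < k → homogeneousComponent k τ = 0) :
    adSq^[m] τ = C ((2 ^ m * m.factorial : ℕ) * eval coord (homogeneousComponent m τ)) := by
  induction m generalizing τ with
  | zero =>
    have h1 := sum_homogeneousComponent (φ := τ)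
    rw [Finset.sum_range_succ', Finset.sum_eq_zero (fun k _ => h (k + 1) (Nat.succ_pos k)),
      zero_add] at h1
    have h2 : τ = C (coeff 0 τ) := by rw [← homogeneousComponent_zero, h1]
    rw [homogeneousComponent_zero, eval_C]
    simpa using h2
  | succ m ih =>
    rw [Function.iterate_succ_apply, ih, homogeneousComponent_adSq h le_rfl]
    · congr 1
      -- Euler's identity at `ξ = x` provides the factor `m + 1` of the factorial.
      have e := (homogeneousComponent_isHomogeneous (m + 1) τ).sum_X_mul_pderiv
      have e2 := congrArg (eval coord) e
      rw [map_sum, map_nsmul] at e2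
      simp only [map_mul, eval_X, nsmul_eq_mul] at e2
      rw [map_sum]
      simp only [map_mul, eval_C, mul_assoc]
      rw [← Finset.mul_sum, e2, Nat.factorial_succ, pow_succ]
      push_cast
      ring
    · intro k hk
      rw [homogeneousComponent_adSq h hk.le, h (k + 1) (by omega)]
      simp

namespace Realization

theorem dop_adSq (R : Realization) (τ : MvPolynomial (Fin 2) RatFun) (v : R.F) :
    R.dop (adSq τ) v = R.dop τ (R.φ (coord 0 ^ 2 + coord 1 ^ 2) * v) -
      R.φ (coord 0 ^ 2 + coord 1 ^ 2) * R.dop τ v := by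
  have h : ∀ i, R.dop τ (R.φ (coord i ^ 2) * v) = R.φ (coord i ^ 2) * R.dop τ v +
      R.dop (C (2 * coord i) * pderiv i τ + pderiv i (pderiv i τ)) v := by
    intro i
    rw [pow_two, map_mul, mul_assoc, dop_coord, dop_coord, dop_coord, dop_add, dop_C_mul, map_mul,
      map_ofNat]
    ring
  rw [adSq, Fin.sum_univ_two, dop_add, map_add, add_mul, dop_add_apply, h, h]
  ring

end Realization

/-! ### Invariant subspaces of commuting operators -/

section Invariant

set_option linter.unusedSectionVars false

variable {A : Type} [Field A] [Algebra ℂ A]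

namespace CircleField

variable (c : CircleField A)

/-- The Schrödinger operator in polar coordinates, on functions twisted by the formal
eigenfunction. -/
def polarSchr (V : A) (v : Polar A) : Polar A :=
  radiusInv A ^ 2 * (incl A V * v - (c.frame V).tE ((c.frame V).tE v) -
    (c.frame V).tT ((c.frame V).tT v))

theorem realization_schr {V : A} {U : RatFun} (hU : c.polar U = radiusInv A ^ 2 * incl A V)
    (v : Polar A) : (c.realization V).schr U v = c.polarSchr V v :=
  (c.frame V).toRealization_schr c.polar (c.δ_polar V) hU v

/-- The action of the operator with symbol `σ` on formal series in the radius. -/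
def act (V : A) (σ : MvPolynomial (Fin 2) RatFun) : Polar A →+ Polar A :=
  (c.realization V).dopHom σ

theorem act_C (V : A) (f : RatFun) (v : Polar A) : c.act V (C f) v = c.polar f * v :=
  (c.realization V).dop_C f v

theorem act_adSq (V : A) (σ : MvPolynomial (Fin 2) RatFun) (v : Polar A) :
    c.act V (adSq σ) v = c.act V σ (c.polar (coord 0 ^ 2 + coord 1 ^ 2) * v) -
      c.polar (coord 0 ^ 2 + coord 1 ^ 2) * c.act V σ v :=
  (c.realization V).dop_adSq σ v

theorem polarSchr_act {V : A} {H : Finset Plane} {C₀ : Plane → ℂ}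
    (hV : c.polar (potential H C₀) = radiusInv A ^ 2 * incl A V)
    {σ : MvPolynomial (Fin 2) RatFun} (hσ : Commute (schrodinger H C₀) (diffOp σ)) (v : Polar A) :
    c.polarSchr V (c.act V σ v) = c.act V σ (c.polarSchr V v) := by
  refine (c.realization_schr hV _).symm.trans ((schr_dop_comm hσ (c.realization V) v).trans ?_)
  exact congrArg (c.act V σ) (c.realization_schr hV v)

theorem polarSchr_add (V : A) (v w : Polar A) :
    c.polarSchr V (v + w) = c.polarSchr V v + c.polarSchr V w := by
  simp only [polarSchr, PolarFrame.tE_add, PolarFrame.tT_add]; ring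

theorem polarSchr_sub (V : A) (v w : Polar A) :
    c.polarSchr V (v - w) = c.polarSchr V v - c.polarSchr V w := by
  simp only [polarSchr, PolarFrame.tE_sub, PolarFrame.tT_sub]; ring

theorem polarSchr_zero (V : A) : c.polarSchr V 0 = 0 := by
  simp [polarSchr, PolarFrame.tE, PolarFrame.tT]

theorem polarSchr_neg (V : A) (v : Polar A) : c.polarSchr V (-v) = -c.polarSchr V v := by
  rw [← zero_sub, polarSchr_sub, polarSchr_zero, zero_sub]

theorem radiusInv_ne_zero : radiusInv A ≠ 0 :=
  left_ne_zero_of_mul (by rw [radiusInv_mul_radius]; exact one_ne_zero)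

theorem coeff_tE (V : A) (v : Polar A) (k : ℤ) :
    ((c.frame V).tE v).coeff k = (nu A + k) * v.coeff k := by
  change (euler _ v + HahnSeries.C (nu A) * v).coeff k = _
  rw [HahnSeries.coeff_add, coeff_euler, HahnSeries.C_mul_eq_smul, HahnSeries.coeff_smul,
    zsmul_eq_mul, smul_eq_mul]
  ring

theorem coeff_tT (V : A) (v : Polar A) (k : ℤ) :
    ((c.frame V).tT v).coeff k = mapD c.d (v.coeff k) + logDer c.d V 0 * v.coeff k := by
  change (mapD (mapD c.d) v + HahnSeries.C (logDer c.d V 0) * v).coeff k = _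
  rw [HahnSeries.coeff_add, coeff_mapD, HahnSeries.C_mul_eq_smul, HahnSeries.coeff_smul,
    smul_eq_mul]

/-- `κ + ik = i(ν + k)`: raising the radial exponent by `k` shifts the spectral parameter by `ik`.
-/
theorem kappa_add_sq (k : ℤ) :
    (kappa A + HahnSeries.C (algebraMap ℂ A (Complex.I * k))) ^ 2 =
      -(nu A + (k : LaurentSeries A)) ^ 2 := by
  have h1 : HahnSeries.C (algebraMap ℂ A Complex.I) ^ 2 = (-1 : LaurentSeries A) := by
    rw [← map_pow, ← map_pow, Complex.I_sq]; simp
  have h2 : HahnSeries.C (algebraMap ℂ A (k : ℂ)) = (k : LaurentSeries A) := by simp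
  rw [nu, map_mul, map_mul, h2, map_neg, map_neg]
  linear_combination (k ^ 2 + kappa A ^ 2) * h1

/-- The components of an element of the kernel of the Schrödinger operator. -/
theorem mapD_coeff_of_polarSchr_eq_zero {V : A} {v : Polar A} (hv : c.polarSchr V v = 0) (k : ℤ) :
    mapD c.d (v.coeff k) = (logDer c.d V (Complex.I * k) - logDer c.d V 0) * v.coeff k := by
  have h0 := (mul_eq_zero.1 hv).resolve_left (pow_ne_zero _ radiusInv_ne_zero)
  have h1 := congrArg (fun x => HahnSeries.coeff x k) h0
  simp only [HahnSeries.coeff_sub, coeff_tE, coeff_tT, HahnSeries.coeff_zero] at h1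
  have h2 : (incl A V * v).coeff k = HahnSeries.C V * v.coeff k := by
    change (HahnSeries.C (HahnSeries.C V) * v).coeff k = _
    rw [HahnSeries.C_mul_eq_smul, HahnSeries.coeff_smul, smul_eq_mul]
  rw [h2] at h1
  refine mapD_eq_of_eigen c.leibniz c.d_const ?_
  rw [kappa_add_sq]
  linear_combination -h1

/-- If some residue of the Riccati solution does not vanish, then the kernel of the Schrödinger
operator consists of constants. -/
theorem eq_single_of_polarSchr_eq_zero {V : A} {ρ : A →ₗ[ℂ] ℂ} (hρ : ∀ a, ρ (c.d a) = 0) {n : ℕ}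
    (hn : ρ (chi c.d V n) ≠ 0) {v : Polar A} (hv : c.polarSchr V v = 0) :
    ∃ u, mapD c.d u = 0 ∧ v = HahnSeries.single 0 u := by
  refine ⟨v.coeff 0, ?_, ?_⟩
  · have := c.mapD_coeff_of_polarSchr_eq_zero hv 0
    simpa using this
  · ext1
    funext k
    by_cases hk : k = 0
    · rw [hk, HahnSeries.coeff_single_same]
    · rw [HahnSeries.coeff_single_of_ne hk]
      by_contra hne
      -- A nonzero component of degree `k ≠ 0` is an eigenfunction of level `ik ≠ 0` obtained from
      -- level `0`.
      refine hn (residue_chi_eq_zero c.leibniz hρ ?_ hne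
        (c.mapD_coeff_of_polarSchr_eq_zero hv k) n)
      exact mul_ne_zero Complex.I_ne_zero (by exact_mod_cast hk)

/-! ### Even radial polynomials and their invariance -/

/-- The even polynomials in the radius with constant coefficients. -/
def evenRadial : AddSubgroup (Polar A) :=
  AddSubgroup.closure {x | ∃ (u : LaurentSeries A) (j : ℕ), mapD c.d u = 0 ∧
    x = HahnSeries.single (2 * (j : ℤ)) u}

theorem single_mem_evenRadial {u : LaurentSeries A} (hu : mapD c.d u = 0) (j : ℕ) :
    HahnSeries.single (2 * (j : ℤ)) u ∈ c.evenRadial :=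
  AddSubgroup.subset_closure ⟨u, j, hu, rfl⟩

theorem coeff_evenRadial {v : Polar A} (hv : v ∈ c.evenRadial) (k : ℤ) :
    mapD c.d (v.coeff k) = 0 ∧ (Odd k → v.coeff k = 0) := by
  induction hv using AddSubgroup.closure_induction with
  | mem x hx =>
    obtain ⟨u, j, hu, rfl⟩ := hx
    by_cases h : k = 2 * j
    · subst h
      rw [HahnSeries.coeff_single_same]
      exact ⟨hu, fun ho => absurd ho (by simp)⟩
    · rw [HahnSeries.coeff_single_of_ne h]
      simp
  | zero => simp
  | add x y _ _ hx hy =>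
    rw [HahnSeries.coeff_add, map_add, hx.1, hy.1]
    exact ⟨add_zero _, fun ho => by rw [hx.2 ho, hy.2 ho, add_zero]⟩
  | neg x _ hx =>
    rw [HahnSeries.coeff_neg, map_neg, hx.1]
    exact ⟨neg_zero, fun ho => by rw [hx.2 ho, neg_zero]⟩

theorem tE_single (V : A) (k : ℤ) (u : LaurentSeries A) :
    (c.frame V).tE (HahnSeries.single k u) = HahnSeries.single k ((nu A + k) * u) := by
  ext1
  funext l
  rw [coeff_tE]
  by_cases h : l = k
  · subst h; simp only [HahnSeries.coeff_single_same]
  · simp only [HahnSeries.coeff_single_of_ne h, mul_zero]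

theorem tT_single (V : A) (k : ℤ) (u : LaurentSeries A) :
    (c.frame V).tT (HahnSeries.single k u) =
      HahnSeries.single k (mapD c.d u + logDer c.d V 0 * u) := by
  ext1
  funext l
  rw [coeff_tT]
  by_cases h : l = k
  · subst h; simp only [HahnSeries.coeff_single_same]
  · simp only [HahnSeries.coeff_single_of_ne h, mul_zero, map_zero, add_zero]

/-- The Riccati equation cancels `V` and leaves `-κ² = ν²`, so the factor is `ν² - (ν + k)²`. -/
theorem polarSchr_single (V : A) {u : LaurentSeries A} (hu : mapD c.d u = 0) (k : ℤ) :
    c.polarSchr V (HahnSeries.single k u) =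
      HahnSeries.single (k - 2) (-(k * (2 * nu A + k)) * u) := by
  have h1 := logDer_riccati c.leibniz c.d_const V 0
  rw [map_zero, map_zero, add_zero] at h1
  have hinv : radiusInv A ^ 2 = HahnSeries.single (-2) 1 := by
    rw [radiusInv, HahnSeries.single_pow]; simp
  have hV : incl A V * HahnSeries.single k u = HahnSeries.single k (HahnSeries.C V * u) := by
    change HahnSeries.C (HahnSeries.C V) * _ = _
    rw [HahnSeries.C_apply (HahnSeries.C V), HahnSeries.single_mul_single, zero_add]
  have hs : ∀ a b : LaurentSeries A, (HahnSeries.single k a - HahnSeries.single k b : Polar A) =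
      HahnSeries.single k (a - b) :=
    fun a b => (map_sub (HahnSeries.single.addMonoidHom k) a b).symm
  rw [polarSchr, tE_single, tE_single, tT_single, tT_single, hV, hinv, hs, hs,
    HahnSeries.single_mul_single, one_mul, hu, zero_add, leibniz_mapD c.leibniz, hu,
    show (-2 + k : ℤ) = k - 2 by ring]
  congr 1
  linear_combination -u * h1 - u * nu_sq (A := A)

theorem two_nu_add_ne_zero (k : ℤ) : 2 * nu A + k ≠ 0 := by
  have : CharZero A := charZero_of_injective_algebraMap (algebraMap ℂ A).injective
  intro h
  have h1 := congrArg (fun x => HahnSeries.coeff x (-1)) h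
  have h2 : ((k : LaurentSeries A)).coeff (-1) = 0 := by
    rw [← HahnSeries.single_zero_intCast]
    exact HahnSeries.coeff_single_of_ne (by decide)
  have h3 : (nu A).coeff (-1) = algebraMap ℂ A (-Complex.I) := by
    rw [nu, kappa, HahnSeries.C_mul_eq_smul, HahnSeries.coeff_smul, HahnSeries.coeff_single_same,
      smul_eq_mul, mul_one]
  simp only [two_mul, HahnSeries.coeff_add, h2, h3, HahnSeries.coeff_zero, add_zero] at h1
  rw [← map_add, map_eq_zero] at h1
  have : (-2 : ℂ) * Complex.I = 0 := by linear_combination h1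
  simp at this

theorem mapD_intCast (k : ℤ) : mapD c.d (k : LaurentSeries A) = 0 := by
  have := map_zsmul (mapD c.d) k (1 : LaurentSeries A)
  rw [(leibniz_mapD c.leibniz).map_one] at this
  simpa using this

theorem mapD_factor (k : ℤ) : mapD c.d (-(k * (2 * nu A + k))) = 0 := by
  have hL := leibniz_mapD c.leibniz
  rw [map_neg, hL.mul_eq_zero (c.mapD_intCast k), neg_zero]
  rw [map_add, c.mapD_intCast, add_zero, two_mul, map_add, c.mapD_nu, add_zero]

/-- The operator sends `r^k` to `-k(2ν + k) r^(k-2)`, and for `k = 2j + 2` this factor is an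
invertible constant: `k ≠ 0`, and `2ν + k` contains `κ`. -/
theorem exists_polarSchr_eq (V : A) {w : Polar A} (hw : w ∈ c.evenRadial) :
    ∃ v ∈ c.evenRadial, c.polarSchr V v = w := by
  have : CharZero A := charZero_of_injective_algebraMap (algebraMap ℂ A).injective
  have hL := leibniz_mapD c.leibniz
  induction hw using AddSubgroup.closure_induction with
  | mem x hx =>
    obtain ⟨u, j, hu, rfl⟩ := hx
    set k : ℤ := 2 * ((j + 1 : ℕ) : ℤ) with hk
    set f : LaurentSeries A := -(k * (2 * nu A + k)) with hf
    have hf0 : f ≠ 0 := by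
      rw [hf, neg_ne_zero]
      refine mul_ne_zero ?_ (two_nu_add_ne_zero k)
      have hk0 : k ≠ 0 := by omega
      rw [← HahnSeries.single_zero_intCast]
      simpa using hk0
    have hfu : mapD c.d (f⁻¹ * u) = 0 :=
      hL.mul_eq_zero (hL.inv_eq_zero (c.mapD_factor k)) hu
    refine ⟨HahnSeries.single k (f⁻¹ * u), c.single_mem_evenRadial hfu (j + 1), ?_⟩
    rw [c.polarSchr_single V hfu, ← hf, mul_inv_cancel_left₀ hf0,
      show k - 2 = 2 * (j : ℤ) by rw [hk]; push_cast; ring]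
  | zero => exact ⟨0, zero_mem _, c.polarSchr_zero V⟩
  | add x y _ _ hx hy =>
    obtain ⟨v, hv, rfl⟩ := hx
    obtain ⟨v', hv', rfl⟩ := hy
    exact ⟨v + v', add_mem hv hv', c.polarSchr_add V v v'⟩
  | neg x _ hx =>
    obtain ⟨v, hv, rfl⟩ := hx
    exact ⟨-v, neg_mem hv, c.polarSchr_neg V v⟩

/-- Operators that commute with the Schrödinger operator preserve the even radial polynomials, if
the kernel of the Schrödinger operator consists of constants. -/
theorem map_mem_evenRadial {V : A}
    (hker : ∀ v, c.polarSchr V v = 0 → ∃ u, mapD c.d u = 0 ∧ v = HahnSeries.single 0 u)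
    {P : Polar A →+ Polar A} (hP : ∀ v, c.polarSchr V (P v) = P (c.polarSchr V v))
    {v : Polar A} (hv : v ∈ c.evenRadial) : P v ∈ c.evenRadial := by
  have hL := leibniz_mapD c.leibniz
  -- If `P L v = L w` with `w` even radial, then `P v - w` is in the kernel of `L`, hence a term of
  -- degree `0` and even radial too.
  have lift : ∀ v, P (c.polarSchr V v) ∈ c.evenRadial → P v ∈ c.evenRadial := by
    intro v h
    obtain ⟨w, hw, hwv⟩ := c.exists_polarSchr_eq V h
    have h0 : c.polarSchr V (P v - w) = 0 := by rw [polarSchr_sub, hwv, hP, sub_self]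
    obtain ⟨u, hu, he⟩ := hker _ h0
    have : P v = w + HahnSeries.single (2 * ((0 : ℕ) : ℤ)) u := by
      rw [Nat.cast_zero, mul_zero, ← he, add_sub_cancel]
    rw [this]
    exact add_mem hw (c.single_mem_evenRadial hu 0)
  -- `L` lowers `j` by one and kills the terms with `j = 0`, so `lift` carries an induction on `j`.
  have gen : ∀ (j : ℕ) (u : LaurentSeries A), mapD c.d u = 0 →
      P (HahnSeries.single (2 * (j : ℤ)) u) ∈ c.evenRadial := by
    intro j
    induction j with
    | zero =>
      intro u hu
      apply lift
      rw [c.polarSchr_single V hu]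
      simp
    | succ j ih =>
      intro u hu
      apply lift
      rw [c.polarSchr_single V hu, show 2 * ((j + 1 : ℕ) : ℤ) - 2 = 2 * (j : ℤ) by push_cast; ring]
      exact ih _ (hL.mul_eq_zero (c.mapD_factor _) hu)
  induction hv using AddSubgroup.closure_induction with
  | mem x hx =>
    obtain ⟨u, j, hu, rfl⟩ := hx
    exact gen j u hu
  | zero => rw [map_zero]; exact zero_mem _
  | add x y _ _ hx hy => rw [map_add]; exact add_mem hx hy
  | neg x _ hx => rw [map_neg]; exact neg_mem hx

theorem polar_radius_sq : c.polar (coord 0 ^ 2 + coord 1 ^ 2) = radius A ^ 2 := by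
  rw [map_add, map_pow, map_pow, polar_coord, polar_coord, mul_pow, mul_pow, ← mul_add,
    ← map_pow, ← map_pow, ← map_add, c.norm_sq, map_one, mul_one]

theorem radius_sq_mul_mem {v : Polar A} (hv : v ∈ c.evenRadial) :
    radius A ^ 2 * v ∈ c.evenRadial := by
  have h : c.evenRadial ≤ c.evenRadial.comap (AddMonoidHom.mulLeft (radius A ^ 2)) := by
    refine (AddSubgroup.closure_le _).2 ?_
    rintro x ⟨u, j, hu, rfl⟩
    have : radius A ^ 2 * HahnSeries.single (2 * (j : ℤ)) u =
        HahnSeries.single (2 * ((j + 1 : ℕ) : ℤ)) u := by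
      rw [radius, HahnSeries.single_pow, HahnSeries.single_mul_single, one_pow, one_mul]
      exact congrArg (fun k : ℤ => (HahnSeries.single k u : Polar A))
        (by rw [nsmul_eq_mul]; push_cast; ring)
    change radius A ^ 2 * _ ∈ c.evenRadial
    rw [this]
    exact c.single_mem_evenRadial hu _
  exact h hv

theorem act_adSq_iterate_mem {V : A} {σ : MvPolynomial (Fin 2) RatFun}
    (h : ∀ v ∈ c.evenRadial, c.act V σ v ∈ c.evenRadial) (m : ℕ) :
    ∀ v ∈ c.evenRadial, c.act V (adSq^[m] σ) v ∈ c.evenRadial := by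
  induction m with
  | zero => exact h
  | succ m ih =>
    intro v hv
    rw [Function.iterate_succ_apply', act_adSq, polar_radius_sq]
    exact sub_mem (ih _ (c.radius_sq_mul_mem hv)) (c.radius_sq_mul_mem (ih _ hv))

/-! ### Reading off the principal symbol -/

theorem polarPoly_of_isHomogeneous {q : MvPolynomial (Fin 2) ℂ} {m : ℕ} (hq : q.IsHomogeneous m) :
    c.polarPoly q = radius A ^ m * incl A (aeval c.p q) := by
  rw [polarPoly, coe_eval₂Hom, eval₂_eq', aeval_def, eval₂_eq', map_sum, Finset.mul_sum]
  refine Finset.sum_congr rfl fun e he => ?_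
  have hdeg : e 0 + e 1 = m := by
    have := hq.degree_eq_sum_deg_support he
    rw [this, ← Finsupp.degree_apply, Finsupp.degree_eq_sum, Fin.sum_univ_two]
  rw [Fin.prod_univ_two, Fin.prod_univ_two, RingHom.comp_apply, map_mul, map_mul, map_pow, map_pow,
    ← hdeg, pow_add]
  ring

/-- If some residue of the Riccati solution does not vanish, then the constant principal symbol of
a commuting operator is radial. -/
theorem exists_aeval_of_commute {V : A} {ρ : A →ₗ[ℂ] ℂ} (hρ : ∀ a, ρ (c.d a) = 0)
    (hconst : ∀ a, c.d a = 0 → ∃ z : ℂ, a = algebraMap ℂ A z)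
    {n : ℕ} (hn : ρ (chi c.d V n) ≠ 0) {H : Finset Plane} {C₀ : Plane → ℂ}
    (hV : c.polar (potential H C₀) = radiusInv A ^ 2 * incl A V)
    {σ : MvPolynomial (Fin 2) RatFun} (hσ : Commute (schrodinger H C₀) (diffOp σ))
    {p₀ : MvPolynomial (Fin 2) ℂ} (hp₀ : principalSymbol σ = map (algebraMap ℂ RatFun) p₀) :
    ∃ q : Polynomial ℂ, p₀ = Polynomial.aeval (X 0 ^ 2 + X 1 ^ 2) q := by
  have : CharZero A := charZero_of_injective_algebraMap (algebraMap ℂ A).injective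
  set m := σ.totalDegree with hm
  have hhom : p₀.IsHomogeneous m := by
    refine IsHomogeneous.of_map (algebraMap ℂ RatFun).injective ?_
    rw [← hp₀]
    exact homogeneousComponent_isHomogeneous _ _
  have hmem : ∀ v ∈ c.evenRadial, c.act V σ v ∈ c.evenRadial := by
    intro v hv
    refine c.map_mem_evenRadial (V := V) (fun v => c.eq_single_of_polarSchr_eq_zero hρ hn)
      (P := c.act V σ) (c.polarSchr_act hV hσ) hv
  have h1 : (1 : Polar A) ∈ c.evenRadial := by
    have := c.single_mem_evenRadial (u := 1) (leibniz_mapD c.leibniz).map_one 0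
    simpa using this
  -- The `m`-fold commutator is multiplication by `2^m m! p₀(x)`; applied to `1` it shows that this
  -- function itself is even radial.
  have h2 := c.act_adSq_iterate_mem hmem m 1 h1
  rw [adSq_iterate (fun k hk => homogeneousComponent_eq_zero _ _ hk), act_C, mul_one] at h2
  have h3 : eval coord (homogeneousComponent m σ) = algebraMap _ RatFun p₀ := by
    change eval coord (principalSymbol σ) = _
    rw [hp₀, eval_map]
    have : (algebraMap (MvPolynomial (Fin 2) ℂ) RatFun) =
        eval₂Hom (algebraMap ℂ RatFun) coord := by
      apply MvPolynomial.ringHom_ext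
      · intro r
        rw [coe_eval₂Hom, eval₂_C, ← algebraMap_eq, ← IsScalarTower.algebraMap_apply]
      · intro i
        rw [coe_eval₂Hom, eval₂_X]; rfl
    rw [this]; rfl
  set N : ℕ := 2 ^ m * m.factorial with hN
  have hN0 : N ≠ 0 := by positivity
  have h4 : c.polar ((N : RatFun) * eval coord (homogeneousComponent m σ)) =
      radius A ^ m * incl A ((N : A) * aeval c.p p₀) := by
    rw [h3, map_mul, polar_algebraMap, c.polarPoly_of_isHomogeneous hhom, map_natCast, map_mul,
      map_natCast]
    ring
  have h5 : radius A ^ m * incl A ((N : A) * aeval c.p p₀) ∈ c.evenRadial := by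
    rw [← h4]
    exact h2
  have h6 : ((radius A ^ m * incl A ((N : A) * aeval c.p p₀)) : Polar A).coeff m =
      HahnSeries.C ((N : A) * aeval c.p p₀) := by
    rw [radius, HahnSeries.single_pow]
    change ((HahnSeries.single _ _ : Polar A) * HahnSeries.C _).coeff _ = _
    rw [HahnSeries.C_apply, HahnSeries.single_mul_single]
    simp
  obtain ⟨h7, h8⟩ := c.coeff_evenRadial h5 m
  rw [h6] at h7 h8
  have hNA : (N : A) ≠ 0 := by exact_mod_cast hN0
  -- The function is `r^m` times `N p₀(cos θ, sin θ)`. For even `m` the angular factor is constant,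
  -- so `p₀` is a multiple of a power of the squared radius; for odd `m` it is zero.
  rcases Nat.even_or_odd m with hev | hodd
  · rw [mapD_C] at h7
    have h9 : c.d ((N : A) * aeval c.p p₀) = 0 := by
      exact HahnSeries.C_injective (h7.trans (map_zero _).symm)
    obtain ⟨z, hz⟩ := hconst _ h9
    obtain ⟨l, hl⟩ := hev
    refine ⟨Polynomial.C (z / N) * Polynomial.X ^ l, ?_⟩
    rw [← sub_eq_zero]
    apply c.polarPoly_eq_zero
    rw [map_sub, c.polarPoly_of_isHomogeneous hhom, map_mul, map_pow, Polynomial.aeval_C,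
      Polynomial.aeval_X, map_mul, map_pow, algebraMap_eq, polarPoly_C, map_add, map_pow, map_pow,
      polarPoly_X, polarPoly_X, mul_pow, mul_pow, ← mul_add, ← map_pow, ← map_pow, ← map_add,
      c.norm_sq, map_one, mul_one, ← pow_mul, show 2 * l = m by omega, mul_comm, ← sub_mul,
      ← map_sub]
    have : aeval c.p p₀ - algebraMap ℂ A (z / N) = 0 := by
      rw [map_div₀, ← hz, map_natCast]
      field_simp
      ring
    rw [this, map_zero, zero_mul]
  · refine ⟨0, ?_⟩
    rw [map_zero]
    apply c.polarPoly_eq_zero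
    have h9 := h8 (by exact_mod_cast hodd)
    have h10 : (N : A) * aeval c.p p₀ = 0 := by
      exact HahnSeries.C_injective (h9.trans (map_zero _).symm)
    rw [c.polarPoly_of_isHomogeneous hhom, (mul_eq_zero.1 h10).resolve_left hNA, map_zero, mul_zero]

end CircleField

end Invariant

/-! ### Residues of the Riccati solution as differential polynomials -/

section DifferentialPolynomials

variable {A : Type*} [Field A] [Algebra ℂ A] {d : A →+ A} {V : A}

theorem map_ratCast_mul (hd : Leibniz d) (hdc : ∀ c : ℂ, d (algebraMap ℂ A c) = 0) (q : ℚ) (a : A) :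
    d ((q : A) * a) = q * d a := by
  have h : (q : A) = algebraMap ℂ A (q : ℂ) := by simp
  rw [hd, h, hdc, zero_mul, zero_add]

theorem chi_one : chi d V 1 = V / 2 := by
  have : CharZero A := charZero_of_injective_algebraMap (algebraMap ℂ A).injective
  have h := two_mul_chi_succ d V 0
  simp [chi_zero] at h
  linear_combination h / 2

theorem two_mul_chi_two : 2 * chi d V 2 = -d (chi d V 1) := by
  have h := two_mul_chi_succ d V 1
  simpa [chi_zero, Finset.Nat.antidiagonal_succ] using h

theorem two_mul_chi_three : 2 * chi d V 3 = -d (chi d V 2) - chi d V 1 ^ 2 := by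
  have h := two_mul_chi_succ d V 2
  simp [chi_zero, Finset.Nat.antidiagonal_succ] at h
  linear_combination h

theorem two_mul_chi_four : 2 * chi d V 4 = -d (chi d V 3) - 2 * chi d V 1 * chi d V 2 := by
  have h := two_mul_chi_succ d V 3
  simp [chi_zero, Finset.Nat.antidiagonal_succ] at h
  linear_combination h

theorem two_mul_chi_five :
    2 * chi d V 5 = -d (chi d V 4) - (2 * chi d V 1 * chi d V 3 + chi d V 2 ^ 2) := by
  have h := two_mul_chi_succ d V 4
  simp [chi_zero, Finset.Nat.antidiagonal_succ] at h
  linear_combination h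

theorem two_mul_chi_seven :
    2 * chi d V 7 = -d (chi d V 6) -
      (2 * chi d V 1 * chi d V 5 + 2 * chi d V 2 * chi d V 4 + chi d V 3 ^ 2) := by
  have h := two_mul_chi_succ d V 6
  simp [chi_zero, Finset.Nat.antidiagonal_succ] at h
  linear_combination h

theorem map_div_natCast (hd : Leibniz d) (hdc : ∀ c : ℂ, d (algebraMap ℂ A c) = 0) (a : A) (n : ℕ) :
    d (a / n) = d a / n := by
  have : CharZero A := charZero_of_injective_algebraMap (algebraMap ℂ A).injective
  have h := map_ratCast_mul hd hdc (1 / n) a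
  push_cast at h
  rw [div_eq_mul_one_div, mul_comm, h]
  ring

theorem chi_two (hd : Leibniz d) (hdc : ∀ c : ℂ, d (algebraMap ℂ A c) = 0) :
    chi d V 2 = -d V / 4 := by
  have : CharZero A := charZero_of_injective_algebraMap (algebraMap ℂ A).injective
  have h := two_mul_chi_two (d := d) (V := V)
  have h2 := map_div_natCast hd hdc V 2
  push_cast at h2
  rw [chi_one, h2] at h
  linear_combination h / 2

theorem chi_three (hd : Leibniz d) (hdc : ∀ c : ℂ, d (algebraMap ℂ A c) = 0) :
    chi d V 3 = (d (d V) - V ^ 2) / 8 := by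
  have : CharZero A := charZero_of_injective_algebraMap (algebraMap ℂ A).injective
  have h := two_mul_chi_three (d := d) (V := V)
  have h2 := map_div_natCast hd hdc (-d V) 4
  push_cast at h2
  rw [chi_two hd hdc, chi_one, h2, map_neg] at h
  linear_combination h / 2

theorem chi_four (hd : Leibniz d) (hdc : ∀ c : ℂ, d (algebraMap ℂ A c) = 0) :
    chi d V 4 = (4 * (V * d V) - d (d (d V))) / 16 := by
  have : CharZero A := charZero_of_injective_algebraMap (algebraMap ℂ A).injective
  have h := two_mul_chi_four (d := d) (V := V)
  have h2 := map_div_natCast hd hdc (d (d V) - V ^ 2) 8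
  push_cast at h2
  rw [chi_three hd hdc, chi_two hd hdc, chi_one, h2, map_sub, hd.map_sq] at h
  linear_combination h / 2

theorem chi_five (hd : Leibniz d) (hdc : ∀ c : ℂ, d (algebraMap ℂ A c) = 0) :
    chi d V 5 = (d (d (d (d V))) - 6 * V * d (d V) - 5 * d V ^ 2 + 2 * V ^ 3) / 32 := by
  have : CharZero A := charZero_of_injective_algebraMap (algebraMap ℂ A).injective
  have h := two_mul_chi_five (d := d) (V := V)
  have h2 := map_div_natCast hd hdc (4 * (V * d V) - d (d (d V))) 16
  have h3 : d (4 * (V * d V)) = 4 * d (V * d V) := by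
    have := map_ratCast_mul hd hdc 4 (V * d V)
    simpa using this
  push_cast at h2
  rw [chi_four hd hdc, chi_three hd hdc, chi_two hd hdc, chi_one, h2, map_sub, h3, hd] at h
  linear_combination h / 2

/-- `V²` is a multiple of `χ₃` up to a derivative. This and the next two are the first conserved
densities of the Korteweg–de Vries hierarchy. -/
theorem residue_sq (hd : Leibniz d) (hdc : ∀ c : ℂ, d (algebraMap ℂ A c) = 0)
    {ρ : A →ₗ[ℂ] ℂ} (hρ : ∀ a, ρ (d a) = 0) (hχ : ∀ n, ρ (chi d V n) = 0) :
    ρ (V ^ 2) = 0 := by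
  have : CharZero A := charZero_of_injective_algebraMap (algebraMap ℂ A).injective
  have h : V ^ 2 = d (d V) - (8 : ℂ) • chi d V 3 := by
    rw [chi_three hd hdc, Algebra.smul_def, map_ofNat]; ring
  rw [h, map_sub, map_smul, hρ, hχ]
  simp

theorem residue_cube (hd : Leibniz d) (hdc : ∀ c : ℂ, d (algebraMap ℂ A c) = 0)
    {ρ : A →ₗ[ℂ] ℂ} (hρ : ∀ a, ρ (d a) = 0) (hχ : ∀ n, ρ (chi d V n) = 0) :
    ρ (2 * V ^ 3 + d V ^ 2) = 0 := by
  have : CharZero A := charZero_of_injective_algebraMap (algebraMap ℂ A).injective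
  have h : 2 * V ^ 3 + d V ^ 2 =
      (32 : ℂ) • chi d V 5 - d (d (d (d V))) + (6 : ℂ) • d (V * d V) := by
    rw [chi_five hd hdc, hd V, Algebra.smul_def, Algebra.smul_def, map_ofNat, map_ofNat]; ring
  rw [h, map_add, map_sub, map_smul, map_smul, hρ, hρ, hχ]
  simp

/-- The density comes from `χ₇` modulo derivatives; `χ₆` enters only through `d χ₆`, so its formula
is never needed. -/
theorem residue_fourth (hd : Leibniz d) (hdc : ∀ c : ℂ, d (algebraMap ℂ A c) = 0)
    {ρ : A →ₗ[ℂ] ℂ} (hρ : ∀ a, ρ (d a) = 0) (hχ : ∀ n, ρ (chi d V n) = 0) :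
    ρ (5 * V ^ 4 + 10 * V * d V ^ 2 + d (d V) ^ 2) = 0 := by
  have : CharZero A := charZero_of_injective_algebraMap (algebraMap ℂ A).injective
  have h1 := two_mul_chi_seven (d := d) (V := V)
  rw [chi_five hd hdc, chi_four hd hdc, chi_three hd hdc, chi_two hd hdc, chi_one] at h1
  have e1 := hd (V ^ 2) (d V)
  have e2 := hd V (d (d (d V)))
  rw [hd.map_sq] at e1
  have h : 5 * V ^ 4 + 10 * V * d V ^ 2 + d (d V) ^ 2 =
      -(128 : ℂ) • chi d V 7 - (64 : ℂ) • d (chi d V 6) + (14 : ℂ) • d (V ^ 2 * d V)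
        - (2 : ℂ) • d (V * d (d (d V))) := by
    simp only [Algebra.smul_def, map_ofNat, map_neg, e1, e2]
    linear_combination 64 * h1
  rw [h, map_sub, map_add, map_sub, map_smul, map_smul, map_smul, map_smul, hρ, hρ, hρ, hχ]
  simp

end DifferentialPolynomials

/-! ### The differential field of Laurent series in the angle -/

/-- The coefficientwise algebra structure of Laurent series. -/
instance laurentAlgebra : Algebra ℂ (LaurentSeries ℂ) := HahnSeries.instAlgebra

/-- The derivation `d/dθ` of Laurent series. -/
def dTheta : LaurentSeries ℂ →+ LaurentSeries ℂ :=
  (AddMonoidHom.mulLeft (HahnSeries.single (-1) 1)).comp (euler ℂ)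

theorem dTheta_apply (x : LaurentSeries ℂ) :
    dTheta x = HahnSeries.single (-1) 1 * euler ℂ x := rfl

theorem coeff_dTheta (x : LaurentSeries ℂ) (n : ℤ) :
    (dTheta x).coeff n = (n + 1) * x.coeff (n + 1) := by
  rw [dTheta_apply, HahnSeries.coeff_single_mul, one_mul, coeff_euler, zsmul_eq_mul, sub_neg_eq_add]
  push_cast
  ring

theorem leibniz_dTheta : Leibniz dTheta := by
  intro x y
  simp only [dTheta_apply, leibniz_euler x y]
  ring

theorem dTheta_const (c : ℂ) : dTheta (algebraMap ℂ (LaurentSeries ℂ) c) = 0 := by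
  rw [← HahnSeries.C_eq_algebraMap, dTheta_apply, euler_C, mul_zero]

theorem eq_const_of_dTheta {a : LaurentSeries ℂ} (h : dTheta a = 0) :
    ∃ z : ℂ, a = algebraMap ℂ (LaurentSeries ℂ) z := by
  refine ⟨a.coeff 0, ?_⟩
  rw [← HahnSeries.C_eq_algebraMap, HahnSeries.C_apply]
  ext n
  by_cases hn : n = 0
  · rw [hn, HahnSeries.coeff_single_same]
  · rw [HahnSeries.coeff_single_of_ne hn]
    have h1 := congrArg (fun x => HahnSeries.coeff x (n - 1)) h
    simp only [coeff_dTheta, HahnSeries.coeff_zero, sub_add_cancel] at h1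
    refine (mul_eq_zero.1 h1).resolve_left ?_
    push_cast
    rw [sub_add_cancel]
    exact_mod_cast hn

/-! ### Residues and series with a pole of given order -/

/-- The residue at `θ = 0`. -/
def res : LaurentSeries ℂ →ₗ[ℂ] ℂ where
  toFun x := x.coeff (-1)
  map_add' _ _ := rfl
  map_smul' _ _ := rfl

theorem res_apply (x : LaurentSeries ℂ) : res x = x.coeff (-1) := rfl

theorem res_dTheta (x : LaurentSeries ℂ) : res (dTheta x) = 0 := by
  rw [res_apply, coeff_dTheta]; simp

/-- The Laurent series `θ⁻ᵏ f`. -/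
def poleSeries (k : ℕ) (f : PowerSeries ℂ) : LaurentSeries ℂ :=
  HahnSeries.single (-(k : ℤ)) 1 * HahnSeries.ofPowerSeries ℤ ℂ f

theorem res_poleSeries (k : ℕ) (f : PowerSeries ℂ) :
    res (poleSeries (k + 1) f) = PowerSeries.coeff k f := by
  rw [res_apply, poleSeries, HahnSeries.coeff_single_mul, one_mul,
    show (-1 - -((k + 1 : ℕ) : ℤ)) = (k : ℤ) by push_cast; ring, HahnSeries.ofPowerSeries_apply_coeff]

theorem poleSeries_mul (k l : ℕ) (f g : PowerSeries ℂ) :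
    poleSeries k f * poleSeries l g = poleSeries (k + l) (f * g) := by
  rw [poleSeries, poleSeries, poleSeries, mul_mul_mul_comm, HahnSeries.single_mul_single, one_mul,
    map_mul (HahnSeries.ofPowerSeries ℤ ℂ),
    show -(k : ℤ) + -(l : ℤ) = -((k + l : ℕ) : ℤ) by push_cast; ring]

theorem poleSeries_add (k : ℕ) (f g : PowerSeries ℂ) :
    poleSeries k f + poleSeries k g = poleSeries k (f + g) := by
  rw [poleSeries, poleSeries, poleSeries, map_add, mul_add]

theorem poleSeries_pow (k n : ℕ) (f : PowerSeries ℂ) :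
    poleSeries k f ^ n = poleSeries (n * k) (f ^ n) := by
  induction n with
  | zero => simp [poleSeries]
  | succ n ih => rw [pow_succ, ih, poleSeries_mul, pow_succ, Nat.succ_mul]

theorem natCast_mul_poleSeries (n k : ℕ) (f : PowerSeries ℂ) :
    (n : LaurentSeries ℂ) * poleSeries k f = poleSeries k ((n : PowerSeries ℂ) * f) := by
  rw [poleSeries, poleSeries, map_mul, map_natCast]
  ring

theorem dTheta_ofPowerSeries (f : PowerSeries ℂ) :
    dTheta (HahnSeries.ofPowerSeries ℤ ℂ f) =
      HahnSeries.ofPowerSeries ℤ ℂ (PowerSeries.derivative ℂ f) := by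
  ext n
  rw [coeff_dTheta, PowerSeries.coeff_coe, PowerSeries.coeff_coe]
  rcases lt_trichotomy n (-1) with h | h | h
  · rw [if_pos (by omega), if_pos (by omega), mul_zero]
  · subst h; simp
  · obtain ⟨m, rfl⟩ := Int.eq_ofNat_of_zero_le (show 0 ≤ n by omega)
    rw [if_neg (by omega), if_neg (by omega), PowerSeries.coeff_derivative,
      show (((m : ℕ) : ℤ) + 1).natAbs = m + 1 by omega, Int.natAbs_natCast]
    push_cast
    ring

theorem dTheta_poleSeries (k : ℕ) (f : PowerSeries ℂ) :
    dTheta (poleSeries k f) =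
      poleSeries (k + 1) (PowerSeries.X * PowerSeries.derivative ℂ f - (k : PowerSeries ℂ) * f) := by
  have h1 : dTheta (HahnSeries.single (-(k : ℤ)) 1) =
      -(k : LaurentSeries ℂ) * HahnSeries.single (-((k + 1 : ℕ) : ℤ)) 1 := by
    rw [dTheta_apply, euler_single, HahnSeries.single_mul_single, ← HahnSeries.single_zero_natCast,
      ← HahnSeries.single_neg, HahnSeries.single_mul_single]
    rw [show (-1 + -(k : ℤ)) = 0 + -((k + 1 : ℕ) : ℤ) by push_cast; ring]
    simp
  have h2 : HahnSeries.single (-(k : ℤ)) (1 : ℂ) = HahnSeries.single (-((k + 1 : ℕ) : ℤ)) 1 *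
      HahnSeries.ofPowerSeries ℤ ℂ PowerSeries.X := by
    rw [PowerSeries.coe_X, HahnSeries.single_mul_single, one_mul,
      show -(k : ℤ) = -((k + 1 : ℕ) : ℤ) + 1 by push_cast; ring]
  rw [poleSeries, leibniz_dTheta, h1, dTheta_ofPowerSeries, poleSeries, map_sub, map_mul, map_mul,
    map_natCast]
  linear_combination HahnSeries.ofPowerSeries ℤ ℂ (PowerSeries.derivative ℂ f) * h2

theorem coeff_X_mul_derivative_sub (f : PowerSeries ℂ) (k n : ℕ) :
    PowerSeries.coeff n (PowerSeries.X * PowerSeries.derivative ℂ f - (k : PowerSeries ℂ) * f) =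
      ((n : ℂ) - k) * PowerSeries.coeff n f := by
  rw [map_sub, ← nsmul_eq_mul, map_nsmul, nsmul_eq_mul]
  cases n with
  | zero => simp
  | succ n =>
    rw [PowerSeries.coeff_succ_X_mul, PowerSeries.coeff_derivative]
    push_cast
    ring

theorem coeff_natCast_mul (n k : ℕ) (f : PowerSeries ℂ) :
    PowerSeries.coeff k ((n : PowerSeries ℂ) * f) = n * PowerSeries.coeff k f := by
  rw [← nsmul_eq_mul, map_nsmul, nsmul_eq_mul]

/-- Vanishing residues of the Riccati solution for a potential with a double pole, in terms of
Laurent coefficients. -/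
theorem coeff_of_residues {W : PowerSeries ℂ} (h1 : PowerSeries.coeff 1 W = 0)
    (h0 : PowerSeries.coeff 0 W ≠ 0)
    (hχ : ∀ n, res (chi dTheta (poleSeries 2 W) n) = 0) :
    PowerSeries.coeff 3 W = 0 ∧
    (PowerSeries.coeff 0 W ≠ 2 → PowerSeries.coeff 5 W = 0) ∧
    (PowerSeries.coeff 0 W ≠ 2 → PowerSeries.coeff 0 W ≠ 6 → PowerSeries.coeff 7 W = 0) := by
  have r2 := residue_sq leibniz_dTheta dTheta_const res_dTheta hχ
  have r3 := residue_cube leibniz_dTheta dTheta_const res_dTheta hχ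
  have r4 := residue_fourth leibniz_dTheta dTheta_const res_dTheta hχ
  rw [poleSeries_pow, res_poleSeries] at r2
  have n2 : (2 : LaurentSeries ℂ) = ((2 : ℕ) : LaurentSeries ℂ) := by norm_num
  have n5 : (5 : LaurentSeries ℂ) = ((5 : ℕ) : LaurentSeries ℂ) := by norm_num
  have n10 : (10 : LaurentSeries ℂ) = ((10 : ℕ) : LaurentSeries ℂ) := by norm_num
  rw [dTheta_poleSeries, poleSeries_pow, poleSeries_pow, n2, natCast_mul_poleSeries,
    poleSeries_add, res_poleSeries] at r3
  rw [dTheta_poleSeries, dTheta_poleSeries, poleSeries_pow, poleSeries_pow, poleSeries_pow, n5, n10,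
    natCast_mul_poleSeries, natCast_mul_poleSeries, poleSeries_mul, poleSeries_add,
    poleSeries_add, res_poleSeries] at r4
  -- `V² = θ⁻⁴ W²` has residue `2 w₀ w₃`, because `w₁ = 0`.
  have hw3 : PowerSeries.coeff 3 W = 0 := by
    rw [pow_two, PowerSeries.coeff_mul] at r2
    simp [Finset.Nat.antidiagonal_succ, h1, -PowerSeries.coeff_zero_eq_constantCoeff] at r2
    have : 2 * PowerSeries.coeff 0 W * PowerSeries.coeff 3 W = 0 := by linear_combination r2
    simpa [h0, -PowerSeries.coeff_zero_eq_constantCoeff] using this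
  -- `W₁` and `W₂` are the numerators of `V'` over `θ³` and of `V''` over `θ⁴`.
  obtain ⟨W₁, hW₁⟩ : ∃ W₁, W₁ = PowerSeries.X * PowerSeries.derivative ℂ W -
    ((2 : ℕ) : PowerSeries ℂ) * W := ⟨_, rfl⟩
  obtain ⟨W₂, hW₂⟩ : ∃ W₂, W₂ = PowerSeries.X * PowerSeries.derivative ℂ W₁ -
    ((3 : ℕ) : PowerSeries ℂ) * W₁ := ⟨_, rfl⟩
  have c₁ : ∀ n, PowerSeries.coeff n W₁ = ((n : ℂ) - 2) * PowerSeries.coeff n W := by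
    intro n
    rw [hW₁, coeff_X_mul_derivative_sub]
    norm_num
  have c₂ : ∀ n, PowerSeries.coeff n W₂ = ((n : ℂ) - 3) * (((n : ℂ) - 2) * PowerSeries.coeff n W) := by
    intro n
    rw [hW₂, coeff_X_mul_derivative_sub, c₁]
    norm_num
  rw [← hW₁] at r3 r4
  rw [← hW₂] at r4
  have hw5 : PowerSeries.coeff 0 W ≠ 2 → PowerSeries.coeff 5 W = 0 := by
    intro hc
    rw [map_add, coeff_natCast_mul, pow_succ, pow_two, pow_two] at r3
    simp [PowerSeries.coeff_mul, Finset.Nat.antidiagonal_succ, h1, hw3, c₁,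
      -PowerSeries.coeff_zero_eq_constantCoeff] at r3
    -- Once `w₁` and `w₃` vanish, the residue is linear in `w₅`. Its factor degenerates at `w₀ = 2`;
    -- that of `w₇` below degenerates at `2` and `6`.
    have e : 6 * PowerSeries.coeff 0 W * (PowerSeries.coeff 0 W - 2) * PowerSeries.coeff 5 W = 0 := by
      linear_combination r3
    simpa [h0, sub_eq_zero, hc, -PowerSeries.coeff_zero_eq_constantCoeff] using e
  refine ⟨hw3, hw5, fun hc hc' => ?_⟩
  have hw5 := hw5 hc
  rw [map_add, map_add, coeff_natCast_mul, mul_assoc, coeff_natCast_mul, pow_two W₁, pow_two W₂,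
    show W ^ 4 = W * W * (W * W) by ring] at r4
  simp [PowerSeries.coeff_mul, Finset.Nat.antidiagonal_succ, h1, hw3, hw5, c₁, c₂,
    -PowerSeries.coeff_zero_eq_constantCoeff] at r4
  have e : 20 * PowerSeries.coeff 0 W * (PowerSeries.coeff 0 W - 2) * (PowerSeries.coeff 0 W - 6) *
      PowerSeries.coeff 7 W = 0 := by
    linear_combination r4
  simpa [h0, sub_eq_zero, hc, hc', -PowerSeries.coeff_zero_eq_constantCoeff] using e

/-! ### Sine and cosine series -/

theorem derivative_sin : PowerSeries.derivative ℂ (PowerSeries.sin ℂ) = PowerSeries.cos ℂ := by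
  ext n
  rw [PowerSeries.coeff_derivative, PowerSeries.sin, PowerSeries.cos, PowerSeries.coeff_mk,
    PowerSeries.coeff_mk]
  rcases Nat.even_or_odd n with h | h
  · obtain ⟨m, rfl⟩ := h
    rw [if_neg (by simp [parity_simps]), if_pos (by simp), show (m + m + 1) / 2 = m by omega,
      show (m + m) / 2 = m by omega, Nat.factorial_succ]
    have : ((m + m : ℕ) + 1 : ℂ) ≠ 0 := Nat.cast_add_one_ne_zero _
    have h2 : ((m + m).factorial : ℂ) ≠ 0 := by exact_mod_cast Nat.factorial_ne_zero _
    push_cast at this ⊢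
    rw [div_mul_eq_mul_div, div_eq_div_iff (mul_ne_zero this h2) h2]
    ring
  · rw [if_pos (by simpa [parity_simps] using h), if_neg (by simpa using h), zero_mul]

theorem derivative_cos : PowerSeries.derivative ℂ (PowerSeries.cos ℂ) = -PowerSeries.sin ℂ := by
  ext n
  rw [PowerSeries.coeff_derivative, map_neg, PowerSeries.sin, PowerSeries.cos, PowerSeries.coeff_mk,
    PowerSeries.coeff_mk]
  rcases Nat.even_or_odd n with h | h
  · rw [if_neg (by simpa [parity_simps] using h), if_pos h, zero_mul, neg_zero]
  · obtain ⟨m, rfl⟩ := h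
    rw [if_pos (by simp [parity_simps]), if_neg (by simp),
      show (2 * m + 1 + 1) / 2 = m + 1 by omega, show (2 * m + 1) / 2 = m by omega,
      Nat.factorial_succ (2 * m + 1)]
    have : ((2 * m + 1 : ℕ) + 1 : ℂ) ≠ 0 := Nat.cast_add_one_ne_zero _
    have h2 : ((2 * m + 1).factorial : ℂ) ≠ 0 := by exact_mod_cast Nat.factorial_ne_zero _
    push_cast at this ⊢
    simp
    field_simp
    ring

theorem constantCoeff_sin : PowerSeries.constantCoeff (PowerSeries.sin ℂ) = 0 := by
  rw [← PowerSeries.coeff_zero_eq_constantCoeff_apply]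
  simp [PowerSeries.sin]

theorem constantCoeff_cos : PowerSeries.constantCoeff (PowerSeries.cos ℂ) = 1 := by
  rw [← PowerSeries.coeff_zero_eq_constantCoeff_apply]
  simp [PowerSeries.cos]

theorem cos_sq_add_sin_sq : PowerSeries.cos ℂ ^ 2 + PowerSeries.sin ℂ ^ 2 = 1 := by
  apply PowerSeries.derivative.ext
  · rw [map_add, PowerSeries.derivative_pow, PowerSeries.derivative_pow, derivative_sin,
      derivative_cos, PowerSeries.derivative_one]
    push_cast
    ring
  · simp [constantCoeff_sin, constantCoeff_cos]

/-- The even power series `sin θ / θ`. -/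
def sinc : PowerSeries ℂ := PowerSeries.mk fun n => PowerSeries.coeff (n + 1) (PowerSeries.sin ℂ)

theorem X_mul_sinc : PowerSeries.X * sinc = PowerSeries.sin ℂ := by
  ext n
  cases n with
  | zero =>
    rw [PowerSeries.coeff_zero_X_mul, PowerSeries.coeff_zero_eq_constantCoeff_apply,
      constantCoeff_sin]
  | succ n => rw [PowerSeries.coeff_succ_X_mul, sinc, PowerSeries.coeff_mk]

theorem constantCoeff_sinc : PowerSeries.constantCoeff sinc = 1 := by
  rw [← PowerSeries.coeff_zero_eq_constantCoeff_apply]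
  simp [sinc, PowerSeries.sin]

theorem rescale_sinc : PowerSeries.rescale (-1) sinc = sinc := by
  ext n
  rw [PowerSeries.coeff_rescale, sinc, PowerSeries.coeff_mk, PowerSeries.sin, PowerSeries.coeff_mk]
  rcases Nat.even_or_odd n with h | h
  · rw [h.neg_one_pow, one_mul]
  · rw [if_pos (by simpa [parity_simps] using h), mul_zero]

/-- The odd coefficients of `1 / sin² θ` vanish. -/
theorem coeff_odd_inv_sinc_sq {n : ℕ} (hn : Odd n) : PowerSeries.coeff n (sinc ^ 2)⁻¹ = 0 := by
  have hc : PowerSeries.constantCoeff (sinc ^ 2) ≠ 0 := by simp [constantCoeff_sinc]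
  have h : PowerSeries.rescale (-1) (sinc ^ 2)⁻¹ = (sinc ^ 2)⁻¹ := by
    rw [PowerSeries.eq_inv_iff_mul_eq_one hc]
    nth_rewrite 2 [← rescale_sinc]
    rw [← map_pow, ← map_mul, PowerSeries.inv_mul_cancel _ hc, map_one]
  have h2 := congrArg (PowerSeries.coeff n) h
  rw [PowerSeries.coeff_rescale, hn.neg_one_pow] at h2
  linear_combination -h2 / 2

/-- The odd Taylor coefficients of `1 / (cos θ - y sin θ)²`. -/
theorem coeff_inv_sq {y : ℂ} (hy : 1 + y ^ 2 ≠ 0) :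
    PowerSeries.coeff 1 ((PowerSeries.cos ℂ - PowerSeries.C y * PowerSeries.sin ℂ) ^ 2)⁻¹ = 2 * y ∧
    PowerSeries.coeff 3 ((PowerSeries.cos ℂ - PowerSeries.C y * PowerSeries.sin ℂ) ^ 2)⁻¹ =
      (8 * y + 12 * y ^ 3) / 3 ∧
    PowerSeries.coeff 5 ((PowerSeries.cos ℂ - PowerSeries.C y * PowerSeries.sin ℂ) ^ 2)⁻¹ =
      (34 * y + 120 * y ^ 3 + 90 * y ^ 5) / 15 := by
  set l := PowerSeries.cos ℂ - PowerSeries.C y * PowerSeries.sin ℂ with hl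
  set k := PowerSeries.sin ℂ + PowerSeries.C y * PowerSeries.cos ℂ with hk
  have hl0 : PowerSeries.constantCoeff l ≠ 0 := by
    simp [hl, constantCoeff_sin, constantCoeff_cos]
  have hinv : l * l⁻¹ = 1 := PowerSeries.mul_inv_cancel _ hl0
  have hl2 : (l ^ 2)⁻¹ = l⁻¹ ^ 2 := by
    rw [PowerSeries.inv_eq_iff_mul_eq_one (by simpa using hl0), ← mul_pow, mul_comm, hinv, one_pow]
  have hdC : PowerSeries.derivative ℂ (PowerSeries.C y) = 0 := PowerSeries.derivative_C
  have dl : PowerSeries.derivative ℂ l = -k := by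
    rw [hl, hk, map_sub, Derivation.leibniz, hdC, derivative_sin, derivative_cos]
    simp only [smul_eq_mul]
    ring
  have dk : PowerSeries.derivative ℂ k = l := by
    rw [hl, hk, map_add, Derivation.leibniz, hdC, derivative_sin, derivative_cos]
    simp only [smul_eq_mul]
    ring
  -- `z = tan(θ + φ)` with `tan φ = y`. Since `z' = 1 + z² = (1 + y²)/l²`, the recursion `z' = 1 +
  -- z²` yields the Taylor coefficients of `1/l²`.
  obtain ⟨z, hz⟩ : ∃ z, z = k * l⁻¹ := ⟨_, rfl⟩
  have hz' : PowerSeries.derivative ℂ z = 1 + z ^ 2 := by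
    rw [hz, Derivation.leibniz, PowerSeries.derivative_inv', dl, dk]
    simp only [smul_eq_mul]
    linear_combination hinv
  have hsum : k ^ 2 + l ^ 2 = PowerSeries.C (1 + y ^ 2) := by
    rw [hl, hk, map_add, map_one, map_pow]
    linear_combination (1 + PowerSeries.C y ^ 2) * cos_sq_add_sin_sq
  have hh : PowerSeries.C (1 + y ^ 2) * (l ^ 2)⁻¹ = PowerSeries.derivative ℂ z := by
    rw [hz', hl2, ← hsum, hz]
    linear_combination (l * l⁻¹ + 1) * hinv
  have hcoef : ∀ n, (1 + y ^ 2) * PowerSeries.coeff n (l ^ 2)⁻¹ =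
      PowerSeries.coeff (n + 1) z * (n + 1) := by
    intro n
    rw [← PowerSeries.coeff_C_mul, hh, PowerSeries.coeff_derivative]
  have hrec : ∀ n, PowerSeries.coeff (n + 1) z * (n + 1) =
      PowerSeries.coeff n 1 + PowerSeries.coeff n (z * z) := by
    intro n
    rw [← PowerSeries.coeff_derivative, hz', pow_two, map_add]
  have z0 : PowerSeries.coeff 0 z = y := by
    rw [hz, PowerSeries.coeff_zero_eq_constantCoeff_apply, map_mul, PowerSeries.constantCoeff_inv]
    simp [hl, hk, constantCoeff_sin, constantCoeff_cos]
  have r0 := hrec 0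
  have r1 := hrec 1
  have r2 := hrec 2
  have r3 := hrec 3
  have r4 := hrec 4
  have r5 := hrec 5
  simp [PowerSeries.coeff_mul, Finset.Nat.antidiagonal_succ, PowerSeries.coeff_one,
    -PowerSeries.coeff_zero_eq_constantCoeff, z0] at r0 r1 r2 r3 r4 r5
  have z1 : PowerSeries.coeff 1 z = 1 + y ^ 2 := by linear_combination r0
  rw [z1] at r1 r2 r3 r4 r5
  have z2 : PowerSeries.coeff 2 z = y * (1 + y ^ 2) := by linear_combination r1 / 2
  rw [z2] at r2 r3 r4 r5
  have z3 : PowerSeries.coeff 3 z = (1 + y ^ 2) * (1 + 3 * y ^ 2) / 3 := by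
    linear_combination r2 / 3
  rw [z3] at r3 r4 r5
  have z4 : PowerSeries.coeff 4 z = (1 + y ^ 2) * (8 * y + 12 * y ^ 3) / 12 := by
    linear_combination r3 / 4
  rw [z4] at r4 r5
  have z5 : PowerSeries.coeff 5 z = (1 + y ^ 2) * (2 + 15 * y ^ 2 + 15 * y ^ 4) / 15 := by
    linear_combination r4 / 5
  rw [z5] at r5
  have z6 : PowerSeries.coeff 6 z = (1 + y ^ 2) * (34 * y + 120 * y ^ 3 + 90 * y ^ 5) / 90 := by
    linear_combination r5 / 6
  have c1 := hcoef 1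
  have c3 := hcoef 3
  have c5 := hcoef 5
  norm_num at c1 c3 c5
  rw [z2] at c1
  rw [z4] at c3
  rw [z6] at c5
  refine ⟨mul_left_cancel₀ hy ?_, mul_left_cancel₀ hy ?_, mul_left_cancel₀ hy ?_⟩
  · linear_combination c1
  · linear_combination c3
  · linear_combination c5

/-- The differential field of Laurent series in the angle measured from the direction `(a, b)`. -/
def angleField {a b : ℂ} (h : a ^ 2 + b ^ 2 = 1) : CircleField (LaurentSeries ℂ) where
  d := dTheta
  p := ![HahnSeries.ofPowerSeries ℤ ℂ
      (PowerSeries.C a * PowerSeries.cos ℂ - PowerSeries.C b * PowerSeries.sin ℂ),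
    HahnSeries.ofPowerSeries ℤ ℂ
      (PowerSeries.C b * PowerSeries.cos ℂ + PowerSeries.C a * PowerSeries.sin ℂ)]
  leibniz := leibniz_dTheta
  d_const := dTheta_const
  d_zero := by
    simp only [Matrix.cons_val_zero, Matrix.cons_val_one]
    rw [dTheta_ofPowerSeries, ← map_neg]
    congr 1
    rw [map_sub, Derivation.leibniz, Derivation.leibniz, derivative_sin, derivative_cos,
      PowerSeries.derivative_C, PowerSeries.derivative_C]
    simp only [smul_eq_mul]
    ring
  d_one := by
    simp only [Matrix.cons_val_zero, Matrix.cons_val_one]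
    rw [dTheta_ofPowerSeries]
    congr 1
    rw [map_add, Derivation.leibniz, Derivation.leibniz, derivative_sin, derivative_cos,
      PowerSeries.derivative_C, PowerSeries.derivative_C]
    simp only [smul_eq_mul]
    ring
  norm_sq := by
    simp only [Matrix.cons_val_zero, Matrix.cons_val_one]
    rw [← map_pow, ← map_pow, ← map_add, ← map_one (HahnSeries.ofPowerSeries ℤ ℂ)]
    congr 1
    have h2 : PowerSeries.C a ^ 2 + PowerSeries.C b ^ 2 = 1 := by
      rw [← map_pow, ← map_pow, ← map_add, h, map_one]
    linear_combination (PowerSeries.C a ^ 2 + PowerSeries.C b ^ 2) * cos_sq_add_sin_sq + h2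

/-! ### The local conditions at a line of the singular locus -/

theorem CircleField.polar_potential {A : Type} [Field A] [Algebra ℂ A] (c : CircleField A)
    (H : Finset Plane) (C₀ : Plane → ℂ) :
    c.polar (potential H C₀) = radiusInv A ^ 2 * incl A (∑ γ ∈ H, algebraMap ℂ A (C₀ γ) /
      (algebraMap ℂ A (γ 0 : ℂ) * c.p 0 + algebraMap ℂ A (γ 1 : ℂ) * c.p 1) ^ 2) := by
  rw [potential, map_sum, map_sum, Finset.mul_sum]
  refine Finset.sum_congr rfl fun γ _ => ?_
  have h : c.polar (linForm γ) = radius A * incl A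
      (algebraMap ℂ A (γ 0 : ℂ) * c.p 0 + algebraMap ℂ A (γ 1 : ℂ) * c.p 1) := by
    rw [linForm, Fin.sum_univ_two, map_add, map_mul, map_mul, c.polar_coord, c.polar_coord,
      c.polar_const, c.polar_const, map_add, map_mul, map_mul]
    ring
  have hr : radiusInv A = (radius A)⁻¹ := eq_inv_of_mul_eq_one_left radiusInv_mul_radius
  rw [map_div₀, map_pow, h, c.polar_const, map_div₀, map_pow, hr, mul_pow, inv_pow, div_eq_mul_inv,
    div_eq_mul_inv, mul_inv]
  ring

theorem angleField_linear {a b : ℂ} (h : a ^ 2 + b ^ 2 = 1) (s t : ℂ) :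
    algebraMap ℂ (LaurentSeries ℂ) s * (angleField h).p 0 +
      algebraMap ℂ (LaurentSeries ℂ) t * (angleField h).p 1 =
    HahnSeries.ofPowerSeries ℤ ℂ (PowerSeries.C (s * a + t * b) * PowerSeries.cos ℂ -
      PowerSeries.C (s * b - t * a) * PowerSeries.sin ℂ) := by
  simp only [angleField, Matrix.cons_val_zero, Matrix.cons_val_one]
  rw [← HahnSeries.C_eq_algebraMap, ← HahnSeries.ofPowerSeries_C, ← HahnSeries.ofPowerSeries_C,
    ← map_mul, ← map_mul, ← map_add]
  congr 1
  simp only [map_add, map_sub, map_mul]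
  ring

/-- Cross-multiplied, the hypothesis also covers the linear form of `β` itself, which vanishes at `θ
= 0`. -/
theorem const_div_eq_poleSeries {z : ℂ} {f g : PowerSeries ℂ} (hf : f ≠ 0)
    (h : PowerSeries.X ^ 2 * PowerSeries.C z = g * f ^ 2) :
    algebraMap ℂ (LaurentSeries ℂ) z / HahnSeries.ofPowerSeries ℤ ℂ f ^ 2 = poleSeries 2 g := by
  have hf' : HahnSeries.ofPowerSeries ℤ ℂ f ≠ 0 := by
    rw [Ne, ← map_zero (HahnSeries.ofPowerSeries ℤ ℂ)]
    exact fun e => hf (HahnSeries.ofPowerSeries_injective e)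
  rw [div_eq_iff (pow_ne_zero 2 hf'), poleSeries, mul_assoc, ← map_pow, ← map_mul, ← h, map_mul,
    map_pow, HahnSeries.ofPowerSeries_X, HahnSeries.ofPowerSeries_C, HahnSeries.single_pow,
    ← mul_assoc, HahnSeries.single_mul_single, ← HahnSeries.C_eq_algebraMap]
  simp

theorem poleSeries_sum {ι : Type*} (k : ℕ) (s : Finset ι) (f : ι → PowerSeries ℂ) :
    ∑ i ∈ s, poleSeries k (f i) = poleSeries k (∑ i ∈ s, f i) := by
  simp only [poleSeries]
  rw [map_sum, Finset.mul_sum]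

/-- The potential on the unit circle near the line orthogonal to `β`. -/
def localSeries (c : ℂ) {ι : Type*} (s : Finset ι) (w y : ι → ℂ) : PowerSeries ℂ :=
  PowerSeries.C c * (sinc ^ 2)⁻¹ + PowerSeries.X ^ 2 * ∑ i ∈ s, PowerSeries.C (w i) *
    ((PowerSeries.cos ℂ - PowerSeries.C (y i) * PowerSeries.sin ℂ) ^ 2)⁻¹

theorem coeff_localSeries (c : ℂ) {ι : Type*} (s : Finset ι) (w y : ι → ℂ) (n : ℕ) :
    PowerSeries.coeff (n + 2) (localSeries c s w y) =
      c * PowerSeries.coeff (n + 2) (sinc ^ 2)⁻¹ + ∑ i ∈ s, w i * PowerSeries.coeff n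
        ((PowerSeries.cos ℂ - PowerSeries.C (y i) * PowerSeries.sin ℂ) ^ 2)⁻¹ := by
  rw [localSeries, map_add, PowerSeries.coeff_C_mul, PowerSeries.coeff_X_pow_mul, map_sum]
  simp only [PowerSeries.coeff_C_mul]

theorem coeff_one_localSeries (c : ℂ) {ι : Type*} (s : Finset ι) (w y : ι → ℂ) :
    PowerSeries.coeff 1 (localSeries c s w y) = 0 := by
  rw [localSeries, map_add, PowerSeries.coeff_C_mul, coeff_odd_inv_sinc_sq odd_one,
    PowerSeries.coeff_X_pow_mul']
  simp

theorem coeff_zero_localSeries (c : ℂ) {ι : Type*} (s : Finset ι) (w y : ι → ℂ) :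
    PowerSeries.coeff 0 (localSeries c s w y) = c := by
  rw [localSeries, map_add, PowerSeries.coeff_C_mul, PowerSeries.coeff_X_pow_mul',
    PowerSeries.coeff_zero_eq_constantCoeff_apply, PowerSeries.constantCoeff_inv]
  simp [constantCoeff_sinc]

/-- `c/sin²` is even, so the odd coefficients come from the other lines. At `θⁿ`, `n = 1, 3, 5`,
each contributes an odd polynomial of degree `n` in its cotangent, and the system for the moments is
triangular. -/
theorem moments_of_residues {c : ℂ} (hc : c ≠ 0) {ι : Type*} {s : Finset ι} {w y : ι → ℂ}
    (hy : ∀ i ∈ s, 1 + y i ^ 2 ≠ 0)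
    (hχ : ∀ n, res (chi dTheta (poleSeries 2 (localSeries c s w y)) n) = 0) :
    ∑ i ∈ s, w i * y i = 0 ∧ (c ≠ 2 → ∑ i ∈ s, w i * y i ^ 3 = 0) ∧
      (c ≠ 2 → c ≠ 6 → ∑ i ∈ s, w i * y i ^ 5 = 0) := by
  have h := coeff_of_residues (coeff_one_localSeries c s w y)
    (by rwa [coeff_zero_localSeries]) hχ
  rw [coeff_zero_localSeries, coeff_localSeries c s w y 1, coeff_localSeries c s w y 3,
    coeff_localSeries c s w y 5, coeff_odd_inv_sinc_sq (by decide),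
    coeff_odd_inv_sinc_sq (by decide), coeff_odd_inv_sinc_sq (by decide), mul_zero, zero_add,
    zero_add, zero_add] at h
  obtain ⟨h1, h3, h5⟩ := h
  rw [Finset.sum_congr rfl fun i hi => by rw [(coeff_inv_sq (hy i hi)).1]] at h1
  rw [Finset.sum_congr rfl fun i hi => by rw [(coeff_inv_sq (hy i hi)).2.1]] at h3
  rw [Finset.sum_congr rfl fun i hi => by rw [(coeff_inv_sq (hy i hi)).2.2]] at h5
  have e1 : ∑ i ∈ s, w i * (2 * y i) = 2 * ∑ i ∈ s, w i * y i := by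
    rw [Finset.mul_sum]
    exact Finset.sum_congr rfl fun i _ => by ring
  have e3 : ∑ i ∈ s, w i * ((8 * y i + 12 * y i ^ 3) / 3) =
      8 / 3 * ∑ i ∈ s, w i * y i + 4 * ∑ i ∈ s, w i * y i ^ 3 := by
    rw [Finset.mul_sum, Finset.mul_sum, ← Finset.sum_add_distrib]
    exact Finset.sum_congr rfl fun i _ => by ring
  have e5 : ∑ i ∈ s, w i * ((34 * y i + 120 * y i ^ 3 + 90 * y i ^ 5) / 15) =
      34 / 15 * ∑ i ∈ s, w i * y i + 8 * ∑ i ∈ s, w i * y i ^ 3 + 6 * ∑ i ∈ s, w i * y i ^ 5 := by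
    rw [Finset.mul_sum, Finset.mul_sum, Finset.mul_sum, ← Finset.sum_add_distrib,
      ← Finset.sum_add_distrib]
    exact Finset.sum_congr rfl fun i _ => by ring
  rw [e1] at h1
  rw [e3] at h3
  rw [e5] at h5
  have s1 : ∑ i ∈ s, w i * y i = 0 := by linear_combination h1 / 2
  have s3 : c ≠ 2 → ∑ i ∈ s, w i * y i ^ 3 = 0 := fun h2 => by
    linear_combination (h3 h2) / 4 - 2 / 3 * s1
  refine ⟨s1, s3, fun h2 h6 => ?_⟩
  linear_combination (h5 h2 h6) / 6 - 34 / 90 * s1 - 8 / 6 * s3 h2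

/-- The oriented area spanned by two vectors. -/
def cross (β γ : Plane) : ℝ := β 0 * γ 1 - β 1 * γ 0

/-- The cotangent of the oriented angle between two vectors. -/
def cot (β γ : Plane) : ℝ := (β 0 * γ 0 + β 1 * γ 1) / cross β γ

/-- Necessary conditions for integrability at a vector of the singular locus. -/
theorem moments_of_commutant {H : Finset Plane} {C₀ : Plane → ℂ}
    (hP : HasNontrivialCommutant H C₀) {β : Plane} (hβ : β ∈ H) (hC : C₀ β ≠ 0)
    (hβ0 : 0 < β 0 ^ 2 + β 1 ^ 2) (hcross : ∀ γ ∈ H.erase β, cross β γ ≠ 0) :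
    ∑ γ ∈ H.erase β, C₀ γ / (cross β γ : ℂ) ^ 2 * (cot β γ : ℂ) = 0 ∧
    (C₀ β / ((β 0 : ℂ) ^ 2 + (β 1 : ℂ) ^ 2) ≠ 2 →
      ∑ γ ∈ H.erase β, C₀ γ / (cross β γ : ℂ) ^ 2 * (cot β γ : ℂ) ^ 3 = 0) ∧
    (C₀ β / ((β 0 : ℂ) ^ 2 + (β 1 : ℂ) ^ 2) ≠ 2 → C₀ β / ((β 0 : ℂ) ^ 2 + (β 1 : ℂ) ^ 2) ≠ 6 →
      ∑ γ ∈ H.erase β, C₀ γ / (cross β γ : ℂ) ^ 2 * (cot β γ : ℂ) ^ 5 = 0) := by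
  obtain ⟨n, hn0, hn⟩ : ∃ n : ℝ, n ≠ 0 ∧ n ^ 2 = β 0 ^ 2 + β 1 ^ 2 :=
    ⟨Real.sqrt (β 0 ^ 2 + β 1 ^ 2), (Real.sqrt_pos.2 hβ0).ne', Real.sq_sqrt hβ0.le⟩
  have hn0' : (n : ℂ) ≠ 0 := by exact_mod_cast hn0
  have hn' : (n : ℂ) ^ 2 = (β 0 : ℂ) ^ 2 + (β 1 : ℂ) ^ 2 := by exact_mod_cast hn
  -- The angle is measured from `β` turned by a right angle, the direction of the line `⟨β, x⟩ = 0`.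
  have hab : (-(β 1 : ℂ) / n) ^ 2 + ((β 0 : ℂ) / n) ^ 2 = 1 := by
    field_simp
    linear_combination -hn'
  set c := angleField hab with hcdef
  set W := localSeries (C₀ β / (n : ℂ) ^ 2) (H.erase β)
    (fun γ => n ^ 2 * (C₀ γ / (cross β γ : ℂ) ^ 2)) (fun γ => (cot β γ : ℂ)) with hW
  have hV : c.polar (potential H C₀) =
      radiusInv (LaurentSeries ℂ) ^ 2 * incl (LaurentSeries ℂ) (poleSeries 2 W) := by
    rw [c.polar_potential, ← Finset.add_sum_erase H _ hβ, hW, localSeries, ← poleSeries_add,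
      Finset.mul_sum, ← poleSeries_sum]
    congr 3
    -- On the circle the form of `β` is `-n sin θ`, which makes the double pole.
    · rw [hcdef, angleField_linear]
      have e1 : (β 0 : ℂ) * (-(β 1 : ℂ) / n) + (β 1 : ℂ) * ((β 0 : ℂ) / n) = 0 := by ring
      have e2 : (β 0 : ℂ) * ((β 0 : ℂ) / n) - (β 1 : ℂ) * (-(β 1 : ℂ) / n) = n := by
        field_simp
        linear_combination -hn'
      have hs : PowerSeries.constantCoeff (sinc ^ 2) ≠ 0 := by simp [constantCoeff_sinc]
      have hCn : PowerSeries.C (C₀ β / (n : ℂ) ^ 2) * PowerSeries.C (n : ℂ) ^ 2 =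
          PowerSeries.C (C₀ β) := by
        rw [← map_pow, ← map_mul, div_mul_cancel₀ _ (pow_ne_zero 2 hn0')]
      rw [e1, e2, map_zero, zero_mul, zero_sub, ← X_mul_sinc]
      apply const_div_eq_poleSeries
      · have : sinc ≠ 0 := fun h => by simp [h] at hs
        have hX : (PowerSeries.X : PowerSeries ℂ) ≠ 0 := PowerSeries.X_ne_zero
        have hCn0 : PowerSeries.C (n : ℂ) ≠ 0 := by simpa using hn0
        exact neg_ne_zero.2 (mul_ne_zero hCn0 (mul_ne_zero hX this))
      · have := PowerSeries.inv_mul_cancel _ hs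
        linear_combination (-PowerSeries.X ^ 2) * hCn - PowerSeries.X ^ 2 *
          PowerSeries.C (C₀ β / (n : ℂ) ^ 2) * PowerSeries.C (n : ℂ) ^ 2 * this
    · refine Finset.sum_congr rfl fun γ hγ => ?_
      -- On the circle the form of `γ` is `D (cos θ - cot β γ · sin θ)` with `D = cross β γ / n`.
      rw [hcdef, angleField_linear]
      have hd := hcross γ hγ
      have hd' : (cross β γ : ℂ) ≠ 0 := by exact_mod_cast hd
      obtain ⟨D, hD⟩ : ∃ D : ℂ, D = cross β γ / n := ⟨_, rfl⟩
      have hD0 : D ≠ 0 := by rw [hD]; exact div_ne_zero hd' hn0'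
      have e1 : (γ 0 : ℂ) * (-(β 1 : ℂ) / n) + (γ 1 : ℂ) * ((β 0 : ℂ) / n) = D := by
        rw [hD, cross]
        push_cast
        ring
      have e2 : (γ 0 : ℂ) * ((β 0 : ℂ) / n) - (γ 1 : ℂ) * (-(β 1 : ℂ) / n) = D * cot β γ := by
        rw [hD, cot]
        push_cast
        field_simp
        ring
      have hCn : PowerSeries.C (n ^ 2 * (C₀ γ / (cross β γ : ℂ) ^ 2)) * PowerSeries.C D ^ 2 =
          PowerSeries.C (C₀ γ) := by
        rw [← map_pow, ← map_mul, hD]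
        congr 1
        field_simp
      rw [e1, e2]
      set l := PowerSeries.cos ℂ - PowerSeries.C (cot β γ : ℂ) * PowerSeries.sin ℂ with hl
      have hl0 : PowerSeries.constantCoeff l ≠ 0 := by
        simp [hl, constantCoeff_sin, constantCoeff_cos]
      have hl2 : PowerSeries.constantCoeff (l ^ 2) ≠ 0 := by simpa using hl0
      have e3 : PowerSeries.C D * PowerSeries.cos ℂ -
          PowerSeries.C (D * cot β γ) * PowerSeries.sin ℂ = PowerSeries.C D * l := by
        rw [hl, map_mul]; ring
      rw [e3]
      apply const_div_eq_poleSeries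
      · exact mul_ne_zero (by simpa using hD0) fun h => by simp [h] at hl0
      · have := PowerSeries.inv_mul_cancel _ hl2
        linear_combination (-PowerSeries.X ^ 2) * hCn - PowerSeries.X ^ 2 *
          PowerSeries.C (n ^ 2 * (C₀ γ / (cross β γ : ℂ) ^ 2)) * PowerSeries.C D ^ 2 * this
  have hχ : ∀ m, res (chi dTheta (poleSeries 2 W) m) = 0 := by
    by_contra! h
    obtain ⟨m, hm⟩ := h
    obtain ⟨σ, p₀, hσ, hp₀, hq⟩ := hP
    obtain ⟨q, hq'⟩ := c.exists_aeval_of_commute (ρ := res) res_dTheta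
      (fun a => eq_const_of_dTheta) hm hV hσ hp₀
    exact hq q hq'
  have hmom := moments_of_residues (div_ne_zero hC (pow_ne_zero 2 hn0')) (fun γ _ => ?_) hχ
  · simp only [mul_assoc, ← Finset.mul_sum, mul_eq_zero, pow_eq_zero_iff, ne_eq,
      OfNat.ofNat_ne_zero, not_false_eq_true, hn0', false_or] at hmom
    rwa [hn'] at hmom
  · have : (1 + cot β γ ^ 2 : ℝ) ≠ 0 := by positivity
    exact_mod_cast this

/-! ### Plane geometry -/

theorem inner_eq (α β : Plane) : inner ℝ α β = α 0 * β 0 + α 1 * β 1 := by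
  simp [PiLp.inner_apply, Fin.sum_univ_two, mul_comm]

theorem norm_sq_eq (α : Plane) : ‖α‖ ^ 2 = α 0 ^ 2 + α 1 ^ 2 := by
  simp [EuclideanSpace.norm_sq_eq, Fin.sum_univ_two]

theorem plane_ext {α β : Plane} (h0 : α 0 = β 0) (h1 : α 1 = β 1) : α = β := by
  ext i
  fin_cases i
  · exact h0
  · exact h1

theorem vec_zero (s t : ℝ) : vec s t 0 = s := rfl

theorem vec_one (s t : ℝ) : vec s t 1 = t := rfl

theorem vec_injective {s t s' t' : ℝ} : vec s t = vec s' t' ↔ s = s' ∧ t = t' :=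
  ⟨fun h => ⟨congrArg (fun v : Plane => v 0) h, congrArg (fun v : Plane => v 1) h⟩,
    fun h => by rw [h.1, h.2]⟩

theorem cross_ne_zero {α β : Plane} (h : LinearIndependent ℝ ![α, β]) : cross α β ≠ 0 := by
  intro hc
  rw [LinearIndependent.pair_iff] at h
  rw [cross] at hc
  have h1 := h (β 1) (-α 1) (plane_ext (by simp; linear_combination hc) (by simp; ring))
  have h0 := h (β 0) (-α 0) (plane_ext (by simp; ring) (by simp; linear_combination -hc))
  have := h 1 0 (plane_ext (by simp; linarith [h0.2]) (by simp; linarith [h1.2]))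
  exact one_ne_zero this.1

theorem sq_add_sq_pos_of_cross {α β : Plane} (h : cross α β ≠ 0) : 0 < α 0 ^ 2 + α 1 ^ 2 := by
  by_contra hn
  have h0 : α 0 = 0 := by nlinarith [sq_nonneg (α 0), sq_nonneg (α 1)]
  have h1 : α 1 = 0 := by nlinarith [sq_nonneg (α 0), sq_nonneg (α 1)]
  exact h (by simp [cross, h0, h1])

theorem cross_swap (α β : Plane) : cross β α = -cross α β := by
  simp only [cross]; ring

theorem cot_swap (α β : Plane) : cot β α = -cot α β := by
  rw [cot, cot, cross_swap, div_neg]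
  ring

/-- Lagrange's identity; it converts `C_γ / cross²` into the weight `C_γ / |γ|²`. -/
theorem one_add_cot_sq {α β : Plane} (h : cross α β ≠ 0) :
    cross α β ^ 2 * (1 + cot α β ^ 2) = (α 0 ^ 2 + α 1 ^ 2) * (β 0 ^ 2 + β 1 ^ 2) := by
  rw [cot]
  field_simp
  rw [cross]
  ring

/-- The addition theorem of the cotangent. -/
theorem cot_sub {α β γ : Plane} (hβ : cross α β ≠ 0) (hγ : cross α γ ≠ 0) (h : cross β γ ≠ 0) :
    cot β γ = (cot α β * cot α γ + 1) / (cot α β - cot α γ) := by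
  have hα := sq_add_sq_pos_of_cross hβ
  have e : cot α β - cot α γ = (α 0 ^ 2 + α 1 ^ 2) * cross β γ / (cross α β * cross α γ) := by
    rw [cot, cot]
    field_simp
    simp only [cross]
    ring
  rw [e, eq_div_iff (div_ne_zero (mul_ne_zero hα.ne' h) (mul_ne_zero hβ hγ))]
  simp only [cot]
  field_simp
  simp only [cross]
  ring

theorem cot_ne_cot {α β γ : Plane} (hβ : cross α β ≠ 0) (hγ : cross α γ ≠ 0) (h : cross β γ ≠ 0) :
    cot α β ≠ cot α γ := by
  intro e
  have hα := sq_add_sq_pos_of_cross hβ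
  rw [cot, cot, div_eq_div_iff hβ hγ] at e
  have : (α 0 ^ 2 + α 1 ^ 2) * cross β γ = 0 := by
    simp only [cross] at e ⊢
    linear_combination e
  exact mul_ne_zero hα.ne' h this

/-- The rotation taking `β` to a positive multiple of the first basis vector. -/
theorem exists_rotation {β : Plane} (hβ : 0 < β 0 ^ 2 + β 1 ^ 2) :
    ∃ (g : Plane ≃ₗᵢ[ℝ] Plane) (n : ℝ), n ≠ 0 ∧ n ^ 2 = β 0 ^ 2 + β 1 ^ 2 ∧
      ∀ v, g v = vec ((β 0 * v 0 + β 1 * v 1) / n) (cross β v / n) := by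
  obtain ⟨n, hn0, hn⟩ : ∃ n : ℝ, n ≠ 0 ∧ n ^ 2 = β 0 ^ 2 + β 1 ^ 2 :=
    ⟨Real.sqrt (β 0 ^ 2 + β 1 ^ 2), (Real.sqrt_pos.2 hβ).ne', Real.sq_sqrt hβ.le⟩
  let f : Plane →ₗ[ℝ] Plane :=
    { toFun := fun v => vec ((β 0 * v 0 + β 1 * v 1) / n) (cross β v / n)
      map_add' := fun v w => plane_ext
        (by simp only [vec_zero, PiLp.add_apply]; ring)
        (by simp only [vec_one, PiLp.add_apply, cross]; ring)
      map_smul' := fun c v => plane_ext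
        (by simp only [vec_zero, PiLp.smul_apply, smul_eq_mul, RingHom.id_apply]; ring)
        (by simp only [vec_one, PiLp.smul_apply, smul_eq_mul, RingHom.id_apply, cross]; ring) }
  have hf : ∀ v, ‖f v‖ = ‖v‖ := by
    intro v
    rw [← sq_eq_sq₀ (norm_nonneg _) (norm_nonneg _), norm_sq_eq, norm_sq_eq]
    change ((β 0 * v 0 + β 1 * v 1) / n) ^ 2 + (cross β v / n) ^ 2 = _
    rw [cross]
    field_simp
    rw [hn]
    ring
  exact ⟨LinearIsometry.toLinearIsometryEquiv ⟨f, hf⟩ rfl, n, hn0, hn, fun v => rfl⟩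

/-- The normal form of a singular locus with respect to one of its vectors. -/
theorem locusEquiv_cot {H : Finset Plane} {β : Plane} (hβ : β ∈ H) (hβ0 : 0 < β 0 ^ 2 + β 1 ^ 2)
    (hcross : ∀ γ ∈ H.erase β, cross β γ ≠ 0) :
    LocusEquiv (H : Set Plane)
      (insert (vec 1 0) ((fun γ => vec (cot β γ) 1) '' (H.erase β : Set Plane))) := by
  classical
  obtain ⟨g, n, hn0, hn, hg⟩ := exists_rotation hβ0
  -- After the rotation `β` is `(n, 0)` and becomes `e₁`; every other vector is scaled to have
  -- second coordinate `1`.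
  refine ⟨g, fun γ => if γ = β then 1 / n else n / cross β γ, ?_, ?_⟩
  · intro γ hγ
    dsimp only
    split_ifs with h
    · exact one_div_ne_zero hn0
    · exact div_ne_zero hn0 (hcross γ (Finset.mem_erase.2 ⟨h, hγ⟩))
  · rw [← Finset.insert_erase hβ, Finset.coe_insert, Set.image_insert_eq,
      Finset.erase_insert (Finset.notMem_erase _ _)]
    congr 1
    · dsimp only
      rw [if_pos rfl, hg]
      refine plane_ext ?_ ?_
      · simp only [vec_zero, PiLp.smul_apply, smul_eq_mul]
        field_simp
        linear_combination hn
      · simp only [vec_one, PiLp.smul_apply, smul_eq_mul, cross]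
        ring
    · refine Set.image_congr fun γ hγ => ?_
      have hγ' : γ ∈ H.erase β := hγ
      have hc := hcross γ hγ'
      dsimp only
      rw [if_neg (Finset.ne_of_mem_erase hγ'), hg]
      refine plane_ext ?_ ?_
      · simp only [vec_zero, PiLp.smul_apply, smul_eq_mul, cot]
        field_simp
      · simp only [vec_one, PiLp.smul_apply, smul_eq_mul]
        field_simp

/-! ### Equivalence of loci -/

theorem LocusEquiv.refl (S : Set Plane) : LocusEquiv S S :=
  ⟨LinearIsometryEquiv.refl ℝ Plane, fun _ => 1, fun _ _ => one_ne_zero, by simp⟩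

theorem LocusEquiv.trans {S S' S'' : Set Plane} (h : LocusEquiv S S') (h' : LocusEquiv S' S'') :
    LocusEquiv S S'' := by
  obtain ⟨g, k, hk, rfl⟩ := h
  obtain ⟨g', k', hk', rfl⟩ := h'
  refine ⟨g.trans g', fun α => k' (k α • g α) * k α,
    fun α hα => mul_ne_zero (hk' _ (Set.mem_image_of_mem _ hα)) (hk α hα), ?_⟩
  rw [Set.image_image]
  refine Set.image_congr fun α _ => ?_
  simp [smul_smul]

theorem LocusEquivWith.locusEquiv {S S' : Set Plane} {C₀ C₁ : Plane → ℂ}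
    (h : LocusEquivWith S C₀ S' C₁) : LocusEquiv S S' := by
  obtain ⟨g, k, hk, h, -⟩ := h
  exact ⟨g, k, hk, h⟩

/-- An isometry preserves cotangents up to a common sign. -/
theorem exists_sign_cot (g : Plane ≃ₗᵢ[ℝ] Plane) :
    ∃ ε : ℝ, (ε = 1 ∨ ε = -1) ∧ ∀ (k l : ℝ) (α β : Plane), k ≠ 0 → l ≠ 0 →
      cot (k • g α) (l • g β) = ε * cot α β := by
  have hexp : ∀ α : Plane, g α = α 0 • g (vec 1 0) + α 1 • g (vec 0 1) := by
    intro α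
    rw [← map_smul, ← map_smul, ← map_add]
    congr 1
    exact plane_ext (by simp [vec_zero]) (by simp [vec_one])
  -- `ε` is the determinant of `g`; its square is the Gram determinant of an orthonormal pair.
  set ε := cross (g (vec 1 0)) (g (vec 0 1)) with hε
  have hcross : ∀ α β, cross (g α) (g β) = ε * cross α β := by
    intro α β
    rw [hexp α, hexp β, hε]
    simp only [cross, PiLp.add_apply, PiLp.smul_apply, smul_eq_mul]
    ring
  have hinner : ∀ α β : Plane, g α 0 * g β 0 + g α 1 * g β 1 = α 0 * β 0 + α 1 * β 1 := by
    intro α β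
    rw [← inner_eq, ← inner_eq, g.inner_map_map]
  have hsq : ε ^ 2 = 1 := by
    have h1 := hinner (vec 1 0) (vec 1 0)
    have h2 := hinner (vec 0 1) (vec 0 1)
    have h3 := hinner (vec 1 0) (vec 0 1)
    simp only [vec_zero, vec_one, mul_one, mul_zero, add_zero, zero_add] at h1 h2 h3
    rw [hε, cross]
    generalize g (vec 1 0) 0 = a at *
    generalize g (vec 1 0) 1 = b at *
    generalize g (vec 0 1) 0 = c at *
    generalize g (vec 0 1) 1 = d at *
    linear_combination (c * c + d * d) * h1 + h2 - (a * c + b * d) * h3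
  have hε' : ε = 1 ∨ ε = -1 := sq_eq_one_iff.1 hsq
  refine ⟨ε, hε', fun k l α β hk hl => ?_⟩
  have e1 : cross (k • g α) (l • g β) = k * l * (ε * cross α β) := by
    rw [← hcross]
    simp only [cross, PiLp.smul_apply, smul_eq_mul]
    ring
  have e2 : (k • g α) 0 * (l • g β) 0 + (k • g α) 1 * (l • g β) 1 =
      k * l * (α 0 * β 0 + α 1 * β 1) := by
    rw [← hinner α β]
    simp only [PiLp.smul_apply, smul_eq_mul]
    ring
  rw [cot, e1, e2, mul_div_mul_left _ _ (mul_ne_zero hk hl), cot]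
  rcases hε' with h | h <;> rw [h]
  · ring
  · rw [neg_one_mul, div_neg]; ring

/-! ### Moment equations -/

/-- The normalized constant `C_γ / |γ|²`. -/
def weight (C₀ : Plane → ℂ) (γ : Plane) : ℂ := C₀ γ / ((γ 0 : ℂ) ^ 2 + (γ 1 : ℂ) ^ 2)

/-- The odd moments of the singular locus seen from `β`. -/
def moment (H : Finset Plane) (C₀ : Plane → ℂ) (β : Plane) (j : ℕ) : ℂ :=
  ∑ γ ∈ H.erase β, weight C₀ γ * ((cot β γ * (1 + cot β γ ^ 2) * cot β γ ^ j : ℝ) : ℂ)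

/-- No two vectors are parallel, and the moments vanish as far as integrability requires. -/
structure MomentCondition (H : Finset Plane) (C₀ : Plane → ℂ) : Prop where
  cross_ne : ∀ α ∈ H, ∀ β ∈ H, α ≠ β → cross α β ≠ 0
  weight_ne : ∀ α ∈ H, weight C₀ α ≠ 0
  first : ∀ β ∈ H, moment H C₀ β 0 = 0
  third : ∀ β ∈ H, weight C₀ β ≠ 2 → moment H C₀ β 2 = 0
  fifth : ∀ β ∈ H, weight C₀ β ≠ 2 → weight C₀ β ≠ 6 → moment H C₀ β 4 = 0

/-- Lagrange's identity turns the sums of `moments_of_commutant` into moments up to the factor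
`|β|²`. The powers `1, 3, 5` become the indices `0, 2, 4`, because `moment` already contains one
factor `cot`. -/
theorem momentCondition_of_commutant {H : Finset Plane} {C₀ : Plane → ℂ}
    (hH : MutuallyNonParallel H) (hC : ∀ α ∈ H, C₀ α ≠ 0) (hP : HasNontrivialCommutant H C₀)
    (hcard : 2 ≤ H.card) : MomentCondition H C₀ := by
  have hcr : ∀ α ∈ H, ∀ β ∈ H, α ≠ β → cross α β ≠ 0 := fun α hα β hβ h =>
    cross_ne_zero (hH α hα β hβ h)
  have hpos : ∀ α ∈ H, (0 : ℝ) < α 0 ^ 2 + α 1 ^ 2 := by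
    intro α hα
    obtain ⟨β, hβ, hne⟩ := Finset.exists_mem_ne hcard α
    exact sq_add_sq_pos_of_cross (hcr α hα β hβ hne.symm)
  have hpos' : ∀ α ∈ H, (α 0 : ℂ) ^ 2 + (α 1 : ℂ) ^ 2 ≠ 0 :=
    fun α hα e => (hpos α hα).ne' (by exact_mod_cast e)
  have hmom : ∀ β ∈ H, ∀ j, moment H C₀ β j = ((β 0 : ℂ) ^ 2 + (β 1 : ℂ) ^ 2) *
      ∑ γ ∈ H.erase β, C₀ γ / (cross β γ : ℂ) ^ 2 * (cot β γ : ℂ) ^ (j + 1) := by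
    intro β hβ j
    rw [moment, Finset.mul_sum]
    refine Finset.sum_congr rfl fun γ hγ => ?_
    obtain ⟨hne, hγH⟩ := Finset.mem_erase.1 hγ
    have hc := hcr β hβ γ hγH hne.symm
    have hc' : (cross β γ : ℂ) ≠ 0 := by exact_mod_cast hc
    have e : (cross β γ : ℂ) ^ 2 * (1 + (cot β γ : ℂ) ^ 2) =
        ((β 0 : ℂ) ^ 2 + (β 1 : ℂ) ^ 2) * ((γ 0 : ℂ) ^ 2 + (γ 1 : ℂ) ^ 2) := by
      exact_mod_cast one_add_cot_sq hc
    have hg := hpos' γ hγH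
    rw [weight]
    push_cast
    rw [div_mul_eq_mul_div, div_eq_iff hg]
    field_simp
    linear_combination C₀ γ * (cot β γ : ℂ) ^ (j + 1) * e
  have hall := fun β hβ => moments_of_commutant hP hβ (hC β hβ) (hpos β hβ) fun γ hγ =>
    hcr β hβ γ (Finset.mem_of_mem_erase hγ) (Finset.ne_of_mem_erase hγ).symm
  refine ⟨hcr, fun α hα => div_ne_zero (hC α hα) (hpos' α hα), fun β hβ => ?_, fun β hβ h2 => ?_,
    fun β hβ h2 h6 => ?_⟩
  · rw [hmom β hβ]
    simpa using Or.inr (hall β hβ).1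
  · rw [hmom β hβ, (hall β hβ).2.1 h2, mul_zero]
  · rw [hmom β hβ, (hall β hβ).2.2 h2 h6, mul_zero]

namespace MomentCondition

variable {H : Finset Plane} {C₀ : Plane → ℂ}

theorem sq_pos (h : MomentCondition H C₀) (hcard : 2 ≤ H.card) {α : Plane} (hα : α ∈ H) :
    0 < α 0 ^ 2 + α 1 ^ 2 := by
  obtain ⟨β, hβ, hne⟩ := Finset.exists_mem_ne hcard α
  exact sq_add_sq_pos_of_cross (h.cross_ne α hα β hβ hne.symm)

theorem cot_ne (h : MomentCondition H C₀) {α β γ : Plane} (hα : α ∈ H) (hβ : β ∈ H) (hγ : γ ∈ H)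
    (hαβ : α ≠ β) (hαγ : α ≠ γ) (hβγ : β ≠ γ) : cot α β ≠ cot α γ :=
  cot_ne_cot (h.cross_ne _ hα _ hβ hαβ) (h.cross_ne _ hα _ hγ hαγ) (h.cross_ne _ hβ _ hγ hβγ)

theorem locusEquiv (h : MomentCondition H C₀) (hcard : 2 ≤ H.card) {β : Plane} (hβ : β ∈ H) :
    LocusEquiv (H : Set Plane)
      (insert (vec 1 0) ((fun γ => vec (cot β γ) 1) '' (H.erase β : Set Plane))) :=
  locusEquiv_cot hβ (h.sq_pos hcard hβ) fun γ hγ =>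
    h.cross_ne β hβ γ (Finset.mem_of_mem_erase hγ) (Finset.ne_of_mem_erase hγ).symm

end MomentCondition

theorem isPositiveSystem_A1A1 {α β v : Plane} (hα : 0 < inner ℝ v α) (hβ : 0 < inner ℝ v β) :
    IsPositiveSystem {α, -α, β, -β} {α, β} := by
  refine ⟨v, ?_, ?_⟩
  · rintro γ (rfl | rfl | rfl | rfl)
    · exact hα.ne'
    · rw [inner_neg_right]; exact (neg_neg_of_pos hα).ne
    · exact hβ.ne'
    · rw [inner_neg_right]; exact (neg_neg_of_pos hβ).ne
  · ext γ
    constructor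
    · rintro (rfl | rfl)
      · exact ⟨by simp, hα⟩
      · exact ⟨by simp, hβ⟩
    · rintro ⟨rfl | rfl | rfl | rfl, hpos⟩
      · simp
      · rw [inner_neg_right] at hpos; linarith
      · simp
      · rw [inner_neg_right] at hpos; linarith

theorem isPositiveSystem_A2 {α β v : Plane} (hα : 0 < inner ℝ v α) (hβ : 0 < inner ℝ v β) :
    IsPositiveSystem {α, -α, β, -β, α + β, -(α + β)} {α, β, α + β} := by
  have hs : 0 < inner ℝ v (α + β) := by rw [inner_add_right]; linarith
  refine ⟨v, ?_, ?_⟩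
  · rintro γ (rfl | rfl | rfl | rfl | rfl | rfl)
    · exact hα.ne'
    · rw [inner_neg_right]; exact (neg_neg_of_pos hα).ne
    · exact hβ.ne'
    · rw [inner_neg_right]; exact (neg_neg_of_pos hβ).ne
    · exact hs.ne'
    · rw [inner_neg_right]; exact (neg_neg_of_pos hs).ne
  · ext γ
    constructor
    · rintro (rfl | rfl | rfl)
      · exact ⟨by simp, hα⟩
      · exact ⟨by simp, hβ⟩
      · exact ⟨by simp, hs⟩
    · rintro ⟨rfl | rfl | rfl | rfl | rfl | rfl, hpos⟩
      · simp
      · rw [inner_neg_right] at hpos; linarith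
      · simp
      · rw [inner_neg_right] at hpos; linarith
      · simp
      · rw [inner_neg_right] at hpos; linarith

/-! ### Two vectors -/

namespace MomentCondition

variable {H : Finset Plane} {C₀ : Plane → ℂ}

theorem cot_mul_ne_zero {y : ℝ} (hy : y ≠ 0) : y * (1 + y ^ 2) ≠ 0 :=
  mul_ne_zero hy (by positivity)

/-- The first moment has a single term, and `y (1 + y²)` vanishes only at `y = 0`. -/
theorem orthogonal (h : MomentCondition H C₀) (hcard : H.card = 2) {α β : Plane} (hα : α ∈ H)
    (hβ : β ∈ H) (hne : α ≠ β) : inner ℝ α β = 0 := by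
  classical
  have hH : H.erase α = {β} := by
    refine (Finset.eq_of_subset_of_card_le ?_ ?_).symm
    · simp [hβ, hne.symm]
    · rw [Finset.card_erase_of_mem hα, hcard]; simp
  have h1 := h.first α hα
  rw [moment, hH, Finset.sum_singleton, mul_eq_zero, or_iff_right (h.weight_ne β hβ)] at h1
  have h2 : cot α β * (1 + cot α β ^ 2) * cot α β ^ 0 = 0 := by exact_mod_cast h1
  rw [pow_zero, mul_one] at h2
  have h3 : cot α β = 0 := by_contra fun hn => cot_mul_ne_zero hn h2
  rw [cot, div_eq_zero_iff, or_iff_left (h.cross_ne α hα β hβ hne)] at h3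
  rw [inner_eq, h3]

theorem isOfTypeA1A1 (h : MomentCondition H C₀) (hcard : H.card = 2) :
    IsOfTypeA1A1 (H : Set Plane) := by
  obtain ⟨α, β, hne, rfl⟩ := Finset.card_eq_two.1 hcard
  have hα : α ∈ ({α, β} : Finset Plane) := by simp
  have hβ : β ∈ ({α, β} : Finset Plane) := by simp
  have h0 : inner ℝ α β = 0 := h.orthogonal hcard hα hβ hne
  have hpα := h.sq_pos hcard.ge hα
  have hpβ := h.sq_pos hcard.ge hβ
  rw [← norm_sq_eq] at hpα hpβ
  refine ⟨_, {α, -α, β, -β}, LocusEquiv.refl _, ⟨α, β, ?_, ?_, h0, rfl⟩, ?_⟩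
  · rintro rfl; simp at hpα
  · rintro rfl; simp at hpβ
  · rw [Finset.coe_pair]
    apply isPositiveSystem_A1A1 (v := α + β)
    · rw [inner_add_left, real_inner_comm α β, h0, real_inner_self_eq_norm_sq]
      linarith
    · rw [inner_add_left, h0, real_inner_self_eq_norm_sq]
      linarith

end MomentCondition

/-! ### Three vectors -/

theorem erase_eq_pair {ι : Type*} [DecidableEq ι] {H : Finset ι} (hcard : H.card = 3) {α β γ : ι}
    (hα : α ∈ H) (hβ : β ∈ H) (hγ : γ ∈ H) (hαβ : α ≠ β) (hαγ : α ≠ γ) (hβγ : β ≠ γ) :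
    H.erase α = {β, γ} := by
  refine (Finset.eq_of_subset_of_card_le ?_ ?_).symm
  · simp [Finset.insert_subset_iff, hβ, hγ, hαβ.symm, hαγ.symm]
  · rw [Finset.card_erase_of_mem hα, hcard, Finset.card_pair hβγ]

namespace MomentCondition

variable {H : Finset Plane} {C₀ : Plane → ℂ}

theorem moment_three (hcard : H.card = 3) {α β γ : Plane}
    (hα : α ∈ H) (hβ : β ∈ H) (hγ : γ ∈ H) (hαβ : α ≠ β) (hαγ : α ≠ γ) (hβγ : β ≠ γ) (j : ℕ) :
    moment H C₀ α j =
      weight C₀ β * ((cot α β : ℂ) * (1 + (cot α β : ℂ) ^ 2) * (cot α β : ℂ) ^ j) +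
      weight C₀ γ * ((cot α γ : ℂ) * (1 + (cot α γ : ℂ) ^ 2) * (cot α γ : ℂ) ^ j) := by
  rw [moment, erase_eq_pair hcard hα hβ hγ hαβ hαγ hβγ, Finset.sum_pair hβγ]
  push_cast
  rfl

theorem ofReal_mul_ne_zero {y : ℝ} (hy : y ≠ 0) : (y : ℂ) * (1 + (y : ℂ) ^ 2) ≠ 0 := by
  exact_mod_cast cot_mul_ne_zero hy

/-- The first and third moments are two linear equations for the nonzero weights of `β` and `γ`;
eliminating one leaves `x² = y²` for the distinct cotangents `x, y`, the other outcome being `x = y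
= 0`. -/
theorem cot_eq_neg_of_weight_ne (h : MomentCondition H C₀) (hcard : H.card = 3) {α β γ : Plane}
    (hα : α ∈ H) (hβ : β ∈ H) (hγ : γ ∈ H) (hαβ : α ≠ β) (hαγ : α ≠ γ) (hβγ : β ≠ γ)
    (hw : weight C₀ α ≠ 2) : cot α β = -cot α γ := by
  have h1 := h.first α hα
  have h3 := h.third α hα hw
  rw [moment_three hcard hα hβ hγ hαβ hαγ hβγ] at h1 h3
  have hne := h.cot_ne hα hβ hγ hαβ hαγ hβγ
  have hwβ := h.weight_ne β hβ
  have hwγ := h.weight_ne γ hγ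
  have e : weight C₀ β * ((cot α β : ℂ) * (1 + (cot α β : ℂ) ^ 2)) *
      ((cot α β : ℂ) ^ 2 - (cot α γ : ℂ) ^ 2) = 0 := by
    linear_combination h3 - (cot α γ : ℂ) ^ 2 * h1
  rcases mul_eq_zero.1 e with e | e
  · have hβ0 : cot α β = 0 := by_contra fun hn => mul_ne_zero hwβ (ofReal_mul_ne_zero hn) e
    have e2 : weight C₀ γ * ((cot α γ : ℂ) * (1 + (cot α γ : ℂ) ^ 2)) = 0 := by
      linear_combination h1 - e
    have hγ0 : cot α γ = 0 := by_contra fun hn => mul_ne_zero hwγ (ofReal_mul_ne_zero hn) e2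
    exact absurd (hβ0.trans hγ0.symm) hne
  · have e' : cot α β ^ 2 = cot α γ ^ 2 := by
      have : (cot α β : ℂ) ^ 2 = (cot α γ : ℂ) ^ 2 := sub_eq_zero.1 e
      exact_mod_cast this
    exact (sq_eq_sq_iff_eq_or_eq_neg.1 e').resolve_left hne

/-- With equal weights the first moment is `G(x) + G(y) = 0`; divided by `x + y` it leaves a
positive quadratic. -/
theorem cot_eq_neg_of_weight_eq (h : MomentCondition H C₀) (hcard : H.card = 3) {α β γ : Plane}
    (hα : α ∈ H) (hβ : β ∈ H) (hγ : γ ∈ H) (hαβ : α ≠ β) (hαγ : α ≠ γ) (hβγ : β ≠ γ)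
    (hwβ : weight C₀ β = 2) (hwγ : weight C₀ γ = 2) : cot α β = -cot α γ := by
  have h1 := h.first α hα
  rw [moment_three hcard hα hβ hγ hαβ hαγ hβγ, hwβ, hwγ] at h1
  have e : (cot α β + cot α γ) * (1 + cot α β ^ 2 - cot α β * cot α γ + cot α γ ^ 2) = 0 := by
    have : ((cot α β : ℂ) + cot α γ) *
        (1 + (cot α β : ℂ) ^ 2 - (cot α β : ℂ) * cot α γ + (cot α γ : ℂ) ^ 2) = 0 := by
      linear_combination h1 / 2
    exact_mod_cast this
  rcases mul_eq_zero.1 e with e | e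
  · linarith
  · nlinarith [sq_nonneg (cot α β - cot α γ), sq_nonneg (cot α β), sq_nonneg (cot α γ)]

/-- Either some vector has weight different from `2`, or the companions of some vector both have
weight `2`; in both cases that vector serves as `e₁`. -/
theorem locusEquiv_three (h : MomentCondition H C₀) (hcard : H.card = 3) :
    ∃ a : ℝ, a ≠ 0 ∧ LocusEquiv (H : Set Plane) {vec 1 0, vec a 1, vec (-a) 1} := by
  have key : ∃ α ∈ H, ∃ β ∈ H, ∃ γ ∈ H, α ≠ β ∧ α ≠ γ ∧ β ≠ γ ∧ cot α β = -cot α γ := by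
    obtain ⟨α, β, γ, hαβ, hαγ, hβγ, hH⟩ := Finset.card_eq_three.1 hcard
    have hα : α ∈ H := by simp [hH]
    have hβ : β ∈ H := by simp [hH]
    have hγ : γ ∈ H := by simp [hH]
    by_cases hwβ : weight C₀ β = 2
    · by_cases hwγ : weight C₀ γ = 2
      · exact ⟨α, hα, β, hβ, γ, hγ, hαβ, hαγ, hβγ,
          h.cot_eq_neg_of_weight_eq hcard hα hβ hγ hαβ hαγ hβγ hwβ hwγ⟩
      · exact ⟨γ, hγ, α, hα, β, hβ, hαγ.symm, hβγ.symm, hαβ,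
          h.cot_eq_neg_of_weight_ne hcard hγ hα hβ hαγ.symm hβγ.symm hαβ hwγ⟩
    · exact ⟨β, hβ, α, hα, γ, hγ, hαβ.symm, hβγ, hαγ,
        h.cot_eq_neg_of_weight_ne hcard hβ hα hγ hαβ.symm hβγ hαγ hwβ⟩
  obtain ⟨α, hα, β, hβ, γ, hγ, hαβ, hαγ, hβγ, hcot⟩ := key
  refine ⟨cot α γ, fun h0 => ?_, ?_⟩
  · exact h.cot_ne hα hβ hγ hαβ hαγ hβγ (by rw [hcot, h0, neg_zero])
  · have he := h.locusEquiv (by omega) hα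
    rwa [erase_eq_pair hcard hα hγ hβ hαγ hαβ hβγ.symm, Finset.coe_pair, Set.image_pair,
      hcot] at he

/-- The coupling constants of three vectors with given cotangents. -/
theorem weight_three (h : MomentCondition H C₀) (hcard : H.card = 3) {α β γ : Plane}
    (hα : α ∈ H) (hβ : β ∈ H) (hγ : γ ∈ H) (hαβ : α ≠ β) (hαγ : α ≠ γ) (hβγ : β ≠ γ)
    {s : ℝ} (hs : s ≠ 0) (h1 : cot α β = s) (h2 : cot α γ = -s)
    (h3 : cot β γ = (1 - s ^ 2) / (2 * s)) :
    weight C₀ β = weight C₀ γ ∧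
    weight C₀ α * (8 * (s : ℂ) ^ 4) = weight C₀ β * (1 - (s : ℂ) ^ 4) ∧
    (weight C₀ β ≠ 2 → s ^ 2 = 1 / 3) := by
  have hs' : (s : ℂ) ≠ 0 := by exact_mod_cast hs
  have hG := ofReal_mul_ne_zero hs
  have h1s : (1 + (s : ℂ) ^ 2) ≠ 0 := right_ne_zero_of_mul hG
  have m1 := h.first α hα
  rw [moment_three hcard hα hβ hγ hαβ hαγ hβγ, h1, h2] at m1
  push_cast at m1
  have e1 : weight C₀ β = weight C₀ γ := by
    have : (weight C₀ β - weight C₀ γ) * ((s : ℂ) * (1 + (s : ℂ) ^ 2)) = 0 := by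
      linear_combination m1
    exact sub_eq_zero.1 ((mul_eq_zero.1 this).resolve_right hG)
  have hβα : cot β α = -s := by rw [cot_swap, h1]
  have m2 := h.first β hβ
  have m3 := h.third β hβ
  rw [moment_three hcard hβ hα hγ hαβ.symm hβγ hαγ, hβα, h3] at m2 m3
  push_cast at m2 m3
  obtain ⟨t, ht⟩ : ∃ t : ℂ, t = (1 - (s : ℂ) ^ 2) / (2 * (s : ℂ)) := ⟨_, rfl⟩
  have ht' : t * (2 * s) = 1 - (s : ℂ) ^ 2 := by
    rw [ht]
    exact div_mul_cancel₀ _ (mul_ne_zero two_ne_zero hs')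
  rw [← ht] at m2 m3
  have e2 : weight C₀ α * (8 * (s : ℂ) ^ 4) = weight C₀ β * (1 - (s : ℂ) ^ 4) := by
    apply mul_right_cancel₀ h1s
    have ht2 : 4 * (s : ℂ) ^ 2 * (1 + t ^ 2) = (1 + (s : ℂ) ^ 2) ^ 2 := by
      linear_combination (t * (2 * s) + (1 - (s : ℂ) ^ 2)) * ht'
    rw [e1]
    linear_combination -8 * (s : ℂ) ^ 3 * m2 + weight C₀ γ * (2 * s * t) * ht2 +
      weight C₀ γ * (1 + (s : ℂ) ^ 2) ^ 2 * ht'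
  refine ⟨e1, e2, fun hw => ?_⟩
  have m3 := m3 hw
  -- If the weight of `β` is not `2`, its third moment forces `t² = s²`. As `t = (1 - s²)/(2s)`,
  -- this means `3s² = 1`, the angles of `A₂`.
  have e3 : weight C₀ α * ((s : ℂ) * (1 + (s : ℂ) ^ 2)) * ((s : ℂ) ^ 2 - t ^ 2) = 0 := by
    linear_combination t ^ 2 * m2 - m3
  have e4 : (s : ℂ) ^ 2 - t ^ 2 = 0 :=
    (mul_eq_zero.1 e3).resolve_left (mul_ne_zero (h.weight_ne α hα) hG)
  have e5 : (3 * s ^ 2 - 1) * (1 + s ^ 2) = 0 := by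
    have : (3 * (s : ℂ) ^ 2 - 1) * (1 + (s : ℂ) ^ 2) = 0 := by
      linear_combination 4 * (s : ℂ) ^ 2 * e4 + (t * (2 * s) + (1 - (s : ℂ) ^ 2)) * ht'
    exact_mod_cast this
  rcases mul_eq_zero.1 e5 with e5 | e5
  · linarith
  · nlinarith [sq_nonneg s]

end MomentCondition

theorem isOfTypeA2_of_sq {a : ℝ} (ha : a ^ 2 = 1 / 3) :
    IsOfTypeA2 {vec 1 0, vec a 1, vec (-a) 1} := by
  classical
  have h0 : a ≠ 0 := by rintro rfl; norm_num at ha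
  have hpos : 0 < |a| := abs_pos.2 h0
  have hsq : |a| ^ 2 = 1 / 3 := by rw [sq_abs, ha]
  have hne : ∀ b : ℝ, vec b 1 ≠ vec 1 0 := fun b e => one_ne_zero (vec_injective.1 e).2
  -- `r = √3/2` scales `(±|a|, 1)` to the unit vectors `(±1/2, r)`. The chamber vector `(1, 2r)`
  -- below has inner product `1` with both simple roots.
  set r : ℝ := 3 / 2 * |a| with hr
  have hr2 : r ^ 2 = 3 / 4 := by rw [hr, mul_pow, hsq]; norm_num
  have hra : r * |a| = 1 / 2 := by rw [hr]; linear_combination 3 / 2 * hsq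
  have hrpos : 0 < r := by positivity
  have hpair : ({vec a 1, vec (-a) 1} : Set Plane) = {vec (-|a|) 1, vec |a| 1} := by
    rcases abs_choice a with e | e <;> rw [e]
    · exact Set.pair_comm _ _
    · rw [neg_neg]
  have hsum : vec 1 0 + vec (-(1 / 2)) r = vec (1 / 2) r :=
    plane_ext (by simp [vec_zero]; norm_num) (by simp [vec_one])
  have hnorm1 : ‖vec 1 0‖ ^ 2 = 1 := by rw [norm_sq_eq, vec_zero, vec_one]; norm_num
  have hnorm2 : ‖vec (-(1 / 2)) r‖ ^ 2 = 1 := by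
    rw [norm_sq_eq, vec_zero, vec_one, hr2]; norm_num
  refine ⟨{vec 1 0, vec (-(1 / 2)) r, vec 1 0 + vec (-(1 / 2)) r}, _, ?_,
    ⟨vec 1 0, vec (-(1 / 2)) r, ?_, ?_, ?_, rfl⟩, isPositiveSystem_A2 (v := vec 1 (2 * r)) ?_ ?_⟩
  · refine ⟨LinearIsometryEquiv.refl ℝ Plane, fun v => if v = vec 1 0 then 1 else r, ?_, ?_⟩
    · intro v _
      dsimp only
      split_ifs
      · exact one_ne_zero
      · exact hrpos.ne'
    · rw [hpair, Set.image_insert_eq, Set.image_pair, hsum]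
      simp only [if_pos, if_neg (hne _), LinearIsometryEquiv.coe_refl, id, one_smul]
      congr 2
      · exact plane_ext (by simp [vec_zero]; linarith) (by simp [vec_one])
      · congr 1
        exact plane_ext (by simp [vec_zero]; linarith) (by simp [vec_one])
  · intro e
    simp [e] at hnorm1
  · rw [← sq_eq_sq₀ (norm_nonneg _) (norm_nonneg _), hnorm1, hnorm2]
  · rw [hnorm1, inner_eq, vec_zero, vec_zero, vec_one, vec_one]; ring
  · rw [inner_eq, vec_zero, vec_zero, vec_one, vec_one]; norm_num
  · rw [inner_eq, vec_zero, vec_zero, vec_one, vec_one]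
    linarith

theorem IsOfTypeA2.of_locusEquiv {S S' : Set Plane} (h : LocusEquiv S S') (h' : IsOfTypeA2 S') :
    IsOfTypeA2 S := by
  obtain ⟨T, Φ, hT, hΦ⟩ := h'
  exact ⟨T, Φ, h.trans hT, hΦ⟩

/-- The constants of a three-vector locus in normal form which is not of type `A₂`. -/
theorem MomentCondition.deformed_A2 {H : Finset Plane} {C₀ : Plane → ℂ} (h : MomentCondition H C₀)
    (hcard : H.card = 3) (hA2 : ¬ IsOfTypeA2 (H : Set Plane)) {a : ℝ} {C₁ : Plane → ℂ} (ha : a ≠ 0)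
    (hE : LocusEquivWith (H : Set Plane) C₀ {vec 1 0, vec a 1, vec (-a) 1} C₁) :
    CouplingOne C₁ (vec a 1) ∧ CouplingOne C₁ (vec (-a) 1) ∧
      C₁ (vec 1 0) = (1 - (a : ℂ) ^ 4) / (4 * (a : ℂ) ^ 4) := by
  have hA2' : a ^ 2 ≠ 1 / 3 := fun e =>
    hA2 ((isOfTypeA2_of_sq e).of_locusEquiv hE.locusEquiv)
  obtain ⟨g, k, hk, hS, hC⟩ := hE
  obtain ⟨ε, hε, hcot⟩ := exists_sign_cot g
  have hmem : ∀ v ∈ ({vec 1 0, vec a 1, vec (-a) 1} : Set Plane), ∃ α ∈ H, k α • g α = v := by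
    intro v hv
    rw [hS] at hv
    exact hv
  obtain ⟨α, hα, eα⟩ := hmem (vec 1 0) (by simp)
  obtain ⟨β, hβ, eβ⟩ := hmem (vec a 1) (by simp)
  obtain ⟨γ, hγ, eγ⟩ := hmem (vec (-a) 1) (by simp)
  have hαβ : α ≠ β := by
    rintro rfl
    exact zero_ne_one (vec_injective.1 (eα.symm.trans eβ)).2
  have hαγ : α ≠ γ := by
    rintro rfl
    exact zero_ne_one (vec_injective.1 (eα.symm.trans eγ)).2
  have hβγ : β ≠ γ := by
    rintro rfl
    exact ha (by linarith [(vec_injective.1 (eβ.symm.trans eγ)).1])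
  -- The weight `C/|δ|²` is invariant under equivalence, so the new constants follow from the old
  -- weights.
  have hweight : ∀ δ ∈ H, C₁ (k δ • g δ) =
      weight C₀ δ * ((‖k δ • g δ‖ : ℝ) : ℂ) ^ 2 := by
    intro δ hδ
    have hp := h.sq_pos (by omega) hδ
    have hp' : (δ 0 : ℂ) ^ 2 + (δ 1 : ℂ) ^ 2 ≠ 0 := fun e => by
      have e' : δ 0 ^ 2 + δ 1 ^ 2 = (0 : ℝ) := by exact_mod_cast e
      exact hp.ne' e'
    have hn : ‖k δ • g δ‖ ^ 2 = k δ ^ 2 * (δ 0 ^ 2 + δ 1 ^ 2) := by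
      rw [norm_smul, g.norm_map, mul_pow, norm_sq_eq, Real.norm_eq_abs, sq_abs]
    have hn' : ((‖k δ • g δ‖ : ℝ) : ℂ) ^ 2 = (k δ : ℂ) ^ 2 * ((δ 0 : ℂ) ^ 2 + (δ 1 : ℂ) ^ 2) := by
      exact_mod_cast hn
    rw [hC δ hδ, hn', weight]
    field_simp
  have hε2 : ε * ε = 1 := by rcases hε with rfl | rfl <;> norm_num
  have hcot' : ∀ δ ∈ H, ∀ η ∈ H, cot δ η = ε * cot (k δ • g δ) (k η • g η) := by
    intro δ hδ η hη
    rw [hcot _ _ _ _ (hk δ hδ) (hk η hη), ← mul_assoc, hε2, one_mul]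
  have hs : ε * a ≠ 0 := mul_ne_zero (left_ne_zero_of_mul (hε2 ▸ one_ne_zero)) ha
  have hs2 : (ε * a) ^ 2 = a ^ 2 := by linear_combination a ^ 2 * hε2
  -- A reflection changes the sign of all cotangents; `s = ε a` absorbs it, and the relations
  -- obtained involve only even powers of `s`.
  obtain ⟨w1, w2, w3⟩ := h.weight_three hcard hα hβ hγ hαβ hαγ hβγ hs
    (by rw [hcot' α hα β hβ, eα, eβ, cot, cross]; simp [vec_zero, vec_one])
    (by rw [hcot' α hα γ hγ, eα, eγ, cot, cross]; simp [vec_zero, vec_one])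
    (by
      rw [hcot' β hβ γ hγ, eβ, eγ, cot, cross, hs2]
      simp only [vec_zero, vec_one]
      rcases hε with rfl | rfl
      · field_simp; ring
      · field_simp; ring)
  rw [hs2] at w3
  have hw : weight C₀ β = 2 := by_contra fun hn => hA2' (w3 hn)
  have hs4 : ((ε * a : ℝ) : ℂ) ^ 4 = (a : ℂ) ^ 4 := by
    have : (ε * a) ^ 4 = a ^ 4 := by linear_combination ((ε * a) ^ 2 + a ^ 2) * hs2
    exact_mod_cast this
  have ha' : (a : ℂ) ≠ 0 := by exact_mod_cast ha
  refine ⟨?_, ?_, ?_⟩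
  · rw [CouplingOne, ← eβ, hweight β hβ, hw]
  · rw [CouplingOne, ← eγ, hweight γ hγ, ← w1, hw]
  · have hn : ((‖vec 1 0‖ : ℝ) : ℂ) ^ 2 = 1 := by
      have : ‖vec 1 0‖ ^ 2 = 1 := by rw [norm_sq_eq, vec_zero, vec_one]; norm_num
      exact_mod_cast this
    have e := hweight α hα
    rw [eα, hn, mul_one] at e
    rw [e, eq_div_iff (mul_ne_zero (by norm_num) (pow_ne_zero 4 ha'))]
    rw [hs4, hw] at w2
    linear_combination w2 / 2

/-! ### Four vectors -/

theorem cubic_strictMono : StrictMono fun y : ℝ => y * (1 + y ^ 2) := by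
  intro x y h
  dsimp only
  nlinarith [sq_nonneg (x + y), sq_nonneg x, sq_nonneg y, mul_pos (sub_pos.2 h) (sub_pos.2 h)]

theorem cubic_lt {x y : ℝ} : x * (1 + x ^ 2) < y * (1 + y ^ 2) ↔ x < y :=
  cubic_strictMono.lt_iff_lt

theorem cubic_inj {x y : ℝ} : x * (1 + x ^ 2) = y * (1 + y ^ 2) ↔ x = y :=
  cubic_strictMono.injective.eq_iff

/-! ### Elimination between moment equations -/

theorem eq_zero_of_moments {x y z : ℝ} {u v w : ℂ} (hxy : x = -y) (hzx : z ≠ x) (hzy : z ≠ y)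
    (hw : w ≠ 0)
    (h0 : u * ((x * (1 + x ^ 2) : ℝ) : ℂ) + v * ((y * (1 + y ^ 2) : ℝ) : ℂ) +
      w * ((z * (1 + z ^ 2) : ℝ) : ℂ) = 0)
    (h2 : u * ((x * (1 + x ^ 2) * x ^ 2 : ℝ) : ℂ) + v * ((y * (1 + y ^ 2) * y ^ 2 : ℝ) : ℂ) +
      w * ((z * (1 + z ^ 2) * z ^ 2 : ℝ) : ℂ) = 0) : z = 0 := by
  subst hxy
  have e : w * ((z * (1 + z ^ 2) * ((z - y) * (z - -y)) : ℝ) : ℂ) = 0 := by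
    push_cast at h0 h2 ⊢
    linear_combination h2 - (y : ℂ) ^ 2 * h0
  have e' : z * (1 + z ^ 2) * ((z - y) * (z - -y)) = 0 := by
    exact_mod_cast (mul_eq_zero.1 e).resolve_left hw
  by_contra hz
  exact mul_ne_zero (MomentCondition.cot_mul_ne_zero hz)
    (mul_ne_zero (sub_ne_zero.2 hzy) (sub_ne_zero.2 hzx)) e'

/-- Vandermonde elimination in the squares: combining the moments by the coefficients of `(T - y²)(T
- z²)` removes `v` and `w`. -/
theorem eq_zero_of_moments_of_sq_ne {x y z : ℝ} {u v w : ℂ} (hxy : x ^ 2 ≠ y ^ 2)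
    (hxz : x ^ 2 ≠ z ^ 2) (hu : u ≠ 0)
    (h0 : u * ((x * (1 + x ^ 2) : ℝ) : ℂ) + v * ((y * (1 + y ^ 2) : ℝ) : ℂ) +
      w * ((z * (1 + z ^ 2) : ℝ) : ℂ) = 0)
    (h2 : u * ((x * (1 + x ^ 2) * x ^ 2 : ℝ) : ℂ) + v * ((y * (1 + y ^ 2) * y ^ 2 : ℝ) : ℂ) +
      w * ((z * (1 + z ^ 2) * z ^ 2 : ℝ) : ℂ) = 0)
    (h4 : u * ((x * (1 + x ^ 2) * x ^ 4 : ℝ) : ℂ) + v * ((y * (1 + y ^ 2) * y ^ 4 : ℝ) : ℂ) +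
      w * ((z * (1 + z ^ 2) * z ^ 4 : ℝ) : ℂ) = 0) : x = 0 := by
  have e : u * ((x * (1 + x ^ 2) * ((x ^ 2 - y ^ 2) * (x ^ 2 - z ^ 2)) : ℝ) : ℂ) = 0 := by
    push_cast at h0 h2 h4 ⊢
    linear_combination h4 - ((y : ℂ) ^ 2 + (z : ℂ) ^ 2) * h2 + (y : ℂ) ^ 2 * (z : ℂ) ^ 2 * h0
  have e' : x * (1 + x ^ 2) * ((x ^ 2 - y ^ 2) * (x ^ 2 - z ^ 2)) = 0 := by
    exact_mod_cast (mul_eq_zero.1 e).resolve_left hu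
  by_contra hx
  exact mul_ne_zero (MomentCondition.cot_mul_ne_zero hx)
    (mul_ne_zero (sub_ne_zero.2 hxy) (sub_ne_zero.2 hxz)) e'

/-- If the squares were pairwise different, both `x` and `y` would be `0`. So two of the numbers are
opposite, and the third is then `0`. -/
theorem eq_triple_of_moments {x y z : ℝ} {u v w : ℂ} (hxy : x ≠ y) (hxz : x ≠ z) (hyz : y ≠ z)
    (hu : u ≠ 0) (hv : v ≠ 0) (hw : w ≠ 0)
    (h0 : u * ((x * (1 + x ^ 2) : ℝ) : ℂ) + v * ((y * (1 + y ^ 2) : ℝ) : ℂ) +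
      w * ((z * (1 + z ^ 2) : ℝ) : ℂ) = 0)
    (h2 : u * ((x * (1 + x ^ 2) * x ^ 2 : ℝ) : ℂ) + v * ((y * (1 + y ^ 2) * y ^ 2 : ℝ) : ℂ) +
      w * ((z * (1 + z ^ 2) * z ^ 2 : ℝ) : ℂ) = 0)
    (h4 : u * ((x * (1 + x ^ 2) * x ^ 4 : ℝ) : ℂ) + v * ((y * (1 + y ^ 2) * y ^ 4 : ℝ) : ℂ) +
      w * ((z * (1 + z ^ 2) * z ^ 4 : ℝ) : ℂ) = 0) :
    ∃ p : ℝ, p ≠ 0 ∧ ({x, y, z} : Set ℝ) = {0, p, -p} := by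
  have hne : ∀ {s t : ℝ}, s ≠ t → s = -t → t ≠ 0 := by
    rintro s t hst h rfl
    exact hst (by rw [h, neg_zero])
  by_cases e1 : x ^ 2 = y ^ 2
  · have e := (sq_eq_sq_iff_eq_or_eq_neg.1 e1).resolve_left hxy
    have hz := eq_zero_of_moments e hxz.symm hyz.symm hw h0 h2
    refine ⟨y, hne hxy e, ?_⟩
    rw [hz, e]
    ext t
    simp only [Set.mem_insert_iff, Set.mem_singleton_iff]
    tauto
  by_cases e2 : x ^ 2 = z ^ 2
  · have e := (sq_eq_sq_iff_eq_or_eq_neg.1 e2).resolve_left hxz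
    have hy := eq_zero_of_moments (u := u) (v := w) (w := v) e hxy.symm hyz hv
      (by linear_combination h0) (by linear_combination h2)
    refine ⟨z, hne hxz e, ?_⟩
    rw [hy, e]
    ext t
    simp only [Set.mem_insert_iff, Set.mem_singleton_iff]
    tauto
  by_cases e3 : y ^ 2 = z ^ 2
  · have e := (sq_eq_sq_iff_eq_or_eq_neg.1 e3).resolve_left hyz
    have hx := eq_zero_of_moments (u := v) (v := w) (w := u) e hxy hxz hu
      (by linear_combination h0) (by linear_combination h2)
    refine ⟨z, hne hyz e, ?_⟩
    rw [hx, e]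
    ext t
    simp only [Set.mem_insert_iff, Set.mem_singleton_iff]
    tauto
  have hx := eq_zero_of_moments_of_sq_ne e1 e2 hu h0 h2 h4
  have hy := eq_zero_of_moments_of_sq_ne (u := v) (v := u) (w := w) (Ne.symm e1) e3 hv
    (by linear_combination h0) (by linear_combination h2) (by linear_combination h4)
  exact absurd (hx.trans hy.symm) hxy

/-! ### Sign arguments for positive weights -/

/-- Here `p > q > r` are the cotangents from `α`, and `h'` is the first moment at the middle vector.
If `q > 0`, then `h` gives `p < -r`, and by the addition theorem both summands of `h'` are negative.
-/
theorem middle_nonpos {p q r κ μ : ℝ} (hpq : q < p) (hqr : r < q) (hκ : 0 < κ) (hμ : 0 < μ)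
    (h : p * (1 + p ^ 2) + q * (1 + q ^ 2) + r * (1 + r ^ 2) = 0)
    (h' : μ * (-q * (1 + (-q) ^ 2)) +
      κ * ((q * p + 1) / (q - p) * (1 + ((q * p + 1) / (q - p)) ^ 2) +
        (q * r + 1) / (q - r) * (1 + ((q * r + 1) / (q - r)) ^ 2)) = 0) : q ≤ 0 := by
  by_contra! hq
  have hGq : 0 < q * (1 + q ^ 2) := by positivity
  have hp : p < -r := by
    rw [← cubic_lt]
    linarith
  have hr : r < 0 := by linarith
  have hBA : (q * r + 1) / (q - r) < (q * p + 1) / (p - q) := by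
    rw [div_lt_div_iff₀ (by linarith) (by linarith)]
    nlinarith [mul_pos hq (sub_pos.2 hpq), mul_pos (mul_pos hq (sub_pos.2 hpq)) (neg_pos.2 hr),
      mul_pos (mul_pos hq (hq.trans hpq)) (sub_pos.2 hqr)]
  have hA : (q * p + 1) / (q - p) = -((q * p + 1) / (p - q)) := by
    rw [← neg_sub p q, div_neg]
  rw [hA] at h'
  have hlt := cubic_lt.2 hBA
  nlinarith [mul_pos hμ hGq, mul_pos hκ (sub_pos.2 hlt)]

theorem middle_eq_zero {p q r κ μ : ℝ} (hpq : q < p) (hqr : r < q) (hκ : 0 < κ) (hμ : 0 < μ)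
    (h : p * (1 + p ^ 2) + q * (1 + q ^ 2) + r * (1 + r ^ 2) = 0)
    (h' : μ * (-q * (1 + (-q) ^ 2)) +
      κ * ((q * p + 1) / (q - p) * (1 + ((q * p + 1) / (q - p)) ^ 2) +
        (q * r + 1) / (q - r) * (1 + ((q * r + 1) / (q - r)) ^ 2)) = 0) : q = 0 := by
  refine le_antisymm (middle_nonpos hpq hqr hκ hμ h h') ?_
  -- Reflection of the configuration negates the cotangents and reverses their order.
  have := middle_nonpos (p := -r) (q := -q) (r := -p) (by linarith) (by linarith) hκ hμ
    (by linear_combination -h) (by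
      have e1 : (-q * -r + 1) / (-q - -r) = -((q * r + 1) / (q - r)) := by
        rw [← div_neg]; congr 1 <;> ring
      have e2 : (-q * -p + 1) / (-q - -p) = -((q * p + 1) / (q - p)) := by
        rw [← div_neg]; congr 1 <;> ring
      rw [e1, e2]
      linear_combination -h')
  linarith

theorem pos_impossible {p q s : ℝ} (hp : 0 < p)
    (h0 : 3 * (p * (1 + p ^ 2)) + q * (1 + q ^ 2) + s * (1 + s ^ 2) = 0)
    (h2 : 3 * (p * (1 + p ^ 2) * p ^ 2) + q * (1 + q ^ 2) * q ^ 2 + s * (1 + s ^ 2) * s ^ 2 = 0) :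
    False := by
  have hGp : 0 < p * (1 + p ^ 2) := by positivity
  -- If `q ≥ 0`, then `-s` exceeds both `p` and `q`, and `s²` times the first relation minus the
  -- second is positive.
  have mixed : ∀ q s : ℝ, 0 ≤ q → 3 * (p * (1 + p ^ 2)) + q * (1 + q ^ 2) + s * (1 + s ^ 2) = 0 →
      3 * (p * (1 + p ^ 2) * p ^ 2) + q * (1 + q ^ 2) * q ^ 2 + s * (1 + s ^ 2) * s ^ 2 = 0 →
      False := by
    intro q s hq h0 h2
    have hGq : 0 ≤ q * (1 + q ^ 2) := by positivity
    have h1 : p < -s := by rw [← cubic_lt]; linarith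
    have h3 : q < -s := by rw [← cubic_lt]; linarith
    have h4 : 0 < s ^ 2 - p ^ 2 := by nlinarith
    have h5 : 0 ≤ s ^ 2 - q ^ 2 := by nlinarith
    nlinarith [mul_pos hGp h4, mul_nonneg hGq h5]
  rcases le_total 0 q with hq | hq
  · exact mixed q s hq h0 h2
  rcases le_total 0 s with hs | hs
  · exact mixed s q hs (by linarith) (by linarith)
  obtain ⟨x, rfl⟩ : ∃ x, q = -x := ⟨-q, by ring⟩
  obtain ⟨y, rfl⟩ : ∃ y, s = -y := ⟨-s, by ring⟩
  have hx : 0 ≤ x := by linarith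
  have hy : 0 ≤ y := by linarith
  have e0 : x * (1 + x ^ 2) + y * (1 + y ^ 2) = 3 * (p * (1 + p ^ 2)) := by linarith
  have e2 : x * (1 + x ^ 2) * x ^ 2 + y * (1 + y ^ 2) * y ^ 2 =
      p ^ 2 * (x * (1 + x ^ 2) + y * (1 + y ^ 2)) := by linear_combination -h2 - p ^ 2 * e0
  -- The mean of `x², y²` with weights `G(x), G(y)` is `p²`. By Chebyshev's inequality the plain
  -- mean is at most `p²`, so `x + y ≤ 2p` and `x³ + y³ < 3p³`; this contradicts `G(x) + G(y) = 3
  -- G(p)`.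
  have cheb : 0 ≤ (x * (1 + x ^ 2) - y * (1 + y ^ 2)) * (x ^ 2 - y ^ 2) := by
    have : (x * (1 + x ^ 2) - y * (1 + y ^ 2)) * (x ^ 2 - y ^ 2) =
        (x - y) ^ 2 * ((1 + x ^ 2 + x * y + y ^ 2) * (x + y)) := by ring
    rw [this]
    positivity
  have hsum : x ^ 2 + y ^ 2 ≤ 2 * p ^ 2 := by
    by_contra! hlt
    have hpos : 0 < x * (1 + x ^ 2) + y * (1 + y ^ 2) := by linarith
    nlinarith [mul_pos hpos (sub_pos.2 hlt)]
  have hlin : x + y ≤ 2 * p := by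
    apply le_of_sq_le_sq _ (by positivity)
    nlinarith [sq_nonneg (x - y)]
  have hcub : x ^ 3 + y ^ 3 < 3 * p ^ 3 := by
    apply lt_of_pow_lt_pow_left₀ 2 (by positivity)
    have hp6 : 0 < p ^ 6 := by positivity
    have a1 : (x ^ 3 + y ^ 3) ^ 2 ≤ (x ^ 2 + y ^ 2) * (x ^ 4 + y ^ 4) := by
      nlinarith [mul_nonneg (mul_nonneg (sq_nonneg x) (sq_nonneg y)) (sq_nonneg (x - y))]
    have a2 : x ^ 4 + y ^ 4 ≤ (x ^ 2 + y ^ 2) ^ 2 := by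
      nlinarith [mul_nonneg (sq_nonneg x) (sq_nonneg y)]
    have a3 : (x ^ 2 + y ^ 2) ^ 3 ≤ (2 * p ^ 2) ^ 3 := pow_le_pow_left₀ (by positivity) hsum 3
    have a4 := mul_le_mul_of_nonneg_left a2 (show 0 ≤ x ^ 2 + y ^ 2 by positivity)
    nlinarith
  nlinarith

theorem eq_zero_of_weights {p q s : ℝ}
    (h0 : 3 * (p * (1 + p ^ 2)) + q * (1 + q ^ 2) + s * (1 + s ^ 2) = 0)
    (h2 : 3 * (p * (1 + p ^ 2) * p ^ 2) + q * (1 + q ^ 2) * q ^ 2 + s * (1 + s ^ 2) * s ^ 2 = 0) :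
    p = 0 ∧ q = -s := by
  have hp : p = 0 := by
    rcases lt_trichotomy p 0 with h | h | h
    · exact (pos_impossible (p := -p) (q := -q) (s := -s) (by linarith)
        (by linear_combination -h0) (by linear_combination -h2)).elim
    · exact h
    · exact (pos_impossible h h0 h2).elim
  refine ⟨hp, ?_⟩
  rw [hp] at h0
  rw [← cubic_inj]
  linear_combination h0

theorem erase_eq_triple {ι : Type*} [DecidableEq ι] {H : Finset ι} (hcard : H.card = 4)
    {α β γ δ : ι} (hα : α ∈ H) (hβ : β ∈ H) (hγ : γ ∈ H) (hδ : δ ∈ H) (hαβ : α ≠ β) (hαγ : α ≠ γ)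
    (hαδ : α ≠ δ) (hβγ : β ≠ γ) (hβδ : β ≠ δ) (hγδ : γ ≠ δ) : H.erase α = {β, γ, δ} := by
  refine (Finset.eq_of_subset_of_card_le ?_ ?_).symm
  · simp [Finset.insert_subset_iff, hβ, hγ, hδ, hαβ.symm, hαγ.symm, hαδ.symm]
  · rw [Finset.card_erase_of_mem hα, hcard, Finset.card_eq_three.2 ⟨β, γ, δ, hβγ, hβδ, hγδ, rfl⟩]

theorem exists_subset_singleton {ι : Type*} {H S : Finset ι} (hne : H.Nonempty) (hS : S ⊆ H)
    (hle : S.card ≤ 1) : ∃ α ∈ H, S ⊆ {α} := by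
  rcases S.eq_empty_or_nonempty with rfl | ⟨α, hα⟩
  · obtain ⟨α, hα⟩ := hne
    exact ⟨α, hα, Finset.empty_subset _⟩
  · exact ⟨α, hS hα, fun x hx => Finset.mem_singleton.2 (Finset.card_le_one.1 hle x hx α hα)⟩

theorem exists_sorted_triple {ι : Type*} [DecidableEq ι] {s : Finset ι} (hcard : s.card = 3)
    {f : ι → ℝ} (hf : ∀ x ∈ s, ∀ y ∈ s, x ≠ y → f x ≠ f y) :
    ∃ x ∈ s, ∃ y ∈ s, ∃ z ∈ s, f y < f x ∧ f z < f y := by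
  obtain ⟨x, y, z, hxy, hxz, hyz, rfl⟩ := Finset.card_eq_three.1 hcard
  have h1 := hf x (by simp) y (by simp) hxy
  have h2 := hf x (by simp) z (by simp) hxz
  have h3 := hf y (by simp) z (by simp) hyz
  rcases h1.lt_or_gt with h1 | h1 <;> rcases h2.lt_or_gt with h2 | h2 <;>
    rcases h3.lt_or_gt with h3 | h3
  · exact ⟨z, by simp, y, by simp, x, by simp, h3, h1⟩
  · exact ⟨y, by simp, z, by simp, x, by simp, h3, h2⟩
  · linarith
  · exact ⟨y, by simp, x, by simp, z, by simp, h1, h2⟩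
  · exact ⟨z, by simp, x, by simp, y, by simp, h2, h1⟩
  · linarith
  · exact ⟨x, by simp, z, by simp, y, by simp, h2, h3⟩
  · exact ⟨x, by simp, y, by simp, z, by simp, h1, h3⟩

namespace MomentCondition

variable {H : Finset Plane} {C₀ : Plane → ℂ}

theorem moment_four (hcard : H.card = 4) {α β γ δ : Plane} (hα : α ∈ H) (hβ : β ∈ H) (hγ : γ ∈ H)
    (hδ : δ ∈ H) (hαβ : α ≠ β) (hαγ : α ≠ γ) (hαδ : α ≠ δ) (hβγ : β ≠ γ) (hβδ : β ≠ δ)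
    (hγδ : γ ≠ δ) (j : ℕ) :
    moment H C₀ α j =
      weight C₀ β * ((cot α β * (1 + cot α β ^ 2) * cot α β ^ j : ℝ) : ℂ) +
      weight C₀ γ * ((cot α γ * (1 + cot α γ ^ 2) * cot α γ ^ j : ℝ) : ℂ) +
      weight C₀ δ * ((cot α δ * (1 + cot α δ ^ 2) * cot α δ ^ j : ℝ) : ℂ) := by
  rw [moment, erase_eq_triple hcard hα hβ hγ hδ hαβ hαγ hαδ hβγ hβδ hγδ,
    Finset.sum_insert (by simp [hβγ, hβδ]), Finset.sum_pair hγδ, add_assoc]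

/-- The cotangents of the other vectors, seen from `α`, are `0`, `p` and `-p`. -/
def IsBalanced (H : Finset Plane) (α : Plane) : Prop :=
  ∃ p : ℝ, p ≠ 0 ∧ cot α '' (H.erase α : Set Plane) = {0, p, -p}

theorem isBalanced_of_weight_ne (h : MomentCondition H C₀) (hcard : H.card = 4) {α : Plane}
    (hα : α ∈ H) (h2 : weight C₀ α ≠ 2) (h6 : weight C₀ α ≠ 6) : IsBalanced H α := by
  have hc3 : (H.erase α).card = 3 := by rw [Finset.card_erase_of_mem hα, hcard]
  obtain ⟨β, γ, δ, hβγ, hβδ, hγδ, hE⟩ := Finset.card_eq_three.1 hc3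
  obtain ⟨hβα, hβ⟩ := Finset.mem_erase.1 (show β ∈ H.erase α by simp [hE])
  obtain ⟨hγα, hγ⟩ := Finset.mem_erase.1 (show γ ∈ H.erase α by simp [hE])
  obtain ⟨hδα, hδ⟩ := Finset.mem_erase.1 (show δ ∈ H.erase α by simp [hE])
  have m0 := h.first α hα
  have m2 := h.third α hα h2
  have m4 := h.fifth α hα h2 h6
  rw [moment_four hcard hα hβ hγ hδ hβα.symm hγα.symm hδα.symm hβγ hβδ hγδ] at m0 m2 m4
  simp only [pow_zero, mul_one] at m0
  obtain ⟨p, hp, e⟩ := eq_triple_of_moments (h.cot_ne hα hβ hγ hβα.symm hγα.symm hβγ)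
    (h.cot_ne hα hβ hδ hβα.symm hδα.symm hβδ) (h.cot_ne hα hγ hδ hγα.symm hδα.symm hγδ)
    (h.weight_ne β hβ) (h.weight_ne γ hγ) (h.weight_ne δ hδ) m0 m2 m4
  refine ⟨p, hp, ?_⟩
  rw [hE, ← e, Finset.coe_insert, Finset.coe_pair, Set.image_insert_eq, Set.image_pair]

/-- Only first moments are used, at `α` and at the vector with the middle cotangent:
`middle_eq_zero` makes that cotangent `0`, and injectivity of `G` makes the outer two opposite. -/
theorem isBalanced_of_weights_eq (h : MomentCondition H C₀) (hcard : H.card = 4) {α : Plane}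
    (hα : α ∈ H) {κ μ : ℝ} (hκ : 0 < κ) (hμ : 0 < μ) (hwα : weight C₀ α = μ)
    (hw : ∀ β ∈ H.erase α, weight C₀ β = κ) : IsBalanced H α := by
  have hc3 : (H.erase α).card = 3 := by rw [Finset.card_erase_of_mem hα, hcard]
  obtain ⟨β, hβE, γ, hγE, δ, hδE, h1, h2⟩ := exists_sorted_triple (f := cot α) hc3 (by
    intro x hx y hy hxy
    obtain ⟨hxα, hxH⟩ := Finset.mem_erase.1 hx
    obtain ⟨hyα, hyH⟩ := Finset.mem_erase.1 hy
    exact h.cot_ne hα hxH hyH hxα.symm hyα.symm hxy)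
  obtain ⟨hβα, hβ⟩ := Finset.mem_erase.1 hβE
  obtain ⟨hγα, hγ⟩ := Finset.mem_erase.1 hγE
  obtain ⟨hδα, hδ⟩ := Finset.mem_erase.1 hδE
  have hβγ : β ≠ γ := by rintro rfl; exact lt_irrefl _ h1
  have hγδ : γ ≠ δ := by rintro rfl; exact lt_irrefl _ h2
  have hβδ : β ≠ δ := by rintro rfl; exact lt_asymm h1 h2
  have m0 := h.first α hα
  have m1 := h.first γ hγ
  rw [moment_four hcard hα hβ hγ hδ hβα.symm hγα.symm hδα.symm hβγ hβδ hγδ, hw β hβE, hw γ hγE,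
    hw δ hδE] at m0
  rw [moment_four hcard hγ hα hβ hδ hγα hβγ.symm hγδ hβα.symm hδα.symm hβδ, hwα, hw β hβE,
    hw δ hδE, cot_swap α γ,
    cot_sub (h.cross_ne α hα γ hγ hγα.symm) (h.cross_ne α hα β hβ hβα.symm)
      (h.cross_ne γ hγ β hβ hβγ.symm),
    cot_sub (h.cross_ne α hα γ hγ hγα.symm) (h.cross_ne α hα δ hδ hδα.symm)
      (h.cross_ne γ hγ δ hδ hγδ)] at m1
  simp only [pow_zero, mul_one] at m0 m1
  have r0 : cot α β * (1 + cot α β ^ 2) + cot α γ * (1 + cot α γ ^ 2) +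
      cot α δ * (1 + cot α δ ^ 2) = 0 := by
    have e : κ * (cot α β * (1 + cot α β ^ 2) + cot α γ * (1 + cot α γ ^ 2) +
        cot α δ * (1 + cot α δ ^ 2)) = 0 := by
      rw [mul_add, mul_add]
      exact_mod_cast m0
    exact (mul_eq_zero.1 e).resolve_left hκ.ne'
  have hq : cot α γ = 0 := by
    refine middle_eq_zero h1 h2 hκ hμ r0 ?_
    rw [mul_add κ, ← add_assoc]
    exact_mod_cast m1
  have hr : cot α δ = -cot α β := by
    rw [← cubic_inj]
    rw [hq] at r0
    linear_combination r0
  refine ⟨cot α β, ?_, ?_⟩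
  · rw [hq] at h1
    exact h1.ne'
  · rw [erase_eq_triple hcard hα hγ hβ hδ hγα.symm hβα.symm hδα.symm hβγ.symm hγδ hβδ,
      Finset.coe_insert, Finset.coe_pair, Set.image_insert_eq, Set.image_pair, hq, hr]

theorem isBalanced_of_two (h : MomentCondition H C₀) (hcard : H.card = 4) {α β γ δ : Plane}
    (hα : α ∈ H) (hβ : β ∈ H) (hγ : γ ∈ H)
    (hδ : δ ∈ H) (hαβ : α ≠ β) (hαγ : α ≠ γ) (hαδ : α ≠ δ) (hβγ : β ≠ γ) (hβδ : β ≠ δ)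
    (hγδ : γ ≠ δ) (hwα : weight C₀ α = 6) (hwβ : weight C₀ β = 6) (hwγ : weight C₀ γ = 2)
    (hwδ : weight C₀ δ = 2) : IsBalanced H α := by
  have m0 := h.first α hα
  have m2 := h.third α hα (by rw [hwα]; norm_num)
  rw [moment_four hcard hα hβ hγ hδ hαβ hαγ hαδ hβγ hβδ hγδ, hwβ, hwγ, hwδ] at m0 m2
  simp only [pow_zero, mul_one] at m0
  have r0 : 6 * (cot α β * (1 + cot α β ^ 2)) + 2 * (cot α γ * (1 + cot α γ ^ 2)) +
      2 * (cot α δ * (1 + cot α δ ^ 2)) = 0 := by exact_mod_cast m0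
  have r2 : 6 * (cot α β * (1 + cot α β ^ 2) * cot α β ^ 2) +
      2 * (cot α γ * (1 + cot α γ ^ 2) * cot α γ ^ 2) +
      2 * (cot α δ * (1 + cot α δ ^ 2) * cot α δ ^ 2) = 0 := by exact_mod_cast m2
  obtain ⟨hp, hqs⟩ := eq_zero_of_weights (p := cot α β) (q := cot α γ) (s := cot α δ)
    (by linear_combination r0 / 2)
    (by linear_combination r2 / 2)
  refine ⟨cot α δ, fun h0 => ?_, ?_⟩
  · exact h.cot_ne hα hβ hδ hαβ hαδ hβδ (by rw [hp, h0])
  · rw [erase_eq_triple hcard hα hβ hδ hγ hαβ hαδ hαγ hβδ hβγ hγδ.symm, Finset.coe_insert,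
      Finset.coe_pair, Set.image_insert_eq, Set.image_pair, hp, hqs]

/-- A weight other than `2` and `6` gives three moments at its vector. Otherwise either three
weights agree and the remaining vector is chosen, or the weights are `6, 6, 2, 2` and a vector of
weight `6` is chosen. -/
theorem exists_isBalanced (h : MomentCondition H C₀) (hcard : H.card = 4) :
    ∃ α ∈ H, IsBalanced H α := by
  classical
  by_cases hall : ∀ α ∈ H, weight C₀ α = 2 ∨ weight C₀ α = 6
  swap
  · push Not at hall
    obtain ⟨α, hα, h2, h6⟩ := hall
    exact ⟨α, hα, h.isBalanced_of_weight_ne hcard hα h2 h6⟩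
  have hreal : ∀ α ∈ H, ∃ μ : ℝ, 0 < μ ∧ weight C₀ α = μ := by
    intro α hα
    rcases hall α hα with e | e
    · exact ⟨2, by norm_num, by rw [e]; norm_num⟩
    · exact ⟨6, by norm_num, by rw [e]; norm_num⟩
  have hequal : ∀ α ∈ H, ∀ κ : ℝ, 0 < κ → (∀ β ∈ H.erase α, weight C₀ β = κ) →
      IsBalanced H α := by
    intro α hα κ hκ hw
    obtain ⟨μ, hμ, e⟩ := hreal α hα
    exact h.isBalanced_of_weights_eq hcard hα hκ hμ e hw
  set S := H.filter fun α => weight C₀ α = 6 with hS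
  set T := H.filter fun α => ¬ weight C₀ α = 6 with hT
  have hcards : S.card + T.card = 4 := by
    rw [hS, hT, Finset.card_filter_add_card_filter_not, hcard]
  have hTw : ∀ α ∈ T, weight C₀ α = 2 := fun α hα =>
    (hall α (Finset.mem_filter.1 hα).1).resolve_right (Finset.mem_filter.1 hα).2
  have hne : H.Nonempty := Finset.card_pos.1 (by omega)
  have hSle : S.card ≤ 1 → ∃ α ∈ H, IsBalanced H α := by
    intro hle
    obtain ⟨α, hα, hsub⟩ := exists_subset_singleton hne (Finset.filter_subset _ H) hle
    refine ⟨α, hα, hequal α hα 2 (by norm_num) fun β hβ => ?_⟩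
    obtain ⟨hβα, hβH⟩ := Finset.mem_erase.1 hβ
    rcases hall β hβH with e | e
    · rw [e]; norm_num
    · exact absurd (Finset.mem_singleton.1 (hsub (Finset.mem_filter.2 ⟨hβH, e⟩))) hβα
  have hTle : T.card ≤ 1 → ∃ α ∈ H, IsBalanced H α := by
    intro hle
    obtain ⟨α, hα, hsub⟩ := exists_subset_singleton hne (Finset.filter_subset _ H) hle
    refine ⟨α, hα, hequal α hα 6 (by norm_num) fun β hβ => ?_⟩
    obtain ⟨hβα, hβH⟩ := Finset.mem_erase.1 hβ
    by_cases e : weight C₀ β = 6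
    · rw [e]; norm_num
    · exact absurd (Finset.mem_singleton.1 (hsub (Finset.mem_filter.2 ⟨hβH, e⟩))) hβα
  by_cases hS1 : S.card ≤ 1
  · exact hSle hS1
  by_cases hT1 : T.card ≤ 1
  · exact hTle hT1
  obtain ⟨α, β, hαβ, eS⟩ := Finset.card_eq_two.1 (show S.card = 2 by omega)
  obtain ⟨γ, δ, hγδ, eT⟩ := Finset.card_eq_two.1 (show T.card = 2 by omega)
  have hα : α ∈ S := by simp [eS]
  have hβ : β ∈ S := by simp [eS]
  have hγ : γ ∈ T := by simp [eT]
  have hδ : δ ∈ T := by simp [eT]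
  have hST : ∀ x ∈ S, ∀ y ∈ T, x ≠ y := by
    rintro x hx y hy rfl
    exact (Finset.mem_filter.1 hy).2 (Finset.mem_filter.1 hx).2
  have hHS : ∀ x ∈ S, x ∈ H := fun x hx => (Finset.mem_filter.1 hx).1
  have hHT : ∀ x ∈ T, x ∈ H := fun x hx => (Finset.mem_filter.1 hx).1
  exact ⟨α, hHS α hα, h.isBalanced_of_two hcard (hHS α hα) (hHS β hβ) (hHT γ hγ) (hHT δ hδ) hαβ
    (hST α hα γ hγ) (hST α hα δ hδ) (hST β hβ γ hγ) (hST β hβ δ hδ) hγδ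
    (Finset.mem_filter.1 hα).2 (Finset.mem_filter.1 hβ).2 (hTw γ hγ) (hTw δ hδ)⟩

theorem locusEquiv_four (h : MomentCondition H C₀) (hcard : H.card = 4) :
    ∃ a : ℝ, a ≠ 0 ∧ LocusEquiv (H : Set Plane) {vec 1 0, vec 0 1, vec a 1, vec (-a) 1} := by
  obtain ⟨α, hα, p, hp, e⟩ := h.exists_isBalanced hcard
  refine ⟨p, hp, ?_⟩
  have he := h.locusEquiv (by omega) hα
  rwa [← Set.image_image (fun y => vec y 1), e, Set.image_insert_eq, Set.image_pair] at he

end MomentCondition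

end RankTwo

end

theorem theorem1p3 (H : Finset RankTwo.Plane) (C : RankTwo.Plane → ℂ)
    (hH : RankTwo.MutuallyNonParallel H) (hC : ∀ α ∈ H, C α ≠ 0)
    (hP : RankTwo.HasNontrivialCommutant H C) :
    (H.card = 2 →
      (∀ α ∈ H, ∀ β ∈ H, α ≠ β → inner ℝ α β = 0) ∧ RankTwo.IsOfTypeA1A1 (H : Set RankTwo.Plane)) ∧
    (H.card = 3 →
      (∃ a : ℝ, a ≠ 0 ∧
        RankTwo.LocusEquiv (H : Set RankTwo.Plane)
          {RankTwo.vec 1 0, RankTwo.vec a 1, RankTwo.vec (-a) 1}) ∧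
      (¬ RankTwo.IsOfTypeA2 (H : Set RankTwo.Plane) →
        ∀ (a : ℝ) (C' : RankTwo.Plane → ℂ), a ≠ 0 →
          RankTwo.LocusEquivWith (H : Set RankTwo.Plane) C
            {RankTwo.vec 1 0, RankTwo.vec a 1, RankTwo.vec (-a) 1} C' →
          RankTwo.CouplingOne C' (RankTwo.vec a 1) ∧
          RankTwo.CouplingOne C' (RankTwo.vec (-a) 1) ∧
          C' (RankTwo.vec 1 0) = (1 - (a : ℂ) ^ 4) / (4 * (a : ℂ) ^ 4))) ∧
    (H.card = 4 →
      ∃ a : ℝ, a ≠ 0 ∧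
        RankTwo.LocusEquiv (H : Set RankTwo.Plane)
          {RankTwo.vec 1 0, RankTwo.vec 0 1, RankTwo.vec a 1, RankTwo.vec (-a) 1}) := by
  have h := fun hcard => RankTwo.momentCondition_of_commutant hH hC hP hcard
  refine ⟨fun hcard => ?_, fun hcard => ?_, fun hcard => ?_⟩
  · have h2 := h (by omega)
    exact ⟨fun α hα β hβ => h2.orthogonal hcard hα hβ, h2.isOfTypeA1A1 hcard⟩
  · have h3 := h (by omega)
    exact ⟨h3.locusEquiv_three hcard, fun hA2 a C' ha hE => h3.deformed_A2 hcard hA2 ha hE⟩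
  · exact (h (by omega)).locusEquiv_four hcard
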